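/- **Setting.** Let $N,M,R\ge 1$, let $A=A_1A_2\in\mathbb C^{N\times M}$ with $A_1=\sum_{j=1}^R\|u_j\|\,|u_j\rangle\langle j|\in\mathbb C^{N\times R}$ (of arbitrary, possibly low, rank) and $A_2=\sum_{j=1}^R\|v_j\|\,|j\rangle\langle v_j|\in\mathbb C^{R\times M}$ with $\operatorname{rank}(A_2)=R$, and let $b=\|b\|\,|b\rangle\in\mathbb C^N$ with $\|b\|>0$. The norms $\|u_j\|,\|v_j\|\ge 0$ and $\|b\|$ are given classically. The unit vectors $|u_j\rangle,|b\rangle\in\mathbb C^N$ and $|v_j\rangle\in\mathbb C^M$ are given by quantum circuits of one- and two-qubit gates that prepare them from $|0\cdots0\rangle$ on $\lceil\log_2N\rceil$, respectively $\lceil\log_2M\rceil$, qubits (vectors are padded with zeros), of depth at most $D(\log N)$, respectively $D(\log M)$, where $D$ is a fixed polynomial. Let $\Gamma=\max_{1\le j\le R}\{\|u_j\|^2,\|u_j\|\,\|b\|,\|v_j\|^2\}$, let $\|B\|$ be the largest and $\sigma_{\min}(B)$ the smallest nonzero singular value of a matrix $B$, and let $\kappa(B)=\|B\|/\sigma_{\min}(B)$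 (with $\sigma_{\min}(0)=\kappa(0)=0$). A *hybrid algorithm* is a single program for all instances. It receives $R,N,M$, the norms above, $\|A_1\|,\sigma_{\min}(A_1),\|A_2\|,\sigma_{\min}(A_2)$, the accuracy $\varepsilon$ and a confidence parameter $k\in\mathbb N$, $k\ge1$. It performs classical operations (exact arithmetic on complex numbers, comparisons, loops) at unit cost, except that rounding up to a natural number $m$ costs $m+O(1)$, and it accesses the vectors only by runs of the Hadamard tests for $\langle u_i|u_j\rangle$, $\langle u_i|b\rangle$, $\langle v_i|v_j\rangle$; each run returns one measured bit, distributed according to the Born rule, and costs the number of gates of its circuit (gates on the ancilla, and the gates of the given circuits or their inverses controlled by the ancilla), up to an additive constant. **Theorem.** There is a hybrid algorithm such that for every constant $c>0$ and every polynomial $D$ there is a polynomial $p$ in five variables with the following property. For every instance as above with $\max\{\Gamma,\|A_2\|\}\ge c$, every $0<\varepsilon\le 1/c$ and every $k\ge1$, the algorithm always stops within time $$k\cdot\frac{R^3\,\Gamma^2\;p\big(\kappa(A_1),\kappa(A_2),\log M,\log N,\|b\|\big)}{\varepsilon^4},$$ and with probability at least $1-2^{-k}$ it outputs a classical vector $s=(s_1,\dots,s_R)\in\mathbb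 C^R$ such that $\hat x=\sum_{j=1}^R s_j|v_j\rangle$ satisfies $$\|A\hat x-b\|-\min_{x\in\mathbb C^M}\|Ax-b\|\le\varepsilon .$$ -/

import Mathlib

open scoped Matrix

noncomputable section

namespace Hybrid

/-! ### Quantum circuits -/

/-- Computational basis states of `n` qubits. -/
abbrev Bits (n : ℕ) : Type := Fin n → Bool

/-- A one- or two-qubit gate on `n` qubits. -/
inductive Gate (n : ℕ) : Type where
  | one (q : Fin n) (U : Matrix.unitaryGroup Bool ℂ)
  | two (p q : Fin n) (hpq : p ≠ q) (U : Matrix.unitaryGroup (Bool × Bool) ℂ)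

namespace Gate

variable {n : ℕ}

/-- The qubits a gate acts on. -/
def wires : Gate n → Finset (Fin n)
  | one q _ => {q}
  | two p q _ _ => {p, q}

/-- The action of a gate on a vector of amplitudes. -/
def apply : Gate n → (Bits n → ℂ) → (Bits n → ℂ)
  | one q U, ψ => fun x => ∑ a : Bool, U.1 (x q) a * ψ (Function.update x q a)
  | two p q _ U, ψ => fun x => ∑ a : Bool × Bool,
      U.1 (x p, x q) a * ψ (Function.update (Function.update x p a.1) q a.2)

/-- The inverse gate. -/
def inv : Gate n → Gate n
  | one q U => one q U⁻¹
  | two p q h U => two p q h U⁻¹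

end Gate

/-- One layer of a circuit: gates acting on pairwise disjoint sets of qubits. -/
def Layer (n : ℕ) : Type :=
  {l : List (Gate n) // l.Pairwise fun g h => Disjoint g.wires h.wires}

/-- A circuit is a list of layers, applied from the first to the last. -/
abbrev Circuit (n : ℕ) : Type := List (Layer n)

/-- The amplitudes of `|0…0⟩`. -/
def ketZero (n : ℕ) : Bits n → ℂ := fun x => if x = fun _ => false then 1 else 0

namespace Circuit

variable {n : ℕ}

/-- The depth of a circuit is the number of its layers. -/
def depth (C : Circuit n) : ℕ := List.length C

/-- All gates of a circuit, in the order in which they are applied. -/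
def gates (C : Circuit n) : List (Gate n) := List.flatMap (fun l : Layer n => l.1) C

/-- The gates of the inverse circuit, in the order in which they are applied. -/
def invGates (C : Circuit n) : List (Gate n) := C.gates.reverse.map Gate.inv

/-- The state `U|0…0⟩` prepared by the circuit of `U`. -/
def state (C : Circuit n) : Bits n → ℂ := C.gates.foldl (fun ψ g => g.apply ψ) (ketZero n)

end Circuit

/-- The basis state of `n` qubits that encodes the number `i` in binary. -/
def encode (n i : ℕ) : Bits n := fun q => i.testBit q

/-- The vector of `ℂᴺ` whose coordinates are the first `N` amplitudes of the state that the circuit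
prepares on `⌈log₂ N⌉` qubits. -/
def ketOf (N : ℕ) (C : Circuit (Nat.clog 2 N)) : Fin N → ℂ := fun i => C.state (encode _ i)

/-- The prepared state is a vector of `ℂᴺ`: the amplitudes beyond the first `N` vanish. This is
automatic when `N` is a power of two. -/
def PreparesIn (N : ℕ) (C : Circuit (Nat.clog 2 N)) : Prop :=
  ∀ x, (∀ i : Fin N, encode _ i ≠ x) → C.state x = 0

/-! ### The Hadamard test -/

/-- The Hadamard gate. -/
def hadamard : Matrix.unitaryGroup Bool ℂ :=
  ⟨Matrix.of fun a b => if a && b then -((√2 : ℝ) : ℂ)⁻¹ else ((√2 : ℝ) : ℂ)⁻¹, by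
    have h : ((√2 : ℝ) : ℂ)⁻¹ * ((√2 : ℝ) : ℂ)⁻¹ = 1 / 2 := by
      rw [← mul_inv, ← Complex.ofReal_mul, Real.mul_self_sqrt (by norm_num)]
      norm_num
    rw [Matrix.mem_unitaryGroup_iff]
    ext a b
    cases a <;> cases b <;>
      simp [Matrix.mul_apply, Matrix.star_apply, Complex.conj_ofReal, h] <;> norm_num⟩

/-- The phase gate. -/
def phase : Matrix.unitaryGroup Bool ℂ :=
  ⟨Matrix.diagonal fun a => if a then Complex.I else 1, by
    rw [Matrix.mem_unitaryGroup_iff]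
    ext a b
    cases a <;> cases b <;>
      simp [Matrix.mul_apply, Matrix.star_apply, Matrix.diagonal]⟩

/-- An elementary operation on one ancilla qubit and `n` further qubits: a gate on the ancilla, or a
gate on the other qubits controlled by the ancilla. -/
inductive TestGate (n : ℕ) : Type where
  | ancilla (U : Matrix.unitaryGroup Bool ℂ)
  | controlled (g : Gate n)

/-- The action of an elementary operation on amplitudes. -/
def TestGate.apply {n : ℕ} : TestGate n → (Bool × Bits n → ℂ) → (Bool × Bits n → ℂ)
  | .ancilla U, ψ => fun z => ∑ a : Bool, U.1 z.1 a * ψ (a, z.2)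
  | .controlled g, ψ => fun z => if z.1 then g.apply (fun x => ψ (true, x)) z.2 else ψ z

/-- The circuit of the Hadamard test of `{|0…0⟩, V†U}`, where `C` is the circuit of `U` and `C'` that
of `V`: a Hadamard gate on the ancilla, the controlled `V†U`, possibly a phase gate on the ancilla,
and another Hadamard gate on the ancilla. -/
def testGates {n : ℕ} (ph : Bool) (C' C : Circuit n) : List (TestGate n) :=
  .ancilla hadamard :: (C.gates ++ C'.invGates).map .controlled ++
    (if ph then [.ancilla phase] else []) ++ [.ancilla hadamard]

/-- The state at the end of the Hadamard test, started from `|0⟩|0…0⟩`. -/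
def testState {n : ℕ} (ph : Bool) (C' C : Circuit n) : Bool × Bits n → ℂ :=
  (testGates ph C' C).foldl (fun ψ g => g.apply ψ)
    fun z => if z.1 then 0 else ketZero n z.2

/-! Gates preserve the norm of the amplitudes, so that measurement probabilities add up to one. -/

theorem sum_normSq_unitary {ι : Type*} [Fintype ι] [DecidableEq ι] (U : Matrix.unitaryGroup ι ℂ)
    (v : ι → ℂ) : ∑ a, ‖∑ b, U.1 a b * v b‖ ^ 2 = ∑ a, ‖v a‖ ^ 2 := by
  have key : ∀ w : ι → ℂ, ((∑ a, ‖w a‖ ^ 2 : ℝ) : ℂ) = star w ⬝ᵥ w := by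
    intro w
    simp only [dotProduct, Pi.star_apply, Complex.ofReal_sum, Complex.ofReal_pow]
    exact Finset.sum_congr rfl fun a _ => (Complex.conj_mul' (w a)).symm
  have h : ((∑ a, ‖(U.1 *ᵥ v) a‖ ^ 2 : ℝ) : ℂ) = ((∑ a, ‖v a‖ ^ 2 : ℝ) : ℂ) := by
    rw [key, key, Matrix.star_mulVec, ← Matrix.dotProduct_mulVec, Matrix.mulVec_mulVec,
      ← Matrix.star_eq_conjTranspose, Matrix.mem_unitaryGroup_iff'.1 U.2, Matrix.one_mulVec]
  exact_mod_cast h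

/-- The bits of two distinct wires and the remaining bits. -/
def splitTwo {n : ℕ} (p q : Fin n) (hpq : p ≠ q) :
    Bits n ≃ (Bool × Bool) × ({j : Fin n // j ≠ p ∧ j ≠ q} → Bool) where
  toFun x := ((x p, x q), fun j => x j)
  invFun z := fun j => if h : j ≠ p ∧ j ≠ q then z.2 ⟨j, h⟩ else if j = p then z.1.1 else z.1.2
  left_inv x := by
    funext j
    by_cases hp : j = p
    · simp [hp]
    · by_cases hq : j = q
      · subst hq
        simp [hp]
      · simp [hp, hq]
  right_inv z := by
    refine Prod.ext (Prod.ext ?_ ?_) ?_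
    · simp
    · simp [hpq.symm]
    · funext j
      simp [j.2.1, j.2.2]

theorem Gate.sum_apply {n : ℕ} (g : Gate n) (ψ : Bits n → ℂ) :
    ∑ x, ‖g.apply ψ x‖ ^ 2 = ∑ x, ‖ψ x‖ ^ 2 := by
  cases g with
  | one q U =>
    rw [← (Equiv.funSplitAt q Bool).symm.sum_comp fun x => ‖Gate.apply _ ψ x‖ ^ 2,
      ← (Equiv.funSplitAt q Bool).symm.sum_comp fun x => ‖ψ x‖ ^ 2,
      Fintype.sum_prod_type_right, Fintype.sum_prod_type_right]
    refine Finset.sum_congr rfl fun r _ => ?_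
    refine Eq.trans ?_ (sum_normSq_unitary U _)
    refine Finset.sum_congr rfl fun a _ => ?_
    simp only [Gate.apply]
    congr 2
    refine Finset.sum_congr rfl fun b _ => ?_
    congr 2
    · simp [Equiv.funSplitAt]
    · funext j
      by_cases h : j = q
      · subst h
        simp [Equiv.funSplitAt]
      · simp [Equiv.funSplitAt, h]
  | two p q hpq U =>
    rw [← (splitTwo p q hpq).symm.sum_comp fun x => ‖Gate.apply _ ψ x‖ ^ 2,
      ← (splitTwo p q hpq).symm.sum_comp fun x => ‖ψ x‖ ^ 2,
      Fintype.sum_prod_type_right, Fintype.sum_prod_type_right]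
    refine Finset.sum_congr rfl fun r _ => ?_
    refine Eq.trans ?_ (sum_normSq_unitary U _)
    refine Finset.sum_congr rfl fun a _ => ?_
    simp only [Gate.apply]
    congr 2
    refine Finset.sum_congr rfl fun b _ => ?_
    congr 2
    · simp [splitTwo, hpq.symm]
    · funext j
      by_cases hp : j = p
      · subst hp
        simp [splitTwo, Function.update_of_ne hpq]
      · by_cases hq : j = q
        · subst hq
          simp [splitTwo, hp]
        · simp [splitTwo, hp, hq]

theorem TestGate.sum_apply {n : ℕ} (g : TestGate n) (ψ : Bool × Bits n → ℂ) :
    ∑ z, ‖g.apply ψ z‖ ^ 2 = ∑ z, ‖ψ z‖ ^ 2 := by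
  cases g with
  | ancilla U =>
    rw [Fintype.sum_prod_type_right, Fintype.sum_prod_type_right]
    exact Finset.sum_congr rfl fun x _ => sum_normSq_unitary U fun a => ψ (a, x)
  | controlled g =>
    rw [Fintype.sum_prod_type, Fintype.sum_prod_type]
    simp [TestGate.apply, g.sum_apply]

theorem sum_testState {n : ℕ} (ph : Bool) (C' C : Circuit n) :
    ∑ z, ‖testState ph C' C z‖ ^ 2 = 1 := by
  have h : ∀ (l : List (TestGate n)) (ψ : Bool × Bits n → ℂ),
      ∑ z, ‖l.foldl (fun ψ g => g.apply ψ) ψ z‖ ^ 2 = ∑ z, ‖ψ z‖ ^ 2 := by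
    intro l
    induction l with
    | nil => intro ψ; rfl
    | cons g l ih => intro ψ; rw [List.foldl_cons, ih, g.sum_apply]
  rw [testState, h, Fintype.sum_prod_type]
  simp [ketZero, apply_ite]

/-- One run of the Hadamard test: the ancilla is measured in the computational basis and the outcome
is obtained with the probability given by the Born rule. -/
def measureTest {n : ℕ} (ph : Bool) (C' C : Circuit n) : PMF Bool :=
  PMF.ofFintype (fun a => ENNReal.ofReal (∑ x, ‖testState ph C' C (a, x)‖ ^ 2)) (by
    rw [← ENNReal.ofReal_sum_of_nonneg fun a _ => Finset.sum_nonneg fun x _ => sq_nonneg _,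
      ← Fintype.sum_prod_type', sum_testState, ENNReal.ofReal_one])

/-! ### Singular values -/

/-- The spectral norm `‖A‖`, that is, the largest singular value. -/
def specNorm {N M : ℕ} (A : Matrix (Fin N) (Fin M) ℂ) : ℝ :=
  (Matrix.toEuclideanLin A).singularValues 0

/-- The smallest nonzero singular value (zero for `A = 0`); its reciprocal is the norm of the
pseudo-inverse. -/
def minSingularValue {N M : ℕ} (A : Matrix (Fin N) (Fin M) ℂ) : ℝ :=
  (Matrix.toEuclideanLin A).singularValues (A.rank - 1)

/-- The condition number `κ(A) = ‖A‖ ‖A⁻¹‖`, where `A⁻¹` is the pseudo-inverse. -/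
def condNumber {N M : ℕ} (A : Matrix (Fin N) (Fin M) ℂ) : ℝ := specNorm A / minSingularValue A

/-! ### Factorized linear systems with quantum access -/

/-- A factorized linear system: norms and state preparation circuits for the columns
`normU j • |u_j⟩` of `A₁`, the rows `normV j • ⟨v_j|` of `A₂`, and the vector `normB • |b⟩`. -/
structure FactorizedSystem where
  N : ℕ
  M : ℕ
  R : ℕ
  normU : Fin R → ℝ
  normU_nonneg : ∀ j, 0 ≤ normU j
  circU : Fin R → Circuit (Nat.clog 2 N)
  preparesU : ∀ j, PreparesIn N (circU j)
  normV : Fin R → ℝ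
  normV_nonneg : ∀ j, 0 ≤ normV j
  circV : Fin R → Circuit (Nat.clog 2 M)
  preparesV : ∀ j, PreparesIn M (circV j)
  normB : ℝ
  normB_pos : 0 < normB
  circB : Circuit (Nat.clog 2 N)
  preparesB : PreparesIn N circB

namespace FactorizedSystem

variable (S : FactorizedSystem)

/-- `A₁ = ∑ⱼ ‖u_j‖ |u_j⟩⟨j|`. -/
def A₁ : Matrix (Fin S.N) (Fin S.R) ℂ :=
  Matrix.of fun i j => (S.normU j : ℂ) * ketOf S.N (S.circU j) i

/-- `A₂ = ∑ⱼ ‖v_j‖ |j⟩⟨v_j|`. -/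
def A₂ : Matrix (Fin S.R) (Fin S.M) ℂ :=
  Matrix.of fun j k => (S.normV j : ℂ) * star (ketOf S.M (S.circV j) k)

/-- `A = A₁ A₂`. -/
def A : Matrix (Fin S.N) (Fin S.M) ℂ := S.A₁ * S.A₂

/-- `b = ‖b‖ |b⟩`. -/
def b : Fin S.N → ℂ := fun i => (S.normB : ℂ) * ketOf S.N S.circB i

/-- The size bound `Γ = maxⱼ {‖u_j‖², ‖u_j‖‖b‖, ‖v_j‖²}`. -/
def Γ : ℝ := ⨆ j : Fin S.R, max (max (S.normU j ^ 2) (S.normU j * S.normB)) (S.normV j ^ 2)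

/-- The Euclidean residual `‖A x - b‖`. -/
def residual (x : Fin S.M → ℂ) : ℝ := ‖WithLp.toLp 2 (S.A *ᵥ x - S.b)‖

/-- The vector `∑ⱼ s_j |v_j⟩`. -/
def combine (s : Fin S.R → ℂ) : Fin S.M → ℂ := ∑ j, s j • ketOf S.M (S.circV j)

/-- The depths of the circuits are at most `D (log N)`, respectively `D (log M)`. -/
def DepthBound (D : Polynomial ℝ) : Prop :=
  (∀ j, ((S.circU j).depth : ℝ) ≤ D.eval (Real.log S.N)) ∧
  (∀ j, ((S.circV j).depth : ℝ) ≤ D.eval (Real.log S.M)) ∧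
  (S.circB.depth : ℝ) ≤ D.eval (Real.log S.N)

end FactorizedSystem

/-! ### Hybrid programs

A program works on registers for natural numbers and on two-dimensional arrays of complex numbers.
Every operation has unit cost, except for the Hadamard test, which costs the number of gates of its
circuit, and for rounding a number up to a natural number, which costs the result, like a loop that
counts up to it. A program accesses the states `|u_j⟩`, `|v_j⟩`, `|b⟩` by Hadamard tests only. -/

/-- The classical memory. -/
@[ext]
structure Store where
  nat : ℕ → ℕ
  num : ℕ → ℕ → ℕ → ℂ

namespace Store

/-- Write to a register. -/
def setNat (s : Store) (v n : ℕ) : Store := { s with nat := Function.update s.nat v n }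

/-- Write to an array entry. -/
def setNum (s : Store) (a i j : ℕ) (z : ℂ) : Store :=
  { s with num := fun a' i' j' => if a' = a ∧ i' = i ∧ j' = j then z else s.num a' i' j' }

end Store

/-- Expressions for natural numbers. -/
inductive NatExp : Type where
  | lit (n : ℕ)
  | reg (v : ℕ)
  | add (e f : NatExp)
  | sub (e f : NatExp)

namespace NatExp

/-- The value of an expression. -/
def eval (s : Store) : NatExp → ℕ
  | lit n => n
  | reg v => s.nat v
  | add e f => e.eval s + f.eval s
  | sub e f => e.eval s - f.eval s

/-- The number of operations in an expression. -/
def cost : NatExp → ℕ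
  | lit _ => 1
  | reg _ => 1
  | add e f => e.cost + f.cost + 1
  | sub e f => e.cost + f.cost + 1

end NatExp

/-- Expressions for complex numbers. -/
inductive NumExp : Type where
  | lit (q : ℚ)
  | I
  | ofNat (e : NatExp)
  | entry (a : ℕ) (i j : NatExp)
  | add (e f : NumExp)
  | sub (e f : NumExp)
  | mul (e f : NumExp)
  | div (e f : NumExp)
  | conj (e : NumExp)

namespace NumExp

/-- The value of an expression. -/
def eval (s : Store) : NumExp → ℂ
  | lit q => (q : ℂ)
  | I => Complex.I
  | ofNat e => (e.eval s : ℂ)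
  | entry a i j => s.num a (i.eval s) (j.eval s)
  | add e f => e.eval s + f.eval s
  | sub e f => e.eval s - f.eval s
  | mul e f => e.eval s * f.eval s
  | div e f => e.eval s / f.eval s
  | conj e => star (e.eval s)

/-- The number of operations in an expression. -/
def cost : NumExp → ℕ
  | lit _ => 1
  | I => 1
  | ofNat e => e.cost + 1
  | entry _ i j => i.cost + j.cost + 1
  | add e f => e.cost + f.cost + 1
  | sub e f => e.cost + f.cost + 1
  | mul e f => e.cost + f.cost + 1
  | div e f => e.cost + f.cost + 1
  | conj e => e.cost + 1

end NumExp

/-- Tests: comparison of natural numbers, and of the real parts of complex numbers. -/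
inductive Cond : Type where
  | natEq (e f : NatExp)
  | natLE (e f : NatExp)
  | reLE (e f : NumExp)

namespace Cond

/-- The truth of a test. -/
def Holds (s : Store) : Cond → Prop
  | natEq e f => e.eval s = f.eval s
  | natLE e f => e.eval s ≤ f.eval s
  | reLE e f => (e.eval s).re ≤ (f.eval s).re

/-- The number of operations in a test. -/
def cost : Cond → ℕ
  | natEq e f => e.cost + f.cost + 1
  | natLE e f => e.cost + f.cost + 1
  | reLE e f => e.cost + f.cost + 1

end Cond

/-- The Hadamard tests available to a program, for `⟨u_i|u_j⟩`, `⟨u_i|b⟩` and `⟨v_i|v_j⟩`. -/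
inductive Query : Type where
  | uu (i j : NatExp)
  | ub (i : NatExp)
  | vv (i j : NatExp)

/-- Programs. -/
inductive Prog : Type where
  | skip
  | setNat (v : ℕ) (e : NatExp)
  | ceil (v : ℕ) (e : NumExp)
  | setNum (a : ℕ) (i j : NatExp) (e : NumExp)
  | test (a : ℕ) (i j : NatExp) (ph : Bool) (q : Query)
  | seq (P Q : Prog)
  | ite (c : Cond) (P Q : Prog)
  | loop (v : ℕ) (e : NatExp) (P : Prog)

namespace FactorizedSystem

variable (S : FactorizedSystem)

/-- The circuit with a given index; the empty circuit if the index is out of range. -/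
def lookup {R n : ℕ} (c : Fin R → Circuit n) (i : ℕ) : Circuit n :=
  if h : i < R then c ⟨i, h⟩ else []

/-- The measurement outcome of a Hadamard test. -/
def outcome (s : Store) (ph : Bool) : Query → PMF Bool
  | .uu i j => measureTest ph (lookup S.circU (i.eval s)) (lookup S.circU (j.eval s))
  | .ub i => measureTest ph (lookup S.circU (i.eval s)) S.circB
  | .vv i j => measureTest ph (lookup S.circV (i.eval s)) (lookup S.circV (j.eval s))

/-- The cost of a Hadamard test: the number of gates of its circuit and the classical cost of the
indices. -/
def testCost (s : Store) (ph : Bool) : Query → ℕ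
  | .uu i j => (testGates ph (lookup S.circU (i.eval s)) (lookup S.circU (j.eval s))).length +
      i.cost + j.cost
  | .ub i => (testGates ph (lookup S.circU (i.eval s)) S.circB).length + i.cost
  | .vv i j => (testGates ph (lookup S.circV (i.eval s)) (lookup S.circV (j.eval s))).length +
      i.cost + j.cost

open Classical in
/-- The joint distribution of the final memory and the time that a program takes. A Hadamard test
writes the measured bit into the memory; `loop v e P` runs `P` for `v = 0, 1, …, e - 1`, where `e` is
evaluated at the start. -/
def run : Prog → Store → PMF (Store × ℕ)
  | .skip, s => PMF.pure (s, 1)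
  | .setNat v e, s => PMF.pure (s.setNat v (e.eval s), e.cost + 1)
  | .ceil v e, s => PMF.pure (s.setNat v ⌈(e.eval s).re⌉₊, e.cost + ⌈(e.eval s).re⌉₊ + 1)
  | .setNum a i j e, s =>
      PMF.pure (s.setNum a (i.eval s) (j.eval s) (e.eval s), i.cost + j.cost + e.cost + 1)
  | .test a i j ph q, s => (S.outcome s ph q).bind fun o =>
      PMF.pure (s.setNum a (i.eval s) (j.eval s) (if o then 1 else 0),
        i.cost + j.cost + S.testCost s ph q + 1)
  | .seq P Q, s => (run P s).bind fun o => (run Q o.1).bind fun o' => PMF.pure (o'.1, o.2 + o'.2)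
  | .ite c P Q, s => (if c.Holds s then run P s else run Q s).bind fun o =>
      PMF.pure (o.1, c.cost + o.2)
  | .loop v e P, s =>
      Nat.rec (PMF.pure (s, e.cost + 1))
        (fun k (prev : PMF (Store × ℕ)) => prev.bind fun o =>
          (run P (o.1.setNat v k)).bind fun o' => PMF.pure (o'.1, o.2 + o'.2 + 1))
        (e.eval s)

/-- The memory at the start of a run with accuracy `ε` and confidence parameter `k`. Registers 0 to 3
hold `R`, `N`, `M`, `k`. Arrays 0 and 1 hold the norms `‖u_j‖` and `‖v_j‖`. Array 2 holds `‖b‖`, `ε`,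
and the largest and the smallest nonzero singular values of `A₁` and of `A₂`. All else is zero. -/
def input (ε : ℝ) (k : ℕ) : Store where
  nat v := [S.R, S.N, S.M, k].getD v 0
  num a i j := if j = 0 then
      match a with
      | 0 => if h : i < S.R then (S.normU ⟨i, h⟩ : ℂ) else 0
      | 1 => if h : i < S.R then (S.normV ⟨i, h⟩ : ℂ) else 0
      | 2 => (([S.normB, ε, specNorm S.A₁, minSingularValue S.A₁, specNorm S.A₂,
          minSingularValue S.A₂].getD i 0 : ℝ) : ℂ)
      | _ => 0
    else 0

/-- The output vector `s`, which a program leaves in array 3. -/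
def output (s : Store) : Fin S.R → ℂ := fun j => s.num 3 j 0

end FactorizedSystem

end Hybrid

end

/-!
Richardson's iteration `t ← t + σ⁻² (g - W* W t)` for a system of normal equations `W* W t = g`
contracts the error orthogonal to the kernel of `W` by the factor `1 - σ_min² / σ²`, and a
perturbation of every step by `δ` adds up to at most `n δ` after `n` steps. The entries of `W* W t`
are weighted sums of inner products of prepared vectors, so they can be estimated by a weighted mean
of Hadamard tests. Applied first to `A₁* A₁ y = A₁* b` and then to `A₂ A₂* z = y`, this gives the
coefficients `s = (‖v_j‖ z_j)_j`, for which `A x̂` is close to the projection of `b`. The tests are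
independent of each other given the current iterate, hence the moment generating function of the
estimated sum is at most Gaussian, and a union bound over all entries and steps controls the
failure. All loop bounds are fixed once the parameters are computed, so the running time is a
polynomial in them.
-/

noncomputable section

namespace Hybrid

open scoped ENNReal

/-! ### Singular values and least squares -/

section LinearMap

open RCLike

variable {𝕜 E F : Type*} [RCLike 𝕜] [NormedAddCommGroup E] [InnerProductSpace 𝕜 E]
  [FiniteDimensional 𝕜 E] [NormedAddCommGroup F] [InnerProductSpace 𝕜 F]

theorem exists_mem_ker_orthogonal_apply_eq (W : E →ₗ[𝕜] F) (y : E) :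
    ∃ z ∈ W.kerᗮ, W z = W y := by
  refine ⟨W.kerᗮ.starProjection y, Submodule.starProjection_apply_mem _ _, ?_⟩
  have h := Submodule.sub_starProjection_mem_orthogonal (K := W.kerᗮ) y
  rw [Submodule.orthogonal_orthogonal, LinearMap.mem_ker, map_sub, sub_eq_zero] at h
  exact h.symm

variable [FiniteDimensional 𝕜 F]

theorem sq_norm_apply_eq_sum_singularValues (W : E →ₗ[𝕜] F) (x : E) :
    ‖W x‖ ^ 2 = ∑ i : Fin (Module.finrank 𝕜 E), W.singularValues i ^ 2 *
      ‖(W.isSymmetric_adjoint_comp_self.eigenvectorBasis rfl).repr x i‖ ^ 2 := by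
  set e := W.isSymmetric_adjoint_comp_self.eigenvectorBasis rfl with he
  calc ‖W x‖ ^ 2 = re (inner 𝕜 x ((W.adjoint ∘ₗ W) x)) := by
        rw [LinearMap.comp_apply, LinearMap.adjoint_inner_right, inner_self_eq_norm_sq]
    _ = ∑ i, re (inner 𝕜 (e.repr x i) (e.repr ((W.adjoint ∘ₗ W) x) i)) := by
        rw [← e.repr.inner_map_map, PiLp.inner_apply, map_sum]
    _ = _ := Finset.sum_congr rfl fun i _ => by
        rw [he, LinearMap.IsSymmetric.eigenvectorBasis_apply_self_apply,
          ← W.sq_singularValues_fin rfl i, ← smul_eq_mul, inner_smul_right, ← he,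
          re_ofReal_mul, inner_self_eq_norm_sq]

theorem norm_apply_le_singularValues_zero (W : E →ₗ[𝕜] F) (x : E) :
    ‖W x‖ ≤ W.singularValues 0 * ‖x‖ := by
  set e := W.isSymmetric_adjoint_comp_self.eigenvectorBasis rfl
  refine le_of_sq_le_sq ?_ (mul_nonneg (W.singularValues_nonneg 0) (norm_nonneg x))
  rw [sq_norm_apply_eq_sum_singularValues, mul_pow, ← e.repr.norm_map x,
    EuclideanSpace.norm_sq_eq, Finset.mul_sum]
  gcongr with i
  · exact W.singularValues_nonneg _
  · exact W.singularValues_antitone (Nat.zero_le _)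

theorem eigenvectorBasis_repr_apply_eq_zero (W : E →ₗ[𝕜] F) {x : E} (hx : x ∈ W.kerᗮ)
    {i : Fin (Module.finrank 𝕜 E)} (hi : W.singularValues i = 0) :
    (W.isSymmetric_adjoint_comp_self.eigenvectorBasis rfl).repr x i = 0 := by
  set e := W.isSymmetric_adjoint_comp_self.eigenvectorBasis rfl with he
  have hker : e i ∈ W.ker := by
    rw [← LinearMap.ker_adjoint_comp_self, LinearMap.mem_ker, he,
      LinearMap.IsSymmetric.apply_eigenvectorBasis, ← W.sq_singularValues_fin rfl i, hi,
      zero_pow two_ne_zero, ofReal_zero, zero_smul]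
  rw [e.repr_apply_apply]
  exact hx _ hker

theorem singularValues_finrank_range_sub_one_mul_norm_le (W : E →ₗ[𝕜] F) {x : E}
    (hx : x ∈ W.kerᗮ) : W.singularValues (Module.finrank 𝕜 W.range - 1) * ‖x‖ ≤ ‖W x‖ := by
  refine le_of_sq_le_sq ?_ (norm_nonneg _)
  set e := W.isSymmetric_adjoint_comp_self.eigenvectorBasis rfl with he
  rw [sq_norm_apply_eq_sum_singularValues, mul_pow, ← e.repr.norm_map x,
    EuclideanSpace.norm_sq_eq, Finset.mul_sum, ← he]
  refine Finset.sum_le_sum fun i _ => ?_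
  by_cases hi : (i : ℕ) < Module.finrank 𝕜 W.range
  · gcongr
    · exact W.singularValues_nonneg _
    · exact W.singularValues_antitone (Nat.le_sub_one_of_lt hi)
  · rw [he, eigenvectorBasis_repr_apply_eq_zero W hx
      (W.singularValues_eq_zero_iff_le_finrank_range.2 (not_lt.1 hi)), norm_zero,
      zero_pow two_ne_zero, mul_zero, mul_zero]

variable {W : E →ₗ[𝕜] F} {σ ρ : ℝ}

theorem norm_adjoint_apply_le (hσ0 : 0 ≤ σ) (hσ : ∀ y, ‖W y‖ ≤ σ * ‖y‖) (x : F) :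
    ‖W.adjoint x‖ ≤ σ * ‖x‖ := by
  have hnorm : ‖W.adjoint.toContinuousLinearMap‖ ≤ σ := by
    rw [LinearMap.adjoint_toContinuousLinearMap, LinearIsometryEquiv.norm_map]
    exact ContinuousLinearMap.opNorm_le_bound _ hσ0 hσ
  exact W.adjoint.toContinuousLinearMap.le_of_opNorm_le hnorm x

theorem exists_mem_ker_orthogonal_adjoint_apply_eq (W : E →ₗ[𝕜] F) (b : F) :
    ∃ y ∈ W.kerᗮ, W.adjoint (W y) = W.adjoint b := by
  obtain ⟨y, hy⟩ : W.adjoint b ∈ (W.adjoint ∘ₗ W).range := by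
    rw [LinearMap.range_adjoint_comp_self]
    exact LinearMap.mem_range_self _ b
  obtain ⟨z, hz, hzy⟩ := exists_mem_ker_orthogonal_apply_eq W y
  exact ⟨z, hz, by rw [hzy]; exact hy⟩

theorem norm_apply_le_of_adjoint_apply_eq {y : E} {b : F}
    (h : W.adjoint (W y) = W.adjoint b) : ‖W y‖ ≤ ‖b‖ := by
  rcases (norm_nonneg (W y)).eq_or_lt with h0 | h0
  · exact h0 ▸ norm_nonneg b
  refine le_of_mul_le_mul_left ?_ h0
  calc ‖W y‖ * ‖W y‖ = re (inner 𝕜 (W y) (W y)) := (inner_self_eq_norm_mul_norm _).symm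
    _ = re (inner 𝕜 (W y) b) := by
        rw [← LinearMap.adjoint_inner_right, h, LinearMap.adjoint_inner_right]
    _ ≤ ‖W y‖ * ‖b‖ := re_inner_le_norm _ _

theorem norm_apply_sub_le_of_adjoint_apply_eq {y : E} {b : F}
    (h : W.adjoint (W y) = W.adjoint b) (y' : E) : ‖W y - b‖ ≤ ‖W y' - b‖ := by
  have horth : inner 𝕜 (W (y' - y)) (W y - b) = 0 := by
    rw [← LinearMap.adjoint_inner_right, map_sub, h, sub_self, inner_zero_right]
  have hpyth := norm_add_sq_eq_norm_sq_add_norm_sq_of_inner_eq_zero _ _ horth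
  rw [map_sub, sub_add_sub_cancel] at hpyth
  exact le_of_sq_le_sq (by nlinarith [mul_self_nonneg ‖W y' - W y‖]) (norm_nonneg _)

theorem sq_mul_norm_le_norm_adjoint_apply (hρ0 : 0 ≤ ρ) (hρ : ∀ y, ρ * ‖y‖ ≤ ‖W y‖) (y : E) :
    ρ ^ 2 * ‖y‖ ≤ ‖W.adjoint (W y)‖ := by
  rcases (norm_nonneg y).eq_or_lt with h0 | h0
  · rw [← h0, mul_zero]
    exact norm_nonneg _
  refine le_of_mul_le_mul_right ?_ h0
  calc ρ ^ 2 * ‖y‖ * ‖y‖ = (ρ * ‖y‖) ^ 2 := by ring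
    _ ≤ ‖W y‖ ^ 2 := by gcongr; exact hρ y
    _ = re (inner 𝕜 (W.adjoint (W y)) y) := by
        rw [LinearMap.adjoint_inner_left, inner_self_eq_norm_sq]
    _ ≤ ‖W.adjoint (W y)‖ * ‖y‖ := re_inner_le_norm _ _

theorem exists_adjoint_apply_apply_eq (hρ0 : 0 < ρ) (hρ : ∀ y, ρ * ‖y‖ ≤ ‖W y‖) (g : E) :
    ∃ y, W.adjoint (W y) = g := by
  have hinj : Function.Injective (W.adjoint ∘ₗ W) := by
    refine LinearMap.ker_eq_bot.1 (LinearMap.ker_eq_bot'.2 fun y hy => norm_le_zero_iff.1 ?_)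
    have h := sq_mul_norm_le_norm_adjoint_apply hρ0.le hρ y
    rw [show W.adjoint (W y) = 0 from hy, norm_zero] at h
    exact nonpos_of_mul_nonpos_right h (pow_pos hρ0 2)
  exact LinearMap.surjective_of_injective hinj g

theorem mul_norm_le_norm_adjoint_of_surjective (hρ0 : 0 ≤ ρ) (hW : Function.Surjective W)
    (hρ : ∀ y ∈ W.kerᗮ, ρ * ‖y‖ ≤ ‖W y‖) (x : F) : ρ * ‖x‖ ≤ ‖W.adjoint x‖ := by
  obtain ⟨y, hy, rfl⟩ : ∃ y ∈ W.kerᗮ, W y = x := by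
    obtain ⟨y₀, rfl⟩ := hW x
    exact exists_mem_ker_orthogonal_apply_eq W y₀
  rcases (norm_nonneg (W y)).eq_or_lt with h0 | h0
  · rw [← h0, mul_zero]
    exact norm_nonneg _
  refine le_of_mul_le_mul_right ?_ h0
  calc ρ * ‖W y‖ * ‖W y‖ = ρ * re (inner 𝕜 (W.adjoint (W y)) y) := by
        rw [LinearMap.adjoint_inner_left, inner_self_eq_norm_mul_norm, mul_assoc]
    _ ≤ ρ * (‖W.adjoint (W y)‖ * ‖y‖) := by gcongr; exact re_inner_le_norm _ _
    _ = ‖W.adjoint (W y)‖ * (ρ * ‖y‖) := by ring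
    _ ≤ ‖W.adjoint (W y)‖ * ‖W y‖ := by gcongr; exact hρ y hy

end LinearMap

/-! ### Richardson iteration for the normal equations -/

section Richardson

open RCLike

variable {𝕜 E F : Type*} [RCLike 𝕜] [NormedAddCommGroup E] [InnerProductSpace 𝕜 E]
  [FiniteDimensional 𝕜 E] [NormedAddCommGroup F] [InnerProductSpace 𝕜 F] [FiniteDimensional 𝕜 F]
  {W : E →ₗ[𝕜] F} {σ ρ : ℝ}

/-- The map `1 - σ⁻² W† W`, which describes how the error of the Richardson iteration
`y ↦ y + σ⁻² (W† b - W† W y)` for the normal equations evolves. -/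
def richardson (W : E →ₗ[𝕜] F) (σ : ℝ) : E →ₗ[𝕜] E :=
  LinearMap.id - (((σ ^ 2)⁻¹ : ℝ) : 𝕜) • (W.adjoint ∘ₗ W)

theorem richardson_apply (z : E) :
    richardson W σ z = z - (((σ ^ 2)⁻¹ : ℝ) : 𝕜) • W.adjoint (W z) := rfl

theorem sq_norm_richardson_le (hσ0 : 0 < σ) (hσ : ∀ y, ‖W y‖ ≤ σ * ‖y‖) (z : E) :
    ‖richardson W σ z‖ ^ 2 ≤ ‖z‖ ^ 2 - ‖W z‖ ^ 2 / σ ^ 2 := by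
  have hcross : re (inner 𝕜 z ((((σ ^ 2)⁻¹ : ℝ) : 𝕜) • W.adjoint (W z))) =
      ‖W z‖ ^ 2 / σ ^ 2 := by
    rw [inner_smul_right, LinearMap.adjoint_inner_right, re_ofReal_mul, inner_self_eq_norm_sq,
      inv_mul_eq_div]
  have hsquare : ‖(((σ ^ 2)⁻¹ : ℝ) : 𝕜) • W.adjoint (W z)‖ ^ 2 ≤ ‖W z‖ ^ 2 / σ ^ 2 := by
    rw [norm_smul, norm_ofReal, abs_of_nonneg (by positivity)]
    calc ((σ ^ 2)⁻¹ * ‖W.adjoint (W z)‖) ^ 2 ≤ ((σ ^ 2)⁻¹ * (σ * ‖W z‖)) ^ 2 := by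
          gcongr; exact norm_adjoint_apply_le hσ0.le hσ _
      _ = ‖W z‖ ^ 2 / σ ^ 2 := by field_simp
  rw [richardson_apply, norm_sub_sq (𝕜 := 𝕜), hcross]
  linarith

theorem norm_richardson_le (hσ0 : 0 < σ) (hσ : ∀ y, ‖W y‖ ≤ σ * ‖y‖) (z : E) :
    ‖richardson W σ z‖ ≤ ‖z‖ :=
  le_of_sq_le_sq ((sq_norm_richardson_le hσ0 hσ z).trans (sub_le_self _ (by positivity)))
    (norm_nonneg _)

theorem norm_richardson_pow_le_norm (hσ0 : 0 < σ) (hσ : ∀ y, ‖W y‖ ≤ σ * ‖y‖) (t : ℕ) (z : E) :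
    ‖(richardson W σ ^ t) z‖ ≤ ‖z‖ := by
  induction t with
  | zero => rw [pow_zero, Module.End.one_apply]
  | succ t ih =>
    rw [pow_succ', Module.End.mul_apply]
    exact (norm_richardson_le hσ0 hσ _).trans ih

theorem richardson_mem_ker_orthogonal {z : E} (hz : z ∈ W.kerᗮ) : richardson W σ z ∈ W.kerᗮ := by
  refine Submodule.sub_mem _ hz (Submodule.smul_mem _ _ fun u hu => ?_)
  rw [LinearMap.comp_apply, LinearMap.adjoint_inner_right, LinearMap.mem_ker.1 hu, inner_zero_left]

theorem richardson_pow_mem_ker_orthogonal {z : E} (hz : z ∈ W.kerᗮ) (t : ℕ) :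
    (richardson W σ ^ t) z ∈ W.kerᗮ := by
  induction t with
  | zero => rwa [pow_zero, Module.End.one_apply]
  | succ t ih =>
    rw [pow_succ', Module.End.mul_apply]
    exact richardson_mem_ker_orthogonal ih

theorem one_sub_sq_div_sq_nonneg (hσ0 : 0 < σ) (hρ0 : 0 ≤ ρ) (hρσ : ρ ≤ σ) :
    0 ≤ 1 - ρ ^ 2 / σ ^ 2 :=
  sub_nonneg.2 ((div_le_one (by positivity)).2 (by gcongr))

theorem sq_norm_richardson_pow_le (hσ0 : 0 < σ) (hσ : ∀ y, ‖W y‖ ≤ σ * ‖y‖) (hρ0 : 0 ≤ ρ)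
    (hρσ : ρ ≤ σ) (hρ : ∀ y ∈ W.kerᗮ, ρ * ‖y‖ ≤ ‖W y‖) {z : E} (hz : z ∈ W.kerᗮ) (t : ℕ) :
    ‖(richardson W σ ^ t) z‖ ^ 2 ≤ (1 - ρ ^ 2 / σ ^ 2) ^ t * ‖z‖ ^ 2 := by
  have hq := one_sub_sq_div_sq_nonneg hσ0 hρ0 hρσ
  induction t with
  | zero => rw [pow_zero, Module.End.one_apply, pow_zero, one_mul]
  | succ t ih =>
    rw [pow_succ' (richardson W σ), Module.End.mul_apply]
    set y := (richardson W σ ^ t) z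
    have hy : ρ * ‖y‖ ≤ ‖W y‖ := hρ y (richardson_pow_mem_ker_orthogonal hz t)
    calc ‖richardson W σ y‖ ^ 2 ≤ ‖y‖ ^ 2 - ‖W y‖ ^ 2 / σ ^ 2 := sq_norm_richardson_le hσ0 hσ y
      _ ≤ ‖y‖ ^ 2 - (ρ * ‖y‖) ^ 2 / σ ^ 2 := by gcongr
      _ = (1 - ρ ^ 2 / σ ^ 2) * ‖y‖ ^ 2 := by ring
      _ ≤ (1 - ρ ^ 2 / σ ^ 2) * ((1 - ρ ^ 2 / σ ^ 2) ^ t * ‖z‖ ^ 2) := by gcongr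
      _ = (1 - ρ ^ 2 / σ ^ 2) ^ (t + 1) * ‖z‖ ^ 2 := by ring

theorem one_sub_sq_div_sq_pow_le (hσ0 : 0 < σ) (hρ0 : 0 < ρ) (hρσ : ρ ≤ σ) {T L : ℕ}
    (hT : 2 * (σ / ρ) ^ 2 * L ≤ T) : (1 - ρ ^ 2 / σ ^ 2) ^ T ≤ ((2 ^ L)⁻¹) ^ 2 := by
  have hq := one_sub_sq_div_sq_nonneg hσ0 hρ0.le hρσ
  have hexp : (2 * L : ℕ) ≤ ρ ^ 2 / σ ^ 2 * T :=
    calc ((2 * L : ℕ) : ℝ) = ρ ^ 2 / σ ^ 2 * (2 * (σ / ρ) ^ 2 * L) := by push_cast; field_simp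
      _ ≤ ρ ^ 2 / σ ^ 2 * T := by gcongr
  calc (1 - ρ ^ 2 / σ ^ 2) ^ T ≤ Real.exp (-(ρ ^ 2 / σ ^ 2)) ^ T := by
        gcongr
        exact Real.one_sub_le_exp_neg _
    _ = Real.exp (-(ρ ^ 2 / σ ^ 2 * T)) := by rw [← Real.exp_nat_mul]; ring_nf
    _ ≤ Real.exp (-(2 * L : ℕ)) := by gcongr
    _ = (Real.exp 1 ^ (2 * L))⁻¹ := by rw [Real.exp_neg, Real.exp_one_pow]
    _ ≤ (2 ^ (2 * L))⁻¹ := by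
        gcongr
        linarith [Real.add_one_le_exp (1 : ℝ)]
    _ = ((2 ^ L)⁻¹) ^ 2 := by rw [inv_pow, ← pow_mul, mul_comm L]

theorem norm_richardson_pow_le (hσ0 : 0 < σ) (hσ : ∀ y, ‖W y‖ ≤ σ * ‖y‖) (hρ0 : 0 < ρ)
    (hρσ : ρ ≤ σ) (hρ : ∀ y ∈ W.kerᗮ, ρ * ‖y‖ ≤ ‖W y‖) {z : E} (hz : z ∈ W.kerᗮ) {T L : ℕ}
    (hT : 2 * (σ / ρ) ^ 2 * L ≤ T) : ‖(richardson W σ ^ T) z‖ ≤ (2 ^ L : ℝ)⁻¹ * ‖z‖ := by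
  refine le_of_sq_le_sq ((sq_norm_richardson_pow_le hσ0 hσ hρ0.le hρσ hρ hz T).trans ?_)
    (by positivity)
  rw [mul_pow]
  gcongr
  exact one_sub_sq_div_sq_pow_le hσ0 hρ0 hρσ hT

-- The exact iterates that start at zero satisfy `y - z = (richardson W σ ^ t) (-z)`, so the
-- hypothesis `hy` bounds the error accumulated in `t` inexact steps.
theorem norm_richardson_step_le (hσ0 : 0 < σ) (hσ : ∀ y, ‖W y‖ ≤ σ * ‖y‖) {η : ℝ} {t : ℕ}
    {y y' z : E} (hy : ‖y - z - (richardson W σ ^ t) (-z)‖ ≤ t * η)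
    (hy' : ‖y' - (y + (((σ ^ 2)⁻¹ : ℝ) : 𝕜) • (W.adjoint (W z) - W.adjoint (W y)))‖ ≤ η) :
    ‖y' - z - (richardson W σ ^ (t + 1)) (-z)‖ ≤ (t + 1 : ℕ) * η := by
  have hsplit : y' - z - (richardson W σ ^ (t + 1)) (-z) =
      (y' - (y + (((σ ^ 2)⁻¹ : ℝ) : 𝕜) • (W.adjoint (W z) - W.adjoint (W y)))) +
        richardson W σ (y - z - (richardson W σ ^ t) (-z)) := by
    rw [map_sub (richardson W σ), ← Module.End.mul_apply, ← pow_succ', richardson_apply, map_sub,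
      map_sub, smul_sub, smul_sub]
    abel
  calc ‖y' - z - (richardson W σ ^ (t + 1)) (-z)‖ ≤ η + t * η := by
        rw [hsplit]
        exact (norm_add_le _ _).trans (add_le_add hy' ((norm_richardson_le hσ0 hσ _).trans hy))
    _ = (t + 1 : ℕ) * η := by push_cast; ring

theorem norm_le_of_norm_sub_sub_richardson_le (hσ0 : 0 < σ) (hσ : ∀ y, ‖W y‖ ≤ σ * ‖y‖)
    {Y δ : ℝ} {t : ℕ} {y z : E} (hy : ‖y - z - (richardson W σ ^ t) (-z)‖ ≤ δ) (hz : ‖z‖ ≤ Y)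
    (hδ : δ ≤ Y) : ‖y‖ ≤ 3 * Y := by
  have hpow := norm_richardson_pow_le_norm hσ0 hσ t (-z)
  rw [norm_neg] at hpow
  calc ‖y‖ = ‖(y - z - (richardson W σ ^ t) (-z)) + (richardson W σ ^ t) (-z) + z‖ := by
        congr 1; abel
    _ ≤ ‖y - z - (richardson W σ ^ t) (-z)‖ + ‖(richardson W σ ^ t) (-z)‖ + ‖z‖ := norm_add₃_le
    _ ≤ 3 * Y := by linarith

end Richardson

/-! ### Singular values of matrices -/

section Matrix

variable {N M : ℕ} (A : Matrix (Fin N) (Fin M) ℂ)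

theorem rank_eq_finrank_range_toEuclideanLin :
    A.rank = Module.finrank ℂ A.toEuclideanLin.range :=
  A.rank_eq_finrank_range_toLin (EuclideanSpace.basisFun _ ℂ).toBasis
    (EuclideanSpace.basisFun _ ℂ).toBasis

theorem norm_toEuclideanLin_le (y : EuclideanSpace ℂ (Fin M)) :
    ‖A.toEuclideanLin y‖ ≤ specNorm A * ‖y‖ := norm_apply_le_singularValues_zero _ y

theorem specNorm_nonneg : 0 ≤ specNorm A := LinearMap.singularValues_nonneg _ _

theorem minSingularValue_nonneg : 0 ≤ minSingularValue A := LinearMap.singularValues_nonneg _ _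

theorem minSingularValue_le_specNorm : minSingularValue A ≤ specNorm A :=
  LinearMap.singularValues_antitone _ (Nat.zero_le _)

theorem minSingularValue_mul_norm_le {y : EuclideanSpace ℂ (Fin M)}
    (hy : y ∈ A.toEuclideanLin.kerᗮ) : minSingularValue A * ‖y‖ ≤ ‖A.toEuclideanLin y‖ := by
  rw [minSingularValue, rank_eq_finrank_range_toEuclideanLin]
  exact singularValues_finrank_range_sub_one_mul_norm_le _ hy

variable {A}

theorem minSingularValue_pos (h : 0 < specNorm A) : 0 < minSingularValue A := by
  rw [specNorm, LinearMap.singularValues_pos_iff_lt_finrank_range] at h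
  rw [minSingularValue, LinearMap.singularValues_pos_iff_lt_finrank_range,
    rank_eq_finrank_range_toEuclideanLin]
  exact Nat.sub_one_lt_of_lt h

theorem eq_zero_of_specNorm_eq_zero (h : specNorm A = 0) : A = 0 := by
  have hzero : A.toEuclideanLin = 0 := LinearMap.ext fun y =>
    norm_le_zero_iff.1 ((norm_toEuclideanLin_le A y).trans_eq (by rw [h, zero_mul]))
  exact (LinearEquiv.map_eq_zero_iff _).1 hzero

end Matrix

/-! ### The distribution of the Hadamard test -/

section HadamardTest

variable {n : ℕ}

theorem Gate.apply_smul (g : Gate n) (c : ℂ) (ψ : Bits n → ℂ) :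
    g.apply (c • ψ) = c • g.apply ψ := by
  cases g <;> funext x <;>
    simp only [Gate.apply, Pi.smul_apply, smul_eq_mul, Finset.mul_sum] <;>
    exact Finset.sum_congr rfl fun a _ => by ring

theorem Gate.apply_sub (g : Gate n) (φ ψ : Bits n → ℂ) :
    g.apply (φ - ψ) = g.apply φ - g.apply ψ := by
  cases g <;> funext x <;>
    simp only [Gate.apply, Pi.sub_apply, mul_sub, Finset.sum_sub_distrib]

theorem sum_unitary_mul_sum_inv {ι : Type*} [Fintype ι] [DecidableEq ι]
    (U : Matrix.unitaryGroup ι ℂ) (i : ι) (f : ι → ℂ) :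
    ∑ a, U.1 i a * ∑ b, (U⁻¹).1 a b * f b = f i := by
  have h : U.1 * (U⁻¹).1 = 1 := by rw [← Submonoid.coe_mul, mul_inv_cancel, Submonoid.coe_one]
  calc ∑ a, U.1 i a * ∑ b, (U⁻¹).1 a b * f b = (U.1 *ᵥ ((U⁻¹).1 *ᵥ f)) i := rfl
    _ = f i := by rw [Matrix.mulVec_mulVec, h, Matrix.one_mulVec]

theorem update_update_update_update {ι α : Type*} [DecidableEq ι] {p q : ι} (hpq : p ≠ q)
    (x : ι → α) (a b c d : α) :
    Function.update (Function.update (Function.update (Function.update x p a) q b) p c) q d =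
      Function.update (Function.update x p c) q d := by
  rw [Function.update_comm (β := fun _ => α) hpq.symm b c, Function.update_idem,
    Function.update_idem]

theorem Gate.apply_inv_apply (g : Gate n) (ψ : Bits n → ℂ) : g.apply (g.inv.apply ψ) = ψ := by
  cases g with
  | one q U =>
    funext x
    simp only [Gate.inv, Gate.apply, Function.update_self, Function.update_idem]
    rw [sum_unitary_mul_sum_inv U (x q) fun b => ψ (Function.update x q b),
      Function.update_eq_self]
  | two p q hpq U =>
    funext x
    simp only [Gate.inv, Gate.apply, Function.update_self, Function.update_of_ne hpq,
      update_update_update_update hpq]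
    rw [sum_unitary_mul_sum_inv U (x p, x q) fun b =>
      ψ (Function.update (Function.update x p b.1) q b.2)]
    simp only [Function.update_eq_self]

/-- The action of a list of gates, the first of which is applied first. -/
def applyGates (l : List (Gate n)) (ψ : Bits n → ℂ) : Bits n → ℂ :=
  l.foldl (fun ψ g => g.apply ψ) ψ

theorem applyGates_append (l l' : List (Gate n)) (ψ : Bits n → ℂ) :
    applyGates (l ++ l') ψ = applyGates l' (applyGates l ψ) := List.foldl_append

theorem applyGates_smul (l : List (Gate n)) (c : ℂ) (ψ : Bits n → ℂ) :
    applyGates l (c • ψ) = c • applyGates l ψ := by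
  induction l generalizing ψ with
  | nil => rfl
  | cons g l ih => simp only [applyGates, List.foldl_cons, g.apply_smul] at ih ⊢; exact ih _

theorem applyGates_sub (l : List (Gate n)) (φ ψ : Bits n → ℂ) :
    applyGates l (φ - ψ) = applyGates l φ - applyGates l ψ := by
  induction l generalizing φ ψ with
  | nil => rfl
  | cons g l ih => simp only [applyGates, List.foldl_cons, g.apply_sub] at ih ⊢; exact ih _ _

theorem sum_normSq_applyGates (l : List (Gate n)) (ψ : Bits n → ℂ) :
    ∑ x, ‖applyGates l ψ x‖ ^ 2 = ∑ x, ‖ψ x‖ ^ 2 := by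
  induction l generalizing ψ with
  | nil => rfl
  | cons g l ih => exact (ih _).trans (g.sum_apply ψ)

theorem applyGates_applyGates_inv (l : List (Gate n)) (ψ : Bits n → ℂ) :
    applyGates l (applyGates (l.reverse.map Gate.inv) ψ) = ψ := by
  induction l generalizing ψ with
  | nil => rfl
  | cons g l ih =>
    rw [List.reverse_cons, List.map_append, applyGates_append]
    change applyGates l (g.apply (g.inv.apply _)) = ψ
    rw [g.apply_inv_apply, ih]

theorem Circuit.sum_normSq_state (C : Circuit n) : ∑ x, ‖C.state x‖ ^ 2 = 1 :=
  (sum_normSq_applyGates C.gates (ketZero n)).trans (by simp [ketZero, apply_ite])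

theorem norm_dotProduct_state_le (C' C : Circuit n) : ‖star C'.state ⬝ᵥ C.state‖ ≤ 1 := by
  have hnorm (C : Circuit n) : ‖(WithLp.toLp 2 C.state : EuclideanSpace ℂ (Bits n))‖ = 1 := by
    rw [EuclideanSpace.norm_eq, Real.sqrt_eq_one]
    exact C.sum_normSq_state
  have h := norm_inner_le_norm (𝕜 := ℂ) (WithLp.toLp 2 C'.state : EuclideanSpace ℂ (Bits n))
    (WithLp.toLp 2 C.state)
  rwa [hnorm, hnorm, one_mul, EuclideanSpace.inner_toLp_toLp, dotProduct_comm] at h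

theorem foldl_controlled (l : List (Gate n)) (ψ : Bool × Bits n → ℂ) :
    (l.map TestGate.controlled).foldl (fun ψ g => g.apply ψ) ψ =
      fun z => if z.1 then applyGates l (fun x => ψ (true, x)) z.2 else ψ z := by
  induction l generalizing ψ with
  | nil =>
    funext ⟨a, x⟩
    cases a <;> simp [applyGates]
  | cons g l ih =>
    rw [List.map_cons, List.foldl_cons, ih]
    funext ⟨a, x⟩
    cases a <;> simp [applyGates, TestGate.apply]

/-- The phase that a Hadamard test with, respectively without, the phase gate gives to the ancilla
state `|1⟩`. -/
def testPhase (ph : Bool) : ℂ := if ph then Complex.I else 1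

theorem norm_testPhase (ph : Bool) : ‖testPhase ph‖ = 1 := by
  cases ph <;> simp [testPhase]

theorem testState_true (ph : Bool) (C' C : Circuit n) :
    (fun x => testState ph C' C (true, x)) = (1 / 2 : ℂ) • (ketZero n -
      testPhase ph • applyGates (C.gates ++ C'.invGates) (ketZero n)) := by
  have hr : ((√2 : ℝ) : ℂ)⁻¹ * ((√2 : ℝ) : ℂ)⁻¹ = 1 / 2 := by
    rw [← mul_inv, ← Complex.ofReal_mul, Real.mul_self_sqrt zero_le_two]
    norm_num
  set r : ℂ := ((√2 : ℝ) : ℂ)⁻¹ with hr_def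
  have hsmul (l : List (Gate n)) : applyGates l (fun x => r * ketZero n x) =
      fun x => r * applyGates l (ketZero n) x := applyGates_smul l r _
  funext x
  rw [testState, testGates, List.foldl_append, List.foldl_append, List.foldl_cons, List.foldl_nil,
    List.foldl_cons, foldl_controlled]
  set ψ := applyGates (C.gates ++ C'.invGates) (ketZero n) with hψ
  cases ph <;> simp [testPhase, TestGate.apply, hadamard, phase, Matrix.diagonal, ← hr_def, hsmul,
    ← hψ]
  · linear_combination (ketZero n x - ψ x) * hr
  · linear_combination (ketZero n x - Complex.I * ψ x) * hr

theorem sum_normSq_sub_smul {ι : Type*} [Fintype ι] {φ ψ : ι → ℂ} (hφ : ∑ x, ‖φ x‖ ^ 2 = 1)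
    (hψ : ∑ x, ‖ψ x‖ ^ 2 = 1) {c : ℂ} (hc : ‖c‖ = 1) :
    ∑ x, ‖(φ - c • ψ) x‖ ^ 2 = 2 - 2 * (c * star φ ⬝ᵥ ψ).re := by
  have h (x : ι) : ‖(φ - c • ψ) x‖ ^ 2 =
      ‖φ x‖ ^ 2 + ‖ψ x‖ ^ 2 - 2 * (c * (star (φ x) * ψ x)).re := by
    have hre : ((starRingEnd ℂ) (c * ψ x) * φ x).re = (c * (star (φ x) * ψ x)).re := by
      rw [← Complex.conj_re, map_mul, Complex.conj_conj, mul_assoc, mul_comm (ψ x)]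
      rfl
    rw [Pi.sub_apply, Pi.smul_apply, smul_eq_mul, ← Complex.normSq_eq_norm_sq, Complex.normSq_sub,
      mul_comm (φ x), hre, Complex.normSq_mul, Complex.normSq_eq_norm_sq c, hc,
      Complex.normSq_eq_norm_sq, Complex.normSq_eq_norm_sq, one_pow, one_mul]
  simp only [h, Finset.sum_sub_distrib, Finset.sum_add_distrib, hφ, hψ, dotProduct, Pi.star_apply,
    Finset.mul_sum, Complex.re_sum]
  ring

-- Applying the unitary `V` of `C'` to the amplitudes turns `V†U|0⟩` into `U|0⟩`.
theorem sum_normSq_testState_true (ph : Bool) (C' C : Circuit n) :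
    ∑ x, ‖testState ph C' C (true, x)‖ ^ 2 =
      (1 - (testPhase ph * star C'.state ⬝ᵥ C.state).re) / 2 := by
  have happly : applyGates C'.gates (fun x => testState ph C' C (true, x)) =
      (1 / 2 : ℂ) • (C'.state - testPhase ph • C.state) := by
    rw [testState_true, applyGates_smul, applyGates_sub, applyGates_smul, applyGates_append,
      Circuit.invGates, applyGates_applyGates_inv]
    rfl
  have h := sum_normSq_sub_smul C'.sum_normSq_state C.sum_normSq_state (norm_testPhase ph)
  rw [← sum_normSq_applyGates C'.gates, happly]
  simp only [Pi.smul_apply (1 / 2 : ℂ), norm_smul, mul_pow, ← Finset.mul_sum, h]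
  norm_num
  ring

theorem measureTest_true (ph : Bool) (C' C : Circuit n) : measureTest ph C' C true =
    ENNReal.ofReal ((1 - (testPhase ph * star C'.state ⬝ᵥ C.state).re) / 2) :=
  congrArg ENNReal.ofReal (sum_normSq_testState_true ph C' C)

theorem measureTest_false (ph : Bool) (C' C : Circuit n) : measureTest ph C' C false =
    ENNReal.ofReal ((1 + (testPhase ph * star C'.state ⬝ᵥ C.state).re) / 2) := by
  have h := sum_testState ph C' C
  rw [Fintype.sum_prod_type, Fintype.sum_bool, sum_normSq_testState_true] at h
  refine congrArg ENNReal.ofReal (?_ : ∑ x, ‖testState ph C' C (false, x)‖ ^ 2 = _)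
  linarith

end HadamardTest

/-! ### Prepared vectors -/

theorem encode_injective (N : ℕ) :
    Function.Injective fun i : Fin N => encode (Nat.clog 2 N) i := by
  intro i j h
  have hN := Nat.le_pow_clog (b := 2) (by norm_num) N
  refine Fin.ext (Nat.eq_of_testBit_eq fun q => ?_)
  by_cases hq : q < Nat.clog 2 N
  · exact congrFun h ⟨q, hq⟩
  · have hle : 2 ^ Nat.clog 2 N ≤ 2 ^ q := Nat.pow_le_pow_right (by norm_num) (not_lt.1 hq)
    rw [Nat.testBit_lt_two_pow (by lia), Nat.testBit_lt_two_pow (by lia)]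

theorem sum_encode {N : ℕ} {α : Type*} [AddCommMonoid α] (f : Bits (Nat.clog 2 N) → α)
    (hf : ∀ x, (∀ i : Fin N, encode _ i ≠ x) → f x = 0) :
    ∑ i : Fin N, f (encode _ i) = ∑ x, f x :=
  Finset.sum_of_injOn (fun i : Fin N => encode (Nat.clog 2 N) i) (encode_injective N).injOn
    (fun _ _ => Finset.mem_coe.2 (Finset.mem_univ _))
    (fun x _ hx => hf x fun i hi => hx ⟨i, Finset.mem_coe.2 (Finset.mem_univ _), hi⟩)
    (fun _ _ => rfl)

theorem dotProduct_ketOf {N : ℕ} (C' : Circuit (Nat.clog 2 N)) {C : Circuit (Nat.clog 2 N)}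
    (hC : PreparesIn N C) : star (ketOf N C') ⬝ᵥ ketOf N C = star C'.state ⬝ᵥ C.state :=
  sum_encode (fun x => star (C'.state x) * C.state x) fun x hx => by rw [hC x hx, mul_zero]

theorem sum_normSq_ketOf {N : ℕ} {C : Circuit (Nat.clog 2 N)} (hC : PreparesIn N C) :
    ∑ i, ‖ketOf N C i‖ ^ 2 = 1 := by
  rw [← C.sum_normSq_state]
  exact sum_encode (fun x => ‖C.state x‖ ^ 2) fun x hx => by
    rw [hC x hx, norm_zero, zero_pow two_ne_zero]

/-! ### The number of gates of a circuit -/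

theorem Gate.wires_nonempty {n : ℕ} (g : Gate n) : g.wires.Nonempty := by
  cases g <;> simp [Gate.wires]

theorem Layer.length_le {n : ℕ} (l : Layer n) : l.1.length ≤ n := by
  let wire (g : Gate n) : Fin n := g.wires_nonempty.choose
  have hnodup : (l.1.map wire).Nodup := l.2.map wire fun g h hdisj =>
    Finset.disjoint_iff_ne.1 hdisj _ g.wires_nonempty.choose_spec _ h.wires_nonempty.choose_spec
  simpa using hnodup.length_le_card

theorem Circuit.length_gates_le {n : ℕ} (C : Circuit n) : C.gates.length ≤ C.depth * n := by
  induction C with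
  | nil => simp [Circuit.gates]
  | cons l C ih =>
    have := l.length_le
    simp only [Circuit.gates, Circuit.depth, List.flatMap_cons, List.length_append,
      List.length_cons, Nat.add_mul, one_mul] at ih ⊢
    lia

theorem length_testGates_le {n : ℕ} (ph : Bool) (C' C : Circuit n) :
    (testGates ph C' C).length ≤ C.gates.length + C'.gates.length + 3 := by
  cases ph <;> simp [testGates, Circuit.invGates] <;> lia

/-! ### Matrices with prepared columns -/

section ColumnMatrix

variable {N R : ℕ}

/-- The matrix with columns `w j • |C j⟩`. It stands for `A₁` as well as for the adjoint of `A₂`. -/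
def columnMatrix (w : Fin R → ℝ) (C : Fin R → Circuit (Nat.clog 2 N)) :
    Matrix (Fin N) (Fin R) ℂ :=
  Matrix.of fun i j => (w j : ℂ) * ketOf N (C j) i

variable {w : Fin R → ℝ} {C : Fin R → Circuit (Nat.clog 2 N)}

theorem norm_toLp_ketOf {C : Circuit (Nat.clog 2 N)} (hC : PreparesIn N C) :
    ‖WithLp.toLp 2 (ketOf N C)‖ = 1 := by
  rw [EuclideanSpace.norm_eq, Real.sqrt_eq_one]
  exact sum_normSq_ketOf hC

theorem norm_columnMatrix_single (hw : ∀ j, 0 ≤ w j) (hC : ∀ j, PreparesIn N (C j)) (j : Fin R) :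
    ‖(columnMatrix w C).toEuclideanLin (EuclideanSpace.single j 1)‖ = w j := by
  have hcolumn : (columnMatrix w C).toEuclideanLin (EuclideanSpace.single j 1) =
      (w j : ℂ) • WithLp.toLp 2 (ketOf N (C j)) := by
    ext i
    simp [Matrix.toLpLin_apply, columnMatrix]
  rw [hcolumn, norm_smul, norm_toLp_ketOf (hC j), mul_one, Complex.norm_real,
    Real.norm_of_nonneg (hw j)]

theorem weight_le (hw : ∀ j, 0 ≤ w j) (hC : ∀ j, PreparesIn N (C j)) {σ : ℝ}
    (hσ : ∀ y, ‖(columnMatrix w C).toEuclideanLin y‖ ≤ σ * ‖y‖) (j : Fin R) : w j ≤ σ := by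
  have h := hσ (EuclideanSpace.single j 1)
  rwa [norm_columnMatrix_single hw hC, PiLp.norm_single, norm_one, mul_one] at h

theorem le_weight (hw : ∀ j, 0 ≤ w j) (hC : ∀ j, PreparesIn N (C j)) {ρ : ℝ}
    (hρ : ∀ y, ρ * ‖y‖ ≤ ‖(columnMatrix w C).toEuclideanLin y‖) (j : Fin R) : ρ ≤ w j := by
  have h := hρ (EuclideanSpace.single j 1)
  rwa [norm_columnMatrix_single hw hC, PiLp.norm_single, norm_one, mul_one] at h

theorem adjoint_columnMatrix_apply (x : EuclideanSpace ℂ (Fin N)) (i : Fin R) :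
    (columnMatrix w C).toEuclideanLin.adjoint x i = w i * (star (ketOf N (C i)) ⬝ᵥ x.ofLp) := by
  rw [← Matrix.toEuclideanLin_conjTranspose_eq_adjoint]
  simp [Matrix.toLpLin_apply, columnMatrix, Matrix.mulVec, dotProduct, Finset.mul_sum, mul_assoc]

theorem adjoint_columnMatrix_columnMatrix_apply (hC : ∀ j, PreparesIn N (C j))
    (y : EuclideanSpace ℂ (Fin R)) (i : Fin R) :
    (columnMatrix w C).toEuclideanLin.adjoint ((columnMatrix w C).toEuclideanLin y) i =
      w i * ∑ j, w j * y j * (star (C i).state ⬝ᵥ (C j).state) := by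
  have hsum : ((columnMatrix w C).toEuclideanLin y).ofLp =
      ∑ j, ((w j : ℂ) * y j) • ketOf N (C j) := by
    funext k
    simp [Matrix.toLpLin_apply, columnMatrix, Matrix.mulVec, dotProduct, mul_right_comm]
  rw [adjoint_columnMatrix_apply, hsum, dotProduct_sum]
  simp only [dotProduct_smul, smul_eq_mul, dotProduct_ketOf _ (hC _)]

end ColumnMatrix

/-! ### The memory -/

namespace Store

@[simp]
theorem nat_setNat (s : Store) (v n w : ℕ) :
    (s.setNat v n).nat w = if w = v then n else s.nat w := by
  simp [setNat, Function.update_apply]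

@[simp]
theorem num_setNat (s : Store) (v n : ℕ) : (s.setNat v n).num = s.num := rfl

@[simp]
theorem num_setNum (s : Store) (a i j : ℕ) (z : ℂ) (a' i' j' : ℕ) :
    (s.setNum a i j z).num a' i' j' = if a' = a ∧ i' = i ∧ j' = j then z else s.num a' i' j' := rfl

end Store

/-- The memories `s` and `s'` agree except for the registers in `V` and the arrays in `W`. -/
structure Unchanged (V W : Finset ℕ) (s s' : Store) : Prop where
  nat_eq : ∀ v ∉ V, s'.nat v = s.nat v
  num_eq : ∀ a ∉ W, s'.num a = s.num a

namespace Unchanged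

variable {V V' W W' : Finset ℕ} {s s' s'' : Store}

theorem refl (V W : Finset ℕ) (s : Store) : Unchanged V W s s :=
  ⟨fun _ _ => rfl, fun _ _ => rfl⟩

theorem trans (h : Unchanged V W s s') (h' : Unchanged V W s' s'') : Unchanged V W s s'' :=
  ⟨fun v hv => (h'.nat_eq v hv).trans (h.nat_eq v hv),
    fun a ha => (h'.num_eq a ha).trans (h.num_eq a ha)⟩

theorem mono (h : Unchanged V W s s') (hV : V ⊆ V') (hW : W ⊆ W') : Unchanged V' W' s s' :=
  ⟨fun v hv => h.nat_eq v fun hv' => hv (hV hv'), fun a ha => h.num_eq a fun ha' => ha (hW ha')⟩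

theorem setNat {v : ℕ} (hv : v ∈ V) (h : Unchanged V W s s') (n : ℕ) :
    Unchanged V W s (s'.setNat v n) :=
  ⟨fun w hw => by
    rw [Store.nat_setNat, if_neg (ne_of_mem_of_not_mem hv hw).symm, h.nat_eq w hw], h.num_eq⟩

theorem setNum {a : ℕ} (ha : a ∈ W) (h : Unchanged V W s s') (i j : ℕ) (z : ℂ) :
    Unchanged V W s (s'.setNum a i j z) :=
  ⟨h.nat_eq, fun b hb => by
    funext i' j'
    rw [Store.num_setNum, if_neg fun hab => ne_of_mem_of_not_mem ha hb hab.1.symm, h.num_eq b hb]⟩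

end Unchanged

namespace Prog

/-- The registers that a program writes to. -/
def natWrites : Prog → Finset ℕ
  | skip => ∅
  | setNat v _ => {v}
  | ceil v _ => {v}
  | setNum _ _ _ _ => ∅
  | test _ _ _ _ _ => ∅
  | seq P Q => P.natWrites ∪ Q.natWrites
  | ite _ P Q => P.natWrites ∪ Q.natWrites
  | loop v _ P => insert v P.natWrites

/-- The arrays that a program writes to. -/
def numWrites : Prog → Finset ℕ
  | skip => ∅
  | setNat _ _ => ∅
  | ceil _ _ => ∅
  | setNum a _ _ _ => {a}
  | test a _ _ _ _ => {a}
  | seq P Q => P.numWrites ∪ Q.numWrites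
  | ite _ P Q => P.numWrites ∪ Q.numWrites
  | loop _ _ P => P.numWrites

end Prog

/-! ### The distribution of the final memory -/

namespace FactorizedSystem

variable (S : FactorizedSystem)

/-- The distribution of the final memory of a program, without the time that it takes. -/
def final (P : Prog) (s : Store) : PMF Store := (S.run P s).map Prod.fst

/-- The distribution of the memory after `n` rounds of a loop. -/
def finalRounds (v : ℕ) (P : Prog) (s : Store) : ℕ → PMF Store
  | 0 => PMF.pure s
  | n + 1 => (finalRounds v P s n).bind fun s' => S.final P (s'.setNat v n)

variable {S} {P Q : Prog} {s : Store}

@[simp]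
theorem final_skip : S.final .skip s = PMF.pure s := PMF.pure_map _ _

@[simp]
theorem final_setNat {v : ℕ} {e : NatExp} :
    S.final (.setNat v e) s = PMF.pure (s.setNat v (e.eval s)) := PMF.pure_map _ _

@[simp]
theorem final_ceil {v : ℕ} {e : NumExp} :
    S.final (.ceil v e) s = PMF.pure (s.setNat v ⌈(e.eval s).re⌉₊) := PMF.pure_map _ _

@[simp]
theorem final_setNum {a : ℕ} {i j : NatExp} {e : NumExp} : S.final (.setNum a i j e) s =
    PMF.pure (s.setNum a (i.eval s) (j.eval s) (e.eval s)) := PMF.pure_map _ _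

theorem final_test {a : ℕ} {i j : NatExp} {ph : Bool} {q : Query} : S.final (.test a i j ph q) s =
    (S.outcome s ph q).map fun o =>
      s.setNum a (i.eval s) (j.eval s) (if o then 1 else 0) := by
  rw [final, run, PMF.map_bind]
  simp only [PMF.pure_map]
  rfl

theorem final_seq : S.final (.seq P Q) s = (S.final P s).bind (S.final Q) := by
  rw [final, run, final, PMF.map_bind, PMF.bind_map]
  simp only [PMF.map_bind, PMF.pure_map]
  rfl

theorem final_ite_of_holds {c : Cond} (h : c.Holds s) : S.final (.ite c P Q) s = S.final P s := by
  rw [final, run, if_pos h, PMF.map_bind]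
  simp only [PMF.pure_map]
  rfl

theorem final_ite_of_not_holds {c : Cond} (h : ¬c.Holds s) :
    S.final (.ite c P Q) s = S.final Q s := by
  rw [final, run, if_neg h, PMF.map_bind]
  simp only [PMF.pure_map]
  rfl

theorem final_loop {v : ℕ} {e : NatExp} :
    S.final (.loop v e P) s = S.finalRounds v P s (e.eval s) := by
  rw [final, run]
  induction e.eval s with
  | zero => exact PMF.pure_map _ _
  | succ n ih =>
    simp only [finalRounds, ← ih, PMF.map_bind, PMF.pure_map, PMF.bind_map]
    rfl

theorem mem_support_final {s' : Store} :
    s' ∈ (S.final P s).support ↔ ∃ t, (s', t) ∈ (S.run P s).support := by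
  simp [final]

theorem unchanged_of_mem_support_finalRounds {V W : Finset ℕ} {v n : ℕ} {s' : Store} (hv : v ∈ V)
    (hP : ∀ s, ∀ s' ∈ (S.final P s).support, Unchanged V W s s')
    (h : s' ∈ (S.finalRounds v P s n).support) : Unchanged V W s s' := by
  induction n generalizing s' with
  | zero =>
    rw [finalRounds, PMF.mem_support_pure_iff] at h
    exact h ▸ .refl V W s
  | succ n ih =>
    obtain ⟨s₁, h₁, h₂⟩ := (PMF.mem_support_bind_iff _ _ _).1 h
    exact ((ih h₁).setNat hv n).trans (hP _ _ h₂)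

theorem unchanged_of_mem_support {V W : Finset ℕ} {s' : Store} (hV : P.natWrites ⊆ V)
    (hW : P.numWrites ⊆ W) (h : s' ∈ (S.final P s).support) : Unchanged V W s s' := by
  induction P generalizing s s' with
  | skip =>
    rw [final_skip, PMF.mem_support_pure_iff] at h
    exact h ▸ .refl V W s
  | setNat v e =>
    rw [final_setNat, PMF.mem_support_pure_iff] at h
    exact h ▸ (Unchanged.refl V W s).setNat (hV (Finset.mem_singleton_self v)) _
  | ceil v e =>
    rw [final_ceil, PMF.mem_support_pure_iff] at h
    exact h ▸ (Unchanged.refl V W s).setNat (hV (Finset.mem_singleton_self v)) _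
  | setNum a i j e =>
    rw [final_setNum, PMF.mem_support_pure_iff] at h
    exact h ▸ (Unchanged.refl V W s).setNum (hW (Finset.mem_singleton_self a)) _ _ _
  | test a i j ph q =>
    rw [final_test, PMF.mem_support_map_iff] at h
    obtain ⟨o, -, rfl⟩ := h
    exact (Unchanged.refl V W s).setNum (hW (Finset.mem_singleton_self a)) _ _ _
  | seq P Q ihP ihQ =>
    rw [final_seq, PMF.mem_support_bind_iff] at h
    obtain ⟨s₁, h₁, h₂⟩ := h
    exact (ihP (Finset.union_subset_left hV) (Finset.union_subset_left hW) h₁).trans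
      (ihQ (Finset.union_subset_right hV) (Finset.union_subset_right hW) h₂)
  | ite c P Q ihP ihQ =>
    by_cases hc : c.Holds s
    · rw [final_ite_of_holds hc] at h
      exact ihP (Finset.union_subset_left hV) (Finset.union_subset_left hW) h
    · rw [final_ite_of_not_holds hc] at h
      exact ihQ (Finset.union_subset_right hV) (Finset.union_subset_right hW) h
  | loop v e P ih =>
    rw [final_loop] at h
    obtain ⟨hv, hP⟩ := Finset.insert_subset_iff.1 hV
    exact unchanged_of_mem_support_finalRounds hv (fun _ _ => ih hP hW) h

end FactorizedSystem

/-! ### Probabilities and expectations -/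

theorem toOuterMeasure_le_one {α : Type*} (μ : PMF α) (A : Set α) : μ.toOuterMeasure A ≤ 1 := by
  rw [PMF.toOuterMeasure_apply, ← μ.tsum_coe]
  exact ENNReal.tsum_le_tsum (Set.indicator_le_self' fun _ _ => zero_le)

theorem toOuterMeasure_bind_le {α β : Type*} {μ : PMF α} {f : α → PMF β} {A : Set α} {B : Set β}
    {p q : ℝ≥0∞} (hA : μ.toOuterMeasure Aᶜ ≤ p)
    (hB : ∀ a ∈ μ.support, a ∈ A → (f a).toOuterMeasure Bᶜ ≤ q) :
    (μ.bind f).toOuterMeasure Bᶜ ≤ p + q := by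
  have hpoint (a : α) :
      μ a * (f a).toOuterMeasure Bᶜ ≤ Aᶜ.indicator μ a + μ a * q := by
    by_cases ha : a ∈ A
    · rw [Set.indicator_of_notMem (Set.notMem_compl_iff.2 ha), zero_add]
      by_cases h0 : μ a = 0
      · simp only [h0, zero_mul, le_refl]
      · gcongr
        exact hB a ((PMF.mem_support_iff μ a).2 h0) ha
    · rw [Set.indicator_of_mem (Set.mem_compl ha)]
      calc μ a * (f a).toOuterMeasure Bᶜ ≤ μ a * 1 := by
            gcongr
            exact toOuterMeasure_le_one _ _
        _ ≤ μ a + μ a * q := by rw [mul_one]; exact le_self_add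
  calc (μ.bind f).toOuterMeasure Bᶜ ≤ ∑' a, (Aᶜ.indicator μ a + μ a * q) := by
        rw [PMF.toOuterMeasure_bind_apply]
        exact ENNReal.tsum_le_tsum hpoint
    _ = μ.toOuterMeasure Aᶜ + q := by
        rw [ENNReal.tsum_add, ENNReal.tsum_mul_right, μ.tsum_coe, one_mul,
          PMF.toOuterMeasure_apply]
    _ ≤ p + q := by gcongr

theorem one_sub_le_toReal_toOuterMeasure {α : Type*} {μ : PMF α} {A : Set α} {p : ℝ} (hp : 0 ≤ p)
    (h : μ.toOuterMeasure Aᶜ ≤ ENNReal.ofReal p) : 1 - p ≤ (μ.toOuterMeasure A).toReal := by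
  have hle (B : Set α) : μ.toOuterMeasure B ≠ ∞ :=
    ne_top_of_le_ne_top ENNReal.one_ne_top (toOuterMeasure_le_one μ B)
  have hadd : 1 ≤ μ.toOuterMeasure A + μ.toOuterMeasure Aᶜ := by
    rw [PMF.toOuterMeasure_apply, PMF.toOuterMeasure_apply, ← ENNReal.tsum_add]
    simp only [Set.indicator_self_add_compl_apply, μ.tsum_coe, le_refl]
  have hreal := ENNReal.toReal_mono (ENNReal.add_ne_top.2 ⟨hle A, hle Aᶜ⟩) hadd
  rw [ENNReal.toReal_add (hle A) (hle Aᶜ), ENNReal.toReal_one] at hreal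
  linarith [ENNReal.toReal_le_of_le_ofReal hp h]

theorem tsum_bind_mul {α β : Type*} (μ : PMF α) (f : α → PMF β) (g : β → ℝ≥0∞) :
    ∑' b, μ.bind f b * g b = ∑' a, μ a * ∑' b, f a b * g b := by
  simp only [PMF.bind_apply, ← ENNReal.tsum_mul_right, ← ENNReal.tsum_mul_left, mul_assoc]
  exact ENNReal.tsum_comm

theorem tsum_pure_mul {α : Type*} (a : α) (g : α → ℝ≥0∞) : ∑' b, PMF.pure a b * g b = g a := by
  rw [tsum_eq_single a fun b hb => by rw [PMF.pure_apply_of_ne _ _ hb, zero_mul],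
    PMF.pure_apply_self, one_mul]

variable {S : FactorizedSystem} {P Q : Prog} {s : Store}

/-- The final memory of `P` violates `A` with probability at most `p`. With `p = 0` this is a
statement about all runs. -/
def Likely (S : FactorizedSystem) (P : Prog) (s : Store) (p : ℝ≥0∞) (A : Store → Prop) : Prop :=
  (S.final P s).toOuterMeasure {s' | A s'}ᶜ ≤ p

theorem likely_zero_iff {A : Store → Prop} :
    Likely S P s 0 A ↔ ∀ s' ∈ (S.final P s).support, A s' := by
  rw [Likely, nonpos_iff_eq_zero, PMF.toOuterMeasure_apply_eq_zero_iff,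
    Set.disjoint_compl_right_iff_subset]
  rfl

namespace Likely

variable {p p' : ℝ≥0∞} {A B : Store → Prop}

theorem mono (h : Likely S P s p A) (hp : p ≤ p')
    (hAB : ∀ s' ∈ (S.final P s).support, A s' → B s') : Likely S P s p' B := by
  refine le_trans ?_ (h.trans hp)
  exact PMF.toOuterMeasure_mono _ fun s' hs' hA => hs'.1 (hAB s' hs'.2 hA)

theorem and (hA : Likely S P s p A) (hB : Likely S P s p' B) :
    Likely S P s (p + p') fun s' => A s' ∧ B s' := by
  have hunion : {s' | A s' ∧ B s'}ᶜ = {s' | A s'}ᶜ ∪ {s' | B s'}ᶜ := Set.compl_inter _ _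
  rw [Likely, hunion]
  exact (MeasureTheory.measure_union_le _ _).trans (add_le_add hA hB)

theorem seq (hP : Likely S P s p A)
    (hQ : ∀ s' ∈ (S.final P s).support, A s' → Likely S Q s' p' B) :
    Likely S (.seq P Q) s (p + p') B := by
  rw [Likely, FactorizedSystem.final_seq]
  exact toOuterMeasure_bind_le hP hQ

theorem loop {v : ℕ} {e : NatExp} {A : ℕ → Store → Prop} (h0 : A 0 s)
    (hP : ∀ n < e.eval s, ∀ s', Unchanged (insert v P.natWrites) P.numWrites s s' → A n s' →
      Likely S P (s'.setNat v n) p (A (n + 1))) :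
    Likely S (.loop v e P) s (e.eval s * p) (A (e.eval s)) := by
  have hrounds (n : ℕ) (hn : n ≤ e.eval s) :
      (S.finalRounds v P s n).toOuterMeasure {s' | A n s'}ᶜ ≤ n * p := by
    induction n with
    | zero =>
      rw [FactorizedSystem.finalRounds, PMF.toOuterMeasure_pure_apply, if_neg fun h => h h0]
      exact zero_le
    | succ n ih =>
      rw [Nat.cast_succ, add_mul, one_mul]
      refine toOuterMeasure_bind_le (ih (Nat.le_of_succ_le hn)) fun s' hs' hA => ?_
      refine hP n hn s' (FactorizedSystem.unchanged_of_mem_support_finalRounds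
        (Finset.mem_insert_self _ _) (fun _ _ h => ?_) hs') hA
      exact FactorizedSystem.unchanged_of_mem_support (Finset.subset_insert _ _) subset_rfl h
  rw [Likely, FactorizedSystem.final_loop]
  exact hrounds _ le_rfl

end Likely

/-- The expectation of `f` in the final memory of `P` is at most `b`. -/
def MeanLE (S : FactorizedSystem) (P : Prog) (s : Store) (f : Store → ℝ≥0∞) (b : ℝ≥0∞) : Prop :=
  ∑' s', S.final P s s' * f s' ≤ b

namespace MeanLE

variable {f g : Store → ℝ≥0∞} {b b' : ℝ≥0∞}

theorem mono (h : MeanLE S P s f b) (hb : b ≤ b') : MeanLE S P s f b' := h.trans hb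

theorem of_final_eq_pure {s' : Store} (h : S.final P s = PMF.pure s') :
    MeanLE S P s f (f s') := by
  rw [MeanLE, h, tsum_pure_mul]

theorem test {a : ℕ} {i j : NatExp} {ph : Bool} {q : Query}
    (h : ∑ o, S.outcome s ph q o * f (s.setNum a (i.eval s) (j.eval s) (if o then 1 else 0)) ≤ b) :
    MeanLE S (.test a i j ph q) s f b := by
  rw [MeanLE, FactorizedSystem.final_test, ← PMF.bind_pure_comp, tsum_bind_mul]
  simp only [Function.comp_apply, tsum_pure_mul, tsum_fintype]
  exact h

theorem seq (hP : MeanLE S P s g b)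
    (hQ : ∀ s' ∈ (S.final P s).support, MeanLE S Q s' f (g s')) : MeanLE S (.seq P Q) s f b := by
  rw [MeanLE, FactorizedSystem.final_seq, tsum_bind_mul]
  refine le_trans (ENNReal.tsum_le_tsum fun s' => ?_) hP
  by_cases hs' : S.final P s s' = 0
  · simp only [hs', zero_mul, le_refl]
  · exact mul_le_mul_right (hQ s' ((PMF.mem_support_iff _ _).2 hs')) _

theorem const_mul (c : ℝ≥0∞) (h : MeanLE S P s f b) :
    MeanLE S P s (fun s' => c * f s') (c * b) := by
  simp only [MeanLE, mul_left_comm _ c, ENNReal.tsum_mul_left]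
  exact mul_le_mul_right h c

theorem loop {v : ℕ} {e : NatExp} {f : ℕ → Store → ℝ≥0∞} (c : ℕ → ℝ≥0∞)
    (hP : ∀ n < e.eval s, ∀ s', Unchanged (insert v P.natWrites) P.numWrites s s' →
      MeanLE S P (s'.setNat v n) (f (n + 1)) (c n * f n s')) :
    MeanLE S (.loop v e P) s (f (e.eval s)) ((∏ n ∈ Finset.range (e.eval s), c n) * f 0 s) := by
  have hrounds (n : ℕ) (hn : n ≤ e.eval s) :
      ∑' s', S.finalRounds v P s n s' * f n s' ≤ (∏ i ∈ Finset.range n, c i) * f 0 s := by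
    induction n with
    | zero => rw [FactorizedSystem.finalRounds, tsum_pure_mul, Finset.prod_range_zero, one_mul]
    | succ n ih =>
      rw [FactorizedSystem.finalRounds, tsum_bind_mul, Finset.prod_range_succ, mul_comm _ (c n),
        mul_assoc]
      refine le_trans (ENNReal.tsum_le_tsum fun s' => ?_)
        ((ENNReal.tsum_mul_left.trans_le (mul_le_mul_right (ih (Nat.le_of_succ_le hn)) (c n))))
      rw [mul_left_comm]
      by_cases hs' : S.finalRounds v P s n s' = 0
      · simp only [hs', zero_mul, le_refl]
      refine mul_le_mul_right (hP n hn s' ?_) _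
      refine FactorizedSystem.unchanged_of_mem_support_finalRounds (Finset.mem_insert_self _ _)
        (fun _ _ h => ?_) ((PMF.mem_support_iff _ _).2 hs')
      exact FactorizedSystem.unchanged_of_mem_support (Finset.subset_insert _ _) subset_rfl h
  rw [MeanLE, FactorizedSystem.final_loop]
  exact hrounds _ le_rfl

theorem likely {A : Store → Prop} (h : MeanLE S P s f b)
    (hA : ∀ s' ∈ (S.final P s).support, ¬A s' → 1 ≤ f s') : Likely S P s b A := by
  rw [Likely, PMF.toOuterMeasure_apply]
  refine le_trans (ENNReal.tsum_le_tsum fun s' => ?_) h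
  refine Set.indicator_apply_le' (fun hnot => ?_) fun _ => zero_le
  by_cases hs' : S.final P s s' = 0
  · rw [hs', zero_mul]
  · exact le_mul_of_one_le_right zero_le (hA s' ((PMF.mem_support_iff _ _).2 hs') hnot)

end MeanLE

/-! ### Time -/

namespace NatExp

/-- The registers that an expression reads. -/
def regs : NatExp → Finset ℕ
  | lit _ => ∅
  | reg v => {v}
  | add e f => e.regs ∪ f.regs
  | sub e f => e.regs ∪ f.regs

theorem eval_congr {e : NatExp} {s s' : Store} (h : ∀ v ∈ e.regs, s'.nat v = s.nat v) :
    e.eval s' = e.eval s := by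
  induction e with
  | lit n => rfl
  | reg v => exact h v (Finset.mem_singleton_self v)
  | add e f ihe ihf =>
    rw [eval, eval, ihe fun v hv => h v (Finset.mem_union_left _ hv),
      ihf fun v hv => h v (Finset.mem_union_right _ hv)]
  | sub e f ihe ihf =>
    rw [eval, eval, ihe fun v hv => h v (Finset.mem_union_left _ hv),
      ihf fun v hv => h v (Finset.mem_union_right _ hv)]

end NatExp

/-- The number of operations in the indices of a Hadamard test. -/
def Query.cost : Query → ℕ
  | uu i j => i.cost + j.cost
  | ub i => i.cost
  | vv i j => i.cost + j.cost

/-- The circuits that prepare the vectors have at most `G` gates. -/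
structure FactorizedSystem.GatesLE (S : FactorizedSystem) (G : ℕ) : Prop where
  circU : ∀ j, (S.circU j).gates.length ≤ G
  circV : ∀ j, (S.circV j).gates.length ≤ G
  circB : S.circB.gates.length ≤ G

namespace FactorizedSystem

variable {G : ℕ}

theorem length_gates_lookup_le {R n : ℕ} {c : Fin R → Circuit n}
    (h : ∀ j, (c j).gates.length ≤ G) (i : ℕ) : (lookup c i).gates.length ≤ G := by
  unfold lookup
  split
  · exact h _
  · exact Nat.zero_le G

theorem testCost_le (hS : S.GatesLE G) (s : Store) (ph : Bool) (q : Query) :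
    S.testCost s ph q ≤ 2 * G + 3 + q.cost := by
  have hU := length_gates_lookup_le hS.circU
  have hV := length_gates_lookup_le hS.circV
  cases q with
  | uu i j =>
    have h := length_testGates_le ph (lookup S.circU (i.eval s)) (lookup S.circU (j.eval s))
    have hi := hU (i.eval s)
    have hj := hU (j.eval s)
    simp only [testCost, Query.cost]
    lia
  | ub i =>
    have h := length_testGates_le ph (lookup S.circU (i.eval s)) S.circB
    have hi := hU (i.eval s)
    have hb := hS.circB
    simp only [testCost, Query.cost]
    lia
  | vv i j =>
    have h := length_testGates_le ph (lookup S.circV (i.eval s)) (lookup S.circV (j.eval s))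
    have hi := hV (i.eval s)
    have hj := hV (j.eval s)
    simp only [testCost, Query.cost]
    lia

end FactorizedSystem

namespace Prog

/-- The running time of a program that is started in `s`, if no circuit has more than `G` gates and
if the bounds of all loops have their initial values. -/
def timeBound (s : Store) (G : ℕ) : Prog → ℕ
  | skip => 1
  | setNat _ e => e.cost + 1
  | ceil _ e => e.cost + ⌈(e.eval s).re⌉₊ + 1
  | setNum _ i j e => i.cost + j.cost + e.cost + 1
  | test _ i j _ q => i.cost + j.cost + (2 * G + 3 + q.cost) + 1
  | seq P Q => P.timeBound s G + Q.timeBound s G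
  | ite c P Q => c.cost + max (P.timeBound s G) (Q.timeBound s G)
  | loop _ e P => e.cost + 1 + e.eval s * (P.timeBound s G + 1)

/-- The program does not round, and the bounds of its loops do not depend on registers in `V`. -/
def StaticLoops (V : Finset ℕ) : Prog → Prop
  | skip => True
  | setNat _ _ => True
  | ceil _ _ => False
  | setNum _ _ _ _ => True
  | test _ _ _ _ _ => True
  | seq P Q => P.StaticLoops V ∧ Q.StaticLoops V
  | ite _ P Q => P.StaticLoops V ∧ Q.StaticLoops V
  | loop _ e P => Disjoint e.regs V ∧ P.StaticLoops V

variable {V W : Finset ℕ} {G : ℕ} {s' : Store}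

theorem StaticLoops.timeBound_congr (hP : P.StaticLoops V) (h : Unchanged V W s s') :
    P.timeBound s' G = P.timeBound s G := by
  induction P with
  | skip => rfl
  | setNat v e => rfl
  | ceil v e => exact hP.elim
  | setNum a i j e => rfl
  | test a i j ph q => rfl
  | seq P Q ihP ihQ => rw [timeBound, timeBound, ihP hP.1, ihQ hP.2]
  | ite c P Q ihP ihQ => rw [timeBound, timeBound, ihP hP.1, ihQ hP.2]
  | loop v e P ih =>
    rw [timeBound, timeBound, ih hP.2,
      NatExp.eval_congr fun w hw => h.nat_eq w (Finset.disjoint_left.1 hP.1 hw)]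

end Prog

/-- The program stops within time `t`. -/
def TimeLE (S : FactorizedSystem) (P : Prog) (s : Store) (t : ℕ) : Prop :=
  ∀ o ∈ (S.run P s).support, o.2 ≤ t

namespace TimeLE

open FactorizedSystem

variable {t t' : ℕ}

theorem mono (h : TimeLE S P s t) (ht : t ≤ t') : TimeLE S P s t' :=
  fun o ho => (h o ho).trans ht

theorem ceil {v : ℕ} {e : NumExp} : TimeLE S (.ceil v e) s (e.cost + ⌈(e.eval s).re⌉₊ + 1) := by
  intro o ho
  rw [run, PMF.mem_support_pure_iff] at ho
  rw [ho]

theorem seq (hP : TimeLE S P s t) (hQ : ∀ s' ∈ (S.final P s).support, TimeLE S Q s' t') :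
    TimeLE S (.seq P Q) s (t + t') := by
  intro o ho
  simp only [run, PMF.mem_support_bind_iff, PMF.mem_support_pure_iff] at ho
  obtain ⟨o₁, h₁, o₂, h₂, rfl⟩ := ho
  exact add_le_add (hP o₁ h₁) (hQ o₁.1 (mem_support_final.2 ⟨o₁.2, h₁⟩) o₂ h₂)

theorem ite {c : Cond} (hP : c.Holds s → TimeLE S P s t) (hQ : ¬c.Holds s → TimeLE S Q s t') :
    TimeLE S (.ite c P Q) s (c.cost + max t t') := by
  intro o ho
  simp only [run, PMF.mem_support_bind_iff, PMF.mem_support_pure_iff] at ho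
  obtain ⟨o₁, h₁, rfl⟩ := ho
  split_ifs at h₁ with hc
  · exact Nat.add_le_add_left ((hP hc o₁ h₁).trans (le_max_left t t')) _
  · exact Nat.add_le_add_left ((hQ hc o₁ h₁).trans (le_max_right t t')) _

theorem loop {v : ℕ} {e : NatExp} (hP : ∀ s' n, Unchanged (insert v P.natWrites) P.numWrites s s' →
      TimeLE S P (s'.setNat v n) t) :
    TimeLE S (.loop v e P) s (e.cost + 1 + e.eval s * (t + 1)) := by
  rw [TimeLE, run]
  suffices h : ∀ n : ℕ, ∀ o ∈ PMF.support (Nat.rec (PMF.pure (s, e.cost + 1))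
      (fun k (prev : PMF (Store × ℕ)) => prev.bind fun o =>
        (S.run P (o.1.setNat v k)).bind fun o' => PMF.pure (o'.1, o.2 + o'.2 + 1)) n),
      Unchanged (insert v P.natWrites) P.numWrites s o.1 ∧ o.2 ≤ e.cost + 1 + n * (t + 1) from
    fun o ho => (h _ o ho).2
  intro n
  induction n with
  | zero =>
    intro o ho
    obtain rfl := (PMF.mem_support_pure_iff _ _).1 ho
    exact ⟨.refl _ _ s, Nat.le_add_right _ _⟩
  | succ n ih =>
    intro o ho
    simp only [PMF.mem_support_bind_iff, PMF.mem_support_pure_iff] at ho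
    obtain ⟨o₁, h₁, o₂, h₂, rfl⟩ := ho
    obtain ⟨hunch, htime⟩ := ih o₁ h₁
    refine ⟨(hunch.setNat (Finset.mem_insert_self v _) n).trans (unchanged_of_mem_support
      (Finset.subset_insert _ _) subset_rfl (mem_support_final.2 ⟨o₂.2, h₂⟩)), ?_⟩
    have hround := hP o₁.1 n hunch o₂ h₂
    dsimp only
    lia

theorem of_staticLoops {G : ℕ} {V : Finset ℕ} (hS : S.GatesLE G) (hV : P.natWrites ⊆ V)
    (hP : P.StaticLoops V) : TimeLE S P s (P.timeBound s G) := by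
  induction P generalizing s with
  | skip => exact fun o ho => ((PMF.mem_support_pure_iff _ _).1 ho).symm ▸ le_rfl
  | setNat v e => exact fun o ho => ((PMF.mem_support_pure_iff _ _).1 ho).symm ▸ le_rfl
  | ceil v e => exact hP.elim
  | setNum a i j e => exact fun o ho => ((PMF.mem_support_pure_iff _ _).1 ho).symm ▸ le_rfl
  | test a i j ph q =>
    intro o ho
    simp only [run, PMF.mem_support_bind_iff, PMF.mem_support_pure_iff] at ho
    obtain ⟨-, -, rfl⟩ := ho
    exact Nat.add_le_add_right (Nat.add_le_add_left (testCost_le hS s ph q) _) 1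
  | seq P Q ihP ihQ =>
    refine (ihP (Finset.union_subset_left hV) hP.1).seq fun s' hs' => ?_
    rw [← hP.2.timeBound_congr
      (unchanged_of_mem_support (Finset.union_subset_left hV) subset_rfl hs')]
    exact ihQ (Finset.union_subset_right hV) hP.2
  | ite c P Q ihP ihQ =>
    exact .ite (fun _ => ihP (Finset.union_subset_left hV) hP.1)
      fun _ => ihQ (Finset.union_subset_right hV) hP.2
  | loop v e P ih =>
    obtain ⟨hv, hPV⟩ := Finset.insert_subset_iff.1 hV
    refine .loop fun s' n h => ?_
    rw [← hP.2.timeBound_congr ((h.mono hV subset_rfl).setNat hv n)]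
    exact ih hPV hP.2

end TimeLE

/-! ### Exponential moments of a sign -/

theorem exp_le_add_exp_sq (x : ℝ) : Real.exp x ≤ x + Real.exp (x ^ 2) := by
  have hsq := Real.add_one_le_exp (x ^ 2)
  rcases le_or_gt |x| 1 with hx | hx
  · linarith [(abs_le.1 (Real.abs_exp_sub_one_sub_id_le hx)).2]
  rcases lt_abs.1 hx with hx | hx
  · linarith [Real.exp_le_exp.2 (show x ≤ x ^ 2 by nlinarith)]
  · nlinarith [Real.exp_le_one_iff.2 (show x ≤ 0 by linarith)]

-- The random variable takes the values `1 - ν` and `-1 - ν` and has mean zero.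
theorem centered_sign_mgf_le {ν : ℝ} (hν : |ν| ≤ 1) (a : ℝ) :
    (1 - ν) / 2 * Real.exp (a * (-1 - ν)) + (1 + ν) / 2 * Real.exp (a * (1 - ν)) ≤
      Real.exp (4 * a ^ 2) := by
  obtain ⟨hν₁, hν₂⟩ := abs_le.1 hν
  have hexp {x : ℝ} (hx : x ^ 2 ≤ 4) : Real.exp (a * x) ≤ a * x + Real.exp (4 * a ^ 2) := by
    refine (exp_le_add_exp_sq _).trans ?_
    rw [mul_pow, mul_comm (a ^ 2)]
    gcongr
  calc (1 - ν) / 2 * Real.exp (a * (-1 - ν)) + (1 + ν) / 2 * Real.exp (a * (1 - ν))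
      ≤ (1 - ν) / 2 * (a * (-1 - ν) + Real.exp (4 * a ^ 2)) +
        (1 + ν) / 2 * (a * (1 - ν) + Real.exp (4 * a ^ 2)) :=
        add_le_add (mul_le_mul_of_nonneg_left (hexp (by nlinarith)) (by linarith))
          (mul_le_mul_of_nonneg_left (hexp (by nlinarith)) (by linarith))
    _ = Real.exp (4 * a ^ 2) := by ring

/-! ### Estimation of weighted sums of inner products -/

/-- The inner product that a Hadamard test estimates. -/
def Query.mean (S : FactorizedSystem) (s : Store) : Query → ℂ
  | uu i j => star (FactorizedSystem.lookup S.circU (i.eval s)).state ⬝ᵥ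
      (FactorizedSystem.lookup S.circU (j.eval s)).state
  | ub i => star (FactorizedSystem.lookup S.circU (i.eval s)).state ⬝ᵥ S.circB.state
  | vv i j => star (FactorizedSystem.lookup S.circV (i.eval s)).state ⬝ᵥ
      (FactorizedSystem.lookup S.circV (j.eval s)).state

theorem Query.norm_mean_le (s : Store) (q : Query) : ‖q.mean S s‖ ≤ 1 := by
  cases q <;> exact norm_dotProduct_state_le _ _

theorem Query.mean_congr {s s' : Store} (h : s'.nat = s.nat) (q : Query) :
    q.mean S s' = q.mean S s := by
  have heval (e : NatExp) : e.eval s' = e.eval s := NatExp.eval_congr fun v _ => congrFun h v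
  cases q <;> simp only [mean, heval]

theorem outcome_true (s : Store) (ph : Bool) (q : Query) :
    S.outcome s ph q true = ENNReal.ofReal ((1 - (testPhase ph * q.mean S s).re) / 2) := by
  cases q <;> exact measureTest_true _ _ _

theorem outcome_false (s : Store) (ph : Bool) (q : Query) :
    S.outcome s ph q false = ENNReal.ofReal ((1 + (testPhase ph * q.mean S s).re) / 2) := by
  cases q <;> exact measureTest_false _ _ _

theorem abs_re_testPhase_mul_mean_le (s : Store) (ph : Bool) (q : Query) :
    |(testPhase ph * q.mean S s).re| ≤ 1 := by
  refine (Complex.abs_re_le_norm _).trans ?_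
  rw [norm_mul, norm_testPhase, one_mul]
  exact q.norm_mean_le s

/-- The number zero as an expression. -/
abbrev zeroExp : NatExp := .lit 0

/-- One Hadamard test whose outcome, as a sign, is multiplied by `e` and added to array 8. -/
def halfSample (ph : Bool) (q : Query) (e : NumExp) : Prog :=
  .seq (.test 9 zeroExp zeroExp ph q)
    (.setNum 8 zeroExp zeroExp (.add (.entry 8 zeroExp zeroExp)
      (.mul e (.sub (.lit 1) (.mul (.lit 2) (.entry 9 zeroExp zeroExp))))))

theorem natWrites_halfSample (ph : Bool) (q : Query) (e : NumExp) :
    (halfSample ph q e).natWrites = ∅ := rfl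

theorem numWrites_halfSample (ph : Bool) (q : Query) (e : NumExp) :
    (halfSample ph q e).numWrites = {8, 9} :=
  Finset.pair_comm 9 8

/-- An unbiased estimate of `e` times the inner product, which is added to array 8. -/
def sample (q : Query) (e : NumExp) : Prog :=
  .seq (halfSample false q e) (halfSample true q (.mul (.mul (.lit (-1)) .I) e))

theorem numWrites_sample (q : Query) (e : NumExp) : (sample q e).numWrites = {8, 9} := by
  simp only [sample, Prog.numWrites, numWrites_halfSample, Finset.union_self]

/-- The sum of `m` estimates of each of `J` inner products with weights `e`, where `m` is the
content of register 6 and register 12 holds the index of the inner product. The result is in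
array 8. -/
def estimate (J : NatExp) (q : Query) (e : NumExp) : Prog :=
  .seq (.setNum 8 zeroExp zeroExp (.lit 0)) (.loop 12 J (.loop 13 (.reg 6) (sample q e)))

theorem natWrites_estimate (J : NatExp) (q : Query) (e : NumExp) :
    (estimate J q e).natWrites = {12, 13} := rfl

theorem numWrites_estimate (J : NatExp) (q : Query) (e : NumExp) :
    (estimate J q e).numWrites = {8, 9} := by
  simp only [estimate, Prog.numWrites, numWrites_sample]
  rfl

/-- The exponential of `Re (w (x - z))`, where `x` is the content of array 8: its expectation
controls the probability that `x` deviates from `z` in the direction `star w`. -/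
def expError (w z : ℂ) (s : Store) : ℝ≥0∞ :=
  ENNReal.ofReal (Real.exp (w * (s.num 8 0 0 - z)).re)

theorem meanLE_halfSample {ph : Bool} {q : Query} {e : NumExp} {s : Store} {d w z : ℂ}
    (hd : ∀ s', Unchanged ∅ {8, 9} s s' → e.eval s' = d) :
    MeanLE S (halfSample ph q e) s (expError w (z + d * (testPhase ph * q.mean S s).re))
      (ENNReal.ofReal (Real.exp (4 * (w * d).re ^ 2)) * expError w z s) := by
  set ν := (testPhase ph * q.mean S s).re
  set a := (w * d).re
  have hν : |ν| ≤ 1 := abs_re_testPhase_mul_mean_le s ph q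
  obtain ⟨hν₁, hν₂⟩ := abs_le.1 hν
  have hvalue (o : ℂ) : (w * (s.num 8 0 0 + d * (1 - 2 * o) - (z + d * ν))).re =
      (w * (s.num 8 0 0 - z)).re + (w * d * ((1 - 2 * o) - ν)).re := by
    rw [← Complex.add_re]; congr 1; ring
  refine MeanLE.seq (g := fun s' => ENNReal.ofReal (Real.exp ((w * (s.num 8 0 0 - z)).re +
    (w * d * ((1 - 2 * s'.num 9 0 0) - ν)).re))) (.test ?_) fun s' hs' => ?_
  · have hsign (x : ℝ) : (w * d * (x - ν)).re = a * (x - ν) := by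
      rw [← Complex.ofReal_sub, Complex.re_mul_ofReal]
    have h₁ := hsign (-1)
    have h₀ := hsign 1
    push_cast at h₁ h₀
    simp only [Fintype.sum_bool, outcome_true, outcome_false, NatExp.eval, Store.num_setNum,
      and_self, if_true, Bool.false_eq_true, if_false, mul_one, mul_zero, sub_zero]
    rw [show (1 : ℂ) - 2 = -1 by norm_num, h₁, h₀, expError, Real.exp_add, Real.exp_add]
    rw [← ENNReal.ofReal_mul (by linarith), ← ENNReal.ofReal_mul (by linarith),
      ← ENNReal.ofReal_mul (by positivity), ← ENNReal.ofReal_add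
        (mul_nonneg (by linarith) (by positivity)) (mul_nonneg (by linarith) (by positivity))]
    refine ENNReal.ofReal_le_ofReal ?_
    nlinarith [mul_le_mul_of_nonneg_right (centered_sign_mgf_le hν a)
      (Real.exp_pos (w * (s.num 8 0 0 - z)).re).le]
  · rw [FactorizedSystem.final_test, PMF.mem_support_map_iff] at hs'
    obtain ⟨o, -, rfl⟩ := hs'
    convert MeanLE.of_final_eq_pure FactorizedSystem.final_setNum using 1
    simp only [expError, NatExp.eval, NumExp.eval, Store.num_setNum, and_self, if_true]
    rw [hd _ ((Unchanged.refl _ _ s).setNum (by decide) _ _ _), ← hvalue]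
    simp

theorem meanLE_sample {q : Query} {e : NumExp} {s : Store} {d w z : ℂ}
    (hd : ∀ s', Unchanged ∅ {8, 9} s s' → e.eval s' = d) :
    MeanLE S (sample q e) s (expError w (z + d * q.mean S s))
      (ENNReal.ofReal (Real.exp (4 * (‖w‖ * ‖d‖) ^ 2)) * expError w z s) := by
  set μ := q.mean S s with hμ
  have htarget : z + d * μ = z + d * (testPhase false * μ).re +
      -Complex.I * d * (testPhase true * μ).re := by
    have hμ' := Complex.re_add_im μ
    simp only [testPhase, Bool.false_eq_true, if_false, if_true, one_mul, Complex.I_mul_re,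
      Complex.ofReal_neg]
    linear_combination -d * hμ'
  have hnorm : (‖w‖ * ‖d‖) ^ 2 = (w * d).re ^ 2 + (w * (-Complex.I * d)).re ^ 2 := by
    rw [← norm_mul, ← Complex.normSq_eq_norm_sq, Complex.normSq_apply, mul_left_comm w,
      neg_mul, Complex.neg_re, Complex.I_mul_re]
    ring
  rw [hnorm, mul_add, Real.exp_add, ENNReal.ofReal_mul (Real.exp_pos _).le,
    mul_comm (ENNReal.ofReal _) (ENNReal.ofReal _), mul_assoc, htarget]
  refine (MeanLE.const_mul _ (meanLE_halfSample hd)).seq fun s' hs' => ?_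
  have hunch : Unchanged ∅ {8, 9} s s' :=
    FactorizedSystem.unchanged_of_mem_support (natWrites_halfSample false q e).subset
      (numWrites_halfSample false q e).subset hs'
  rw [hμ, ← Query.mean_congr (funext fun v => hunch.nat_eq v (Finset.notMem_empty v))]
  refine meanLE_halfSample fun s'' hs'' => ?_
  simp [NumExp.eval, hd s'' (hunch.trans hs'')]

theorem meanLE_loop_sample {q : Query} {e : NumExp} {s : Store} {m : ℕ} {d μ w z : ℂ}
    (hm : s.nat 6 = m)
    (hd : ∀ s', Unchanged {13} {8, 9} s s' → e.eval s' = d ∧ q.mean S s' = μ) :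
    MeanLE S (.loop 13 (.reg 6) (sample q e)) s (expError w (z + m * (d * μ)))
      (ENNReal.ofReal (Real.exp (4 * (‖w‖ * ‖d‖) ^ 2)) ^ m * expError w z s) := by
  have h := MeanLE.loop (S := S) (P := sample q e) (s := s) (v := 13) (e := .reg 6)
    (f := fun l => expError w (z + l * (d * μ)))
    (fun _ => ENNReal.ofReal (Real.exp (4 * (‖w‖ * ‖d‖) ^ 2))) fun l _ s' hs' => ?_
  · simpa only [NatExp.eval, hm, Finset.prod_const, Finset.card_range, Nat.cast_zero, zero_mul,
      add_zero] using h
  have hs₁ : Unchanged {13} {8, 9} s (s'.setNat 13 l) :=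
    .setNat (Finset.mem_singleton_self 13) (numWrites_sample q e ▸ hs') l
  have hsample := meanLE_sample (S := S) (w := w) (z := z + l * (d * μ)) (q := q) (e := e) (d := d)
    (s := s'.setNat 13 l) fun s'' hs'' =>
      (hd s'' (hs₁.trans (hs''.mono (Finset.empty_subset _) subset_rfl))).1
  rw [(hd _ hs₁).2] at hsample
  convert hsample using 2
  · push_cast
    ring
  · rfl

theorem prod_ofReal_exp_pow (w : ℂ) (d : ℕ → ℂ) (m J : ℕ) :
    ∏ j ∈ Finset.range J, ENNReal.ofReal (Real.exp (4 * (‖w‖ * ‖d j‖) ^ 2)) ^ m =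
      ENNReal.ofReal (Real.exp (4 * ‖w‖ ^ 2 * (m * ∑ j ∈ Finset.range J, ‖d j‖ ^ 2))) := by
  simp only [← ENNReal.ofReal_pow (Real.exp_pos _).le, ← Real.exp_nat_mul]
  rw [← ENNReal.ofReal_prod_of_nonneg fun _ _ => (Real.exp_pos _).le, ← Real.exp_sum,
    Finset.mul_sum, Finset.mul_sum]
  congr 2
  exact Finset.sum_congr rfl fun j _ => by ring

theorem meanLE_estimate {J : NatExp} {q : Query} {e : NumExp} {s : Store} {m : ℕ}
    {d μ : ℕ → ℂ} (w : ℂ) (hm : s.nat 6 = m)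
    (hd : ∀ j < J.eval s, ∀ s', Unchanged {12, 13} {8, 9} s s' → s'.nat 12 = j →
      e.eval s' = d j ∧ q.mean S s' = μ j) :
    MeanLE S (estimate J q e) s
      (expError w (m * ∑ j ∈ Finset.range (J.eval s), d j * μ j))
      (ENNReal.ofReal (Real.exp (4 * ‖w‖ ^ 2 *
        (m * ∑ j ∈ Finset.range (J.eval s), ‖d j‖ ^ 2)))) := by
  set s₁ := s.setNum 8 0 0 0 with hs₁
  let target (j : ℕ) : ℂ := m * ∑ i ∈ Finset.range j, d i * μ i
  have hstart : expError w (target 0) s₁ = 1 := by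
    simp only [target, hs₁, expError, Store.num_setNum, Finset.range_zero, Finset.sum_empty,
      mul_zero, sub_zero, and_self, if_true, Complex.zero_re, Real.exp_zero, ENNReal.ofReal_one]
  have hfirst : MeanLE S (estimate J q e) s = MeanLE S (.loop 12 J (.loop 13 (.reg 6) (sample q e)))
      s₁ := by
    funext f b
    simp only [MeanLE, estimate, FactorizedSystem.final_seq, FactorizedSystem.final_setNum,
      PMF.pure_bind, NatExp.eval, NumExp.eval, Rat.cast_zero, hs₁]
  have hJ : J.eval s₁ = J.eval s := NatExp.eval_congr fun _ _ => rfl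
  rw [hfirst, ← prod_ofReal_exp_pow, ← hJ, ← mul_one (∏ _ ∈ _, _), ← hstart]
  refine MeanLE.loop (f := fun j => expError w (target j)) _ fun j hj s' hs' => ?_
  have hs₂ : Unchanged {12, 13} {8, 9} s (s'.setNat 12 j) := by
    refine .setNat (by decide) (((Unchanged.refl {12, 13} {8, 9} s).setNum (by decide) 0 0 0).trans
      (hs'.mono ?_ ?_)) j
    · exact subset_rfl
    · exact (numWrites_sample q e).subset
  have htarget : target (j + 1) = target j + m * (d j * μ j) := by
    rw [← mul_add, ← Finset.sum_range_succ]
  rw [htarget]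
  refine meanLE_loop_sample ?_ fun s'' hs'' => ?_
  · rw [hs₂.nat_eq 6 (by decide), hm]
  · refine hd j (hJ ▸ hj) s'' (hs₂.trans (hs''.mono (by decide) subset_rfl)) ?_
    rw [hs''.nat_eq 12 (by decide), Store.nat_setNat, if_pos rfl]

theorem norm_le_of_directions {z : ℂ} {h : ℝ}
    (hz : (1 * z).re ≤ h ∧ (-1 * z).re ≤ h ∧ (Complex.I * z).re ≤ h ∧ (-Complex.I * z).re ≤ h) :
    ‖z‖ ≤ 2 * h := by
  simp only [one_mul, neg_mul, Complex.neg_re, Complex.I_mul_re, neg_neg] at hz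
  obtain ⟨h₁, h₂, h₃, h₄⟩ := hz
  have hre : |z.re| ≤ h := abs_le.2 ⟨by linarith, h₁⟩
  have him : |z.im| ≤ h := abs_le.2 ⟨by linarith, h₄⟩
  linarith [Complex.norm_le_abs_re_add_abs_im z]

theorem likely_re_estimate_le {J : NatExp} {q : Query} {e : NumExp} {s : Store} {m : ℕ}
    {d μ : ℕ → ℂ} {V h : ℝ} (w : ℂ) (hw : ‖w‖ = 1) (hV : 0 < V) (hh : 0 ≤ h) (hm : s.nat 6 = m)
    (hd : ∀ j < J.eval s, ∀ s', Unchanged {12, 13} {8, 9} s s' → s'.nat 12 = j →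
      e.eval s' = d j ∧ q.mean S s' = μ j)
    (hdV : m * ∑ j ∈ Finset.range (J.eval s), ‖d j‖ ^ 2 ≤ V) :
    Likely S (estimate J q e) s (ENNReal.ofReal (Real.exp (-(h ^ 2 / (16 * V))))) fun s' =>
      (w * (s'.num 8 0 0 - m * ∑ j ∈ Finset.range (J.eval s), d j * μ j)).re ≤ h := by
  -- Markov's inequality; `l` minimizes the exponent `4 l ^ 2 V - l h` of the resulting bound.
  set l : ℝ := h / (8 * V) with hl
  have hl0 : 0 ≤ l := by positivity
  have hmean := (meanLE_estimate (S := S) ((l : ℂ) * w) hm hd).const_mul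
    (ENNReal.ofReal (Real.exp (-(l * h))))
  refine (hmean.mono ?_).likely fun s' _ hs' => ?_
  · rw [← ENNReal.ofReal_mul (Real.exp_pos _).le, ← Real.exp_add, norm_mul, hw, mul_one,
      Complex.norm_real, Real.norm_of_nonneg hl0]
    refine ENNReal.ofReal_le_ofReal (Real.exp_le_exp.2 ?_)
    calc -(l * h) + 4 * l ^ 2 * _ ≤ -(l * h) + 4 * l ^ 2 * V := by gcongr
      _ = -(h ^ 2 / (16 * V)) := by rw [hl]; field_simp; ring
  · rw [expError, ← ENNReal.ofReal_mul (Real.exp_pos _).le, ← Real.exp_add, mul_assoc,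
      Complex.re_ofReal_mul, ← ENNReal.ofReal_one]
    refine ENNReal.ofReal_le_ofReal (Real.one_le_exp ?_)
    nlinarith [mul_le_mul_of_nonneg_left (not_le.1 hs').le hl0]

theorem likely_estimate {J : NatExp} {q : Query} {e : NumExp} {s : Store} {m : ℕ}
    {d μ : ℕ → ℂ} {V h : ℝ} (hV : 0 < V) (hh : 0 ≤ h) (hm : s.nat 6 = m)
    (hd : ∀ j < J.eval s, ∀ s', Unchanged {12, 13} {8, 9} s s' → s'.nat 12 = j →
      e.eval s' = d j ∧ q.mean S s' = μ j)
    (hdV : m * ∑ j ∈ Finset.range (J.eval s), ‖d j‖ ^ 2 ≤ V) :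
    Likely S (estimate J q e) s (4 * ENNReal.ofReal (Real.exp (-(h ^ 2 / (16 * V))))) fun s' =>
      ‖s'.num 8 0 0 - m * ∑ j ∈ Finset.range (J.eval s), d j * μ j‖ ≤ 2 * h := by
  have hdir (w : ℂ) (hw : ‖w‖ = 1) := likely_re_estimate_le w hw hV hh hm hd hdV
  refine ((hdir 1 (by simp)).and ((hdir (-1) (by simp)).and
    ((hdir Complex.I (by simp)).and (hdir (-Complex.I) (by simp))))).mono (le_of_eq (by ring))
    fun s' _ hs' => norm_le_of_directions hs'

/-! ### Componentwise computation of vectors -/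

/-- The vector in the first column of an array. -/
def Store.vec (s : Store) (a R : ℕ) : EuclideanSpace ℂ (Fin R) :=
  WithLp.toLp 2 fun i => s.num a i 0

theorem Store.vec_apply (s : Store) (a R : ℕ) (i : Fin R) : s.vec a R i = s.num a i 0 := rfl

theorem Unchanged.vec_eq {V W : Finset ℕ} {s s' : Store} (h : Unchanged V W s s') {a : ℕ}
    (ha : a ∉ W) (R : ℕ) : s'.vec a R = s.vec a R := by
  rw [Store.vec, Store.vec, h.num_eq a ha]

theorem norm_le_sqrt_card_mul {ι : Type*} [Fintype ι] {x : EuclideanSpace ℂ ι} {δ : ℝ}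
    (hδ : 0 ≤ δ) (hx : ∀ i, ‖x i‖ ≤ δ) : ‖x‖ ≤ √(Fintype.card ι) * δ := by
  rw [EuclideanSpace.norm_eq]
  refine Real.sqrt_le_iff.2 ⟨by positivity, ?_⟩
  rw [mul_pow, Real.sq_sqrt (Nat.cast_nonneg _), ← nsmul_eq_mul]
  exact Finset.sum_le_card_nsmul _ _ _ fun i _ => pow_le_pow_left₀ (norm_nonneg _) (hx i) 2

/-- The program that runs `P` and then writes `e` to an entry of array `a`, for each index in
register 11 below the content of register 0. -/
def assignEach (a : ℕ) (P : Prog) (e : NumExp) : Prog :=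
  .loop 11 (.reg 0) (.seq P (.setNum a (.reg 11) zeroExp e))

/-- The program that fills an array with the values of an expression. -/
def fill (a : ℕ) (e : NumExp) : Prog := assignEach a .skip e

theorem natWrites_assignEach (a : ℕ) (P : Prog) (e : NumExp) :
    (assignEach a P e).natWrites = insert 11 P.natWrites := by
  simp only [assignEach, Prog.natWrites, Finset.union_empty]

theorem numWrites_assignEach (a : ℕ) (P : Prog) (e : NumExp) :
    (assignEach a P e).numWrites = insert a P.numWrites := by
  simp only [assignEach, Prog.numWrites, Finset.union_comm, Finset.insert_eq]

theorem likely_assignEach {a : ℕ} {P : Prog} {e : NumExp} {s : Store} {R : ℕ} {p : ℝ≥0∞}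
    {Good : Fin R → ℂ → Prop} (hR : s.nat 0 = R) (ha : a ∉ P.numWrites) (h11 : 11 ∉ P.natWrites)
    (h : ∀ (i : Fin R) (s' : Store), Unchanged (insert 11 P.natWrites) (insert a P.numWrites) s s' →
      s'.nat 11 = i → Likely S P s' p fun s'' => Good i (e.eval s'')) :
    Likely S (assignEach a P e) s (R * p) fun s' => ∀ i, Good i (s'.vec a R i) := by
  have hloop := Likely.loop (S := S) (v := 11) (e := .reg 0) (p := p) (s := s)
    (P := .seq P (.setNum a (.reg 11) zeroExp e))
    (A := fun n s' => ∀ i : Fin R, (i : ℕ) < n → Good i (s'.num a i 0))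
    (fun i hi => absurd hi (Nat.not_lt_zero _)) fun n hn s' hs' hA => ?_
  · rw [NatExp.eval, hR] at hloop
    exact hloop.mono le_rfl fun s' _ hs' i => hs' i i.2
  rw [NatExp.eval, hR] at hn
  have hs₁ : Unchanged (insert 11 P.natWrites) (insert a P.numWrites) s (s'.setNat 11 n) := by
    refine .setNat (Finset.mem_insert_self _ _) (hs'.mono ?_ ?_) n
    · simp only [Prog.natWrites, Finset.union_empty, subset_refl]
    · simp only [Prog.numWrites, Finset.union_comm, Finset.insert_eq, subset_refl]
  rw [← add_zero p]
  refine (h ⟨n, hn⟩ _ hs₁ (by rw [Store.nat_setNat, if_pos rfl])).seq fun s'' hs'' hGood => ?_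
  have hP := FactorizedSystem.unchanged_of_mem_support subset_rfl subset_rfl hs''
  simp only [likely_zero_iff, FactorizedSystem.final_setNum, PMF.mem_support_pure_iff, forall_eq]
  intro i hi
  have hn'' : s''.nat 11 = n := by rw [hP.nat_eq 11 h11, Store.nat_setNat, if_pos rfl]
  simp only [NatExp.eval, hn'', Store.num_setNum, true_and, and_true]
  rcases eq_or_ne (i : ℕ) n with hin | hin
  · rwa [if_pos hin, (Fin.ext hin : i = ⟨n, hn⟩)]
  · rw [if_neg hin, hP.num_eq a ha]
    exact hA i (by omega)

theorem likely_fill {a : ℕ} {e : NumExp} {s : Store} {R : ℕ} {x : EuclideanSpace ℂ (Fin R)}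
    (hR : s.nat 0 = R)
    (he : ∀ (i : Fin R) (s' : Store), Unchanged {11} {a} s s' → s'.nat 11 = i → e.eval s' = x i) :
    Likely S (fill a e) s 0 fun s' => s'.vec a R = x := by
  have h := likely_assignEach (S := S) (a := a) (P := .skip) (e := e) (p := 0)
    (Good := fun i z => z = x i) hR (Finset.notMem_empty a) (Finset.notMem_empty 11)
    fun i s' hs' hi => by
      simp only [likely_zero_iff, FactorizedSystem.final_skip, PMF.mem_support_pure_iff, forall_eq]
      exact he i s' hs' hi
  exact h.mono (mul_zero _).le fun s' _ hs' => PiLp.ext hs'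

theorem likely_estimate_div {J : NatExp} {q : Query} {e : NumExp} {s : Store} {m n : ℕ}
    {d μ : Fin n → ℂ} {v η : ℝ} (hm : s.nat 6 = m) (hm0 : 0 < m) (hn : J.eval s = n)
    (hd : ∀ (j : Fin n) (s' : Store), Unchanged {12, 13} {8, 9} s s' → s'.nat 12 = j →
      e.eval s' = d j ∧ q.mean S s' = μ j)
    (hv : 0 < v) (hη : 0 ≤ η) (hdv : ∑ j, ‖d j‖ ^ 2 ≤ v ^ 2) :
    Likely S (estimate J q e) s (4 * ENNReal.ofReal (Real.exp (-(m * η ^ 2 / 16)))) fun s' =>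
      ‖s'.num 8 0 0 / m - ∑ j, d j * μ j‖ ≤ 2 * (v * η) := by
  have hm0' : (0 : ℝ) < m := Nat.cast_pos.2 hm0
  let extend (f : Fin n → ℂ) (j : ℕ) : ℂ := if h : j < n then f ⟨j, h⟩ else 0
  have hextend (f : Fin n → ℂ) (j : Fin n) : extend f j = f j := dif_pos j.2
  have h := likely_estimate (S := S) (J := J) (q := q) (e := e) (d := extend d) (μ := extend μ)
    (V := m * v ^ 2) (h := m * (v * η)) (by positivity) (by positivity) hm
    (fun j hj s' hs' hj' => by
      rw [hn] at hj
      rw [← Fin.val_mk hj, hextend, hextend]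
      exact hd ⟨j, hj⟩ s' hs' hj')
    (by
      rw [hn, Finset.sum_range]
      simp only [hextend]
      gcongr)
  rw [show (m * (v * η)) ^ 2 / (16 * (m * v ^ 2)) = m * η ^ 2 / 16 by field_simp] at h
  refine h.mono le_rfl fun s' _ hs' => ?_
  rw [hn, Finset.sum_range] at hs'
  simp only [hextend] at hs'
  rw [div_sub' (Nat.cast_ne_zero.2 hm0.ne'), norm_div, Complex.norm_natCast, div_le_iff₀ hm0']
  linarith

/-! ### The iteration as a program -/

/-- Weights and circuits that describe the columns of a matrix with norm at most `σ`. -/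
structure BoundedColumns {N R : ℕ} (w : Fin R → ℝ) (C : Fin R → Circuit (Nat.clog 2 N))
    (σ : ℝ) : Prop where
  nonneg : ∀ j, 0 ≤ w j
  prepares : ∀ j, PreparesIn N (C j)
  pos : 0 < σ
  norm_le : ∀ y, ‖(columnMatrix w C).toEuclideanLin y‖ ≤ σ * ‖y‖

/-- The memory provides the Gram matrix of the columns described by `w` and `C`: the weights are in
array `a`, the number `σ` is entry `c` of array 2, the query `q` estimates the inner products of the
states with indices in registers 11 and 12, and register 6 holds the number `m` of samples. -/
structure GramAccess (S : FactorizedSystem) {N : ℕ} (w : Fin S.R → ℝ)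
    (C : Fin S.R → Circuit (Nat.clog 2 N)) (σ : ℝ) (a c : ℕ) (q : Query) (m : ℕ) (s : Store) :
    Prop where
  array_le : a ≤ 2
  nat_zero : s.nat 0 = S.R
  nat_six : s.nat 6 = m
  weight : ∀ i : Fin S.R, s.num a i 0 = w i
  norm : s.num 2 c 0 = σ
  mean : ∀ (s' : Store) (i j : Fin S.R), s'.nat 11 = i → s'.nat 12 = j →
    q.mean S s' = star (C i).state ⬝ᵥ (C j).state

theorem BoundedColumns.sum_sq_le {N R : ℕ} {w : Fin R → ℝ} {C : Fin R → Circuit (Nat.clog 2 N)}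
    {σ B : ℝ} (hC : BoundedColumns w C σ) {y : EuclideanSpace ℂ (Fin R)} (hy : ‖y‖ ≤ B) :
    ∑ j, ‖(w j : ℂ) * y j‖ ^ 2 ≤ (σ * B) ^ 2 := by
  have hσ := hC.pos
  calc ∑ j, ‖(w j : ℂ) * y j‖ ^ 2 ≤ ∑ j, σ ^ 2 * ‖y j‖ ^ 2 := by
        gcongr with j
        rw [norm_mul, mul_pow, Complex.norm_real, Real.norm_of_nonneg (hC.nonneg j)]
        gcongr
        · exact hC.nonneg j
        · exact weight_le hC.nonneg hC.prepares hC.norm_le j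
    _ = σ ^ 2 * ‖y‖ ^ 2 := by rw [← Finset.mul_sum, EuclideanSpace.norm_sq_eq]
    _ ≤ (σ * B) ^ 2 := by rw [mul_pow]; gcongr

section Solve

variable {N : ℕ} {w : Fin S.R → ℝ} {C : Fin S.R → Circuit (Nat.clog 2 N)} {σ : ℝ} {a c m : ℕ}
  {q : Query} {s s' : Store}

theorem GramAccess.of_unchanged (hs : GramAccess S w C σ a c q m s)
    (h : Unchanged {10, 11, 12, 13} {5, 6, 7, 8, 9} s s') : GramAccess S w C σ a c q m s' := by
  have hnum {b : ℕ} (hb : b ≤ 2) : s'.num b = s.num b :=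
    h.num_eq b (by simp only [Finset.mem_insert, Finset.mem_singleton]; omega)
  exact ⟨hs.array_le, (h.nat_eq 0 (by decide)).trans hs.nat_zero,
    (h.nat_eq 6 (by decide)).trans hs.nat_six, fun i => by rw [hnum hs.array_le, hs.weight],
    by rw [hnum le_rfl, hs.norm], hs.mean⟩

/-- One step `y ↦ y + σ⁻² (g - G y)` of the Richardson iteration, where `G` is the Gram matrix,
`g` is in array 5 and `y` is in array 6. -/
def stepProg (a : ℕ) (q : Query) (c : ℕ) : Prog :=
  .seq
    (assignEach 7
      (estimate (.reg 0) q (.mul (.entry a (.reg 12) zeroExp) (.entry 6 (.reg 12) zeroExp)))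
      (.add (.entry 6 (.reg 11) zeroExp)
        (.div
          (.sub (.entry 5 (.reg 11) zeroExp)
            (.mul (.entry a (.reg 11) zeroExp) (.div (.entry 8 zeroExp zeroExp) (.ofNat (.reg 6)))))
          (.mul (.entry 2 (.lit c) zeroExp) (.entry 2 (.lit c) zeroExp)))))
    (fill 6 (.entry 7 (.reg 11) zeroExp))

theorem natWrites_stepProg (a : ℕ) (q : Query) (c : ℕ) :
    (stepProg a q c).natWrites = {11, 12, 13} := by
  simp only [stepProg, Prog.natWrites, fill, natWrites_assignEach, natWrites_estimate]
  decide

theorem numWrites_stepProg (a : ℕ) (q : Query) (c : ℕ) :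
    (stepProg a q c).numWrites = {6, 7, 8, 9} := by
  simp only [stepProg, Prog.numWrites, fill, numWrites_assignEach, numWrites_estimate]
  decide

theorem likely_gram_estimate (hC : BoundedColumns w C σ) (hs : GramAccess S w C σ a c q m s)
    (hm0 : 0 < m) {B η : ℝ} (hB : 0 < B) (hη : 0 ≤ η) (hy : ‖s.vec 6 S.R‖ ≤ B) {i : Fin S.R}
    (hi : s.nat 11 = i) :
    Likely S (estimate (.reg 0) q (.mul (.entry a (.reg 12) zeroExp) (.entry 6 (.reg 12) zeroExp)))
      s (4 * ENNReal.ofReal (Real.exp (-(m * η ^ 2 / 16)))) fun s' =>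
        ‖s'.num 8 0 0 / m - ∑ j, w j * s.vec 6 S.R j * (star (C i).state ⬝ᵥ (C j).state)‖ ≤
          2 * (σ * B * η) := by
  refine likely_estimate_div hs.nat_six hm0 hs.nat_zero (fun j s' hs' hj => ⟨?_, ?_⟩)
    (mul_pos hC.pos hB) hη (hC.sum_sq_le hy)
  · have hs'' := hs.of_unchanged (hs'.mono (by decide) (by decide))
    simp only [NumExp.eval, NatExp.eval, hj, hs''.weight, Store.vec_apply,
      hs'.num_eq 6 (by decide)]
  · exact hs.mean s' i j ((hs'.nat_eq 11 (by decide)).trans hi) hj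

theorem norm_step_sub_le (hC : BoundedColumns w C σ) {B η : ℝ} {x : ℂ} {i : Fin S.R}
    {y g : EuclideanSpace ℂ (Fin S.R)}
    (hx : ‖x - ∑ j, w j * y j * (star (C i).state ⬝ᵥ (C j).state)‖ ≤ 2 * (σ * B * η)) :
    ‖y i + (g i - w i * x) / (σ * σ) - (y + (((σ ^ 2)⁻¹ : ℝ) : ℂ) •
      (g - (columnMatrix w C).toEuclideanLin.adjoint ((columnMatrix w C).toEuclideanLin y))) i‖ ≤
      2 * (B * η) := by
  have hσ := hC.pos
  set X : ℂ := ∑ j, w j * y j * (star (C i).state ⬝ᵥ (C j).state)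
  have hsplit : y i + (g i - w i * x) / (σ * σ) - (y + (((σ ^ 2)⁻¹ : ℝ) : ℂ) •
      (g - (columnMatrix w C).toEuclideanLin.adjoint ((columnMatrix w C).toEuclideanLin y))) i =
      -((w i / σ ^ 2 : ℝ) * (x - X)) := by
    simp only [PiLp.add_apply, PiLp.smul_apply, PiLp.sub_apply, smul_eq_mul,
      adjoint_columnMatrix_columnMatrix_apply hC.prepares]
    push_cast
    ring
  rw [hsplit, norm_neg, norm_mul, Complex.norm_real,
    Real.norm_of_nonneg (div_nonneg (hC.nonneg i) (sq_nonneg σ))]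
  calc w i / σ ^ 2 * ‖x - X‖ ≤ σ / σ ^ 2 * (2 * (σ * B * η)) := by
        gcongr
        exact weight_le hC.nonneg hC.prepares hC.norm_le i
    _ = 2 * (B * η) := by field_simp

theorem likely_step (hC : BoundedColumns w C σ) (hs : GramAccess S w C σ a c q m s) (hm0 : 0 < m)
    {B η : ℝ} (hB : 0 < B) (hη : 0 ≤ η) (hy : ‖s.vec 6 S.R‖ ≤ B) :
    Likely S (stepProg a q c) s (S.R * (4 * ENNReal.ofReal (Real.exp (-(m * η ^ 2 / 16)))))
      fun s' => ‖s'.vec 6 S.R - (s.vec 6 S.R + (((σ ^ 2)⁻¹ : ℝ) : ℂ) • (s.vec 5 S.R -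
        (columnMatrix w C).toEuclideanLin.adjoint
          ((columnMatrix w C).toEuclideanLin (s.vec 6 S.R))))‖ ≤ √S.R * (2 * (B * η)) := by
  set target := s.vec 6 S.R + (((σ ^ 2)⁻¹ : ℝ) : ℂ) • (s.vec 5 S.R -
    (columnMatrix w C).toEuclideanLin.adjoint ((columnMatrix w C).toEuclideanLin (s.vec 6 S.R)))
  rw [← add_zero (S.R * _ : ℝ≥0∞)]
  refine (likely_assignEach (Good := fun i z => ‖z - target i‖ ≤ 2 * (B * η)) hs.nat_zero
    (by rw [numWrites_estimate]; decide) (by rw [natWrites_estimate]; decide)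
    fun i s₁ hs₁ hi => ?_).seq fun s₂ hs₂ hgood => ?_
  · rw [natWrites_estimate, numWrites_estimate] at hs₁
    have hy₁ := hs₁.vec_eq (a := 6) (by decide) S.R
    refine (likely_gram_estimate hC (hs.of_unchanged (hs₁.mono (by decide) (by decide))) hm0 hB hη
      (by rwa [hy₁]) hi).mono le_rfl fun s₂ hs₂ hx => ?_
    have hest := FactorizedSystem.unchanged_of_mem_support (natWrites_estimate ..).le
      (numWrites_estimate ..).le hs₂
    have hu : Unchanged {11, 12, 13} {7, 8, 9} s s₂ :=
      hs₁.trans (hest.mono (by decide) (by decide))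
    have hs₂' := hs.of_unchanged (hu.mono (by decide) (by decide))
    rw [hy₁] at hx
    have hstep := norm_step_sub_le (g := s.vec 5 S.R) hC hx
    simp only [NumExp.eval, NatExp.eval, (hest.nat_eq 11 (by decide)).trans hi, hs₂'.weight,
      hs₂'.norm, hs₂'.nat_six, hu.num_eq 6 (by decide), hu.num_eq 5 (by decide)]
    exact hstep
  · have hu := FactorizedSystem.unchanged_of_mem_support subset_rfl subset_rfl hs₂
    rw [natWrites_assignEach, natWrites_estimate] at hu
    refine (likely_fill (x := s₂.vec 7 S.R) ((hu.nat_eq 0 (by decide)).trans hs.nat_zero)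
      fun i s₃ hs₃ hi => ?_).mono le_rfl fun s₃ _ hs₃ => ?_
    · simp only [NumExp.eval, NatExp.eval, hi, hs₃.num_eq 7 (by decide), Store.vec_apply]
    · rw [hs₃]
      simpa only [Fintype.card_fin] using
        norm_le_sqrt_card_mul (x := s₂.vec 7 S.R - target) (by positivity) hgood

/-- The Richardson iteration, with the number of steps in register 5. -/
def solveProg (a : ℕ) (q : Query) (c : ℕ) : Prog := .loop 10 (.reg 5) (stepProg a q c)

theorem natWrites_solveProg (a : ℕ) (q : Query) (c : ℕ) :
    (solveProg a q c).natWrites = {10, 11, 12, 13} := by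
  rw [solveProg, Prog.natWrites, natWrites_stepProg]

theorem numWrites_solveProg (a : ℕ) (q : Query) (c : ℕ) :
    (solveProg a q c).numWrites = {6, 7, 8, 9} := by
  rw [solveProg, Prog.numWrites, numWrites_stepProg]

theorem likely_solve (hC : BoundedColumns w C σ) (hs : GramAccess S w C σ a c q m s)
    (hm0 : 0 < m) {Y η : ℝ} {T : ℕ} (hY : 0 < Y) (hη : 0 ≤ η) (hT : s.nat 5 = T)
    (h0 : s.vec 6 S.R = 0) {z : EuclideanSpace ℂ (Fin S.R)} (hz : ‖z‖ ≤ Y)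
    (hg : ‖(((σ ^ 2)⁻¹ : ℝ) : ℂ) • (s.vec 5 S.R - (columnMatrix w C).toEuclideanLin.adjoint
      ((columnMatrix w C).toEuclideanLin z))‖ ≤ √S.R * (6 * Y * η))
    (hTY : T * (2 * (√S.R * (6 * Y * η))) ≤ Y) :
    Likely S (solveProg a q c) s
      (T * (S.R * (4 * ENNReal.ofReal (Real.exp (-(m * η ^ 2 / 16)))))) fun s' =>
        ‖s'.vec 6 S.R - z - (richardson (columnMatrix w C).toEuclideanLin σ ^ T) (-z)‖ ≤
          T * (2 * (√S.R * (6 * Y * η))) := by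
  set δ := √S.R * (6 * Y * η) with hδ
  have hδ0 : 0 ≤ δ := by positivity
  rw [← hT]
  refine Likely.loop (e := .reg 5) (A := fun t s' =>
    ‖s'.vec 6 S.R - z - (richardson (columnMatrix w C).toEuclideanLin σ ^ t) (-z)‖ ≤ t * (2 * δ))
    (by simp [h0])
    fun t ht s₁ hs₁ hy => ?_
  rw [natWrites_stepProg, numWrites_stepProg] at hs₁
  have hu : Unchanged {10, 11, 12, 13} {6, 7, 8, 9} s (s₁.setNat 10 t) :=
    hs₁.setNat (by decide) t
  have htT : (t : ℝ) ≤ T := Nat.cast_le.2 (hT ▸ ht.le)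
  have hbound : ‖s₁.vec 6 S.R‖ ≤ 3 * Y := norm_le_of_norm_sub_sub_richardson_le hC.pos hC.norm_le
    hy hz ((mul_le_mul_of_nonneg_right htT (mul_nonneg zero_le_two hδ0)).trans hTY)
  refine (likely_step hC (hs.of_unchanged (hu.mono subset_rfl (by decide))) hm0
    (B := 3 * Y) (by positivity) hη hbound).mono le_rfl fun s₂ _ hs₂ =>
    norm_richardson_step_le hC.pos hC.norm_le hy ?_
  rw [hu.vec_eq (a := 5) (by decide), show 2 * (3 * Y * η) = 6 * Y * η by ring, ← hδ] at hs₂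
  rw [two_mul]
  refine le_trans (le_of_eq_of_le (congrArg _ ?_) (norm_add_le _ _)) (add_le_add hs₂ hg)
  simp only [smul_sub, Store.vec, Store.num_setNat, RCLike.ofReal_eq_complex_ofReal]
  abel

theorem likely_solve_accurate (hC : BoundedColumns w C σ) (hs : GramAccess S w C σ a c q m s)
    (hm0 : 0 < m) {Y X η ρ : ℝ} {T L : ℕ} (hY : 0 < Y) (hη : 0 ≤ η) (hT : s.nat 5 = T)
    (h0 : s.vec 6 S.R = 0) (hρ0 : 0 < ρ) (hρσ : ρ ≤ σ)
    (hρ : ∀ y ∈ (columnMatrix w C).toEuclideanLin.kerᗮ,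
      ρ * ‖y‖ ≤ ‖(columnMatrix w C).toEuclideanLin y‖)
    {z : EuclideanSpace ℂ (Fin S.R)} (hz : ‖z‖ ≤ Y)
    (hz' : z ∈ (columnMatrix w C).toEuclideanLin.kerᗮ)
    (hg : ‖(((σ ^ 2)⁻¹ : ℝ) : ℂ) • (s.vec 5 S.R - (columnMatrix w C).toEuclideanLin.adjoint
      ((columnMatrix w C).toEuclideanLin z))‖ ≤ √S.R * (6 * Y * η))
    (hX : 1 ≤ X) (hXL : X ≤ 2 ^ L) (hTL : 2 * (σ / ρ) ^ 2 * L ≤ T)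
    (hTη : 12 * T * √S.R * η * X ≤ 1) :
    Likely S (solveProg a q c) s
      (T * (S.R * (4 * ENNReal.ofReal (Real.exp (-(m * η ^ 2 / 16)))))) fun s' =>
        ‖s'.vec 6 S.R - z‖ ≤ 2 * Y / X := by
  have hX0 : 0 < X := one_pos.trans_le hX
  have hacc : T * (2 * (√S.R * (6 * Y * η))) ≤ Y / X := by
    rw [le_div_iff₀ hX0]
    calc T * (2 * (√S.R * (6 * Y * η))) * X = 12 * T * √S.R * η * X * Y := by ring
      _ ≤ Y := mul_le_of_le_one_left hY.le hTη
  refine (likely_solve hC hs hm0 hY hη hT h0 hz hg (hacc.trans (div_le_self hY.le hX))).mono le_rfl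
    fun s' _ hs' => ?_
  set r := (richardson (columnMatrix w C).toEuclideanLin σ ^ T) (-z) with hr
  have hdecay : ‖r‖ ≤ Y / X := by
    rw [hr]
    refine (norm_richardson_pow_le hC.pos hC.norm_le hρ0 hρσ hρ (neg_mem hz') hTL).trans ?_
    rw [norm_neg, div_eq_inv_mul]
    gcongr
  calc ‖s'.vec 6 S.R - z‖ = ‖(s'.vec 6 S.R - z - r) + r‖ := by rw [sub_add_cancel]
    _ ≤ Y / X + Y / X := (norm_add_le _ _).trans (add_le_add (hs'.trans hacc) hdecay)
    _ = 2 * Y / X := by ring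

end Solve

/-! ### The parameters of the algorithm -/

variable {ε : ℝ} {k : ℕ}

namespace FactorizedSystem

variable (S)

/-- The factor by which the iteration has to reduce the error. -/
def reduction (ε : ℝ) : ℝ :=
  1 + 8 * condNumber S.A₁ * (condNumber S.A₂ * condNumber S.A₂) * S.normB / ε

/-- The binary logarithm of `R` times the reduction factor, rounded up. -/
def logReduction (ε : ℝ) : ℕ := Nat.clog 2 ⌈S.R * S.reduction ε⌉₊

/-- The number of steps of the iteration. -/
def steps (ε : ℝ) : ℕ :=
  ⌈2 * (condNumber S.A₁ * condNumber S.A₁ + condNumber S.A₂ * condNumber S.A₂) *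
    S.logReduction ε⌉₊

/-- The number of samples for each inner product. -/
def samples (ε : ℝ) (k : ℕ) : ℕ :=
  ⌈2304 * S.R * ((S.steps ε * S.steps ε) * (S.reduction ε * S.reduction ε)) *
    ((k + S.steps ε + S.logReduction ε + 3 : ℕ) : ℝ)⌉₊

/-- The relative accuracy to which each component of a matrix-vector product is estimated: the
errors of all steps then accumulate to less than the reciprocal of the reduction factor. -/
def precision (ε : ℝ) : ℝ := 1 / (12 * S.steps ε * √S.R * S.reduction ε)

/-- The bound for the probability that one estimate is less accurate than required. -/
def estimateFailure (ε : ℝ) (k : ℕ) : ℝ≥0∞ :=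
  4 * ENNReal.ofReal (Real.exp (-(S.samples ε k * S.precision ε ^ 2 / 16)))

variable {S}

theorem mul_reduction_le_two_pow_iff (i : ℕ) :
    S.R * S.reduction ε ≤ (2 : ℝ) ^ i ↔ S.logReduction ε ≤ i := by
  rw [logReduction, Nat.clog_le_iff_le_pow one_lt_two, Nat.ceil_le]
  norm_cast

theorem one_le_condNumber {N M : ℕ} {A : Matrix (Fin N) (Fin M) ℂ} (h : 0 < specNorm A) :
    1 ≤ condNumber A := by
  rw [condNumber, one_le_div (minSingularValue_pos h)]
  exact minSingularValue_le_specNorm A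

section Parameters

variable (h₁ : 0 < specNorm S.A₁) (h₂ : 0 < specNorm S.A₂) (hR : 0 < S.R) (hε : 0 < ε)

include h₁ h₂ hε in
theorem one_lt_reduction : 1 < S.reduction ε := by
  have hκ₁ := one_pos.trans_le (one_le_condNumber h₁)
  have hκ₂ := one_pos.trans_le (one_le_condNumber h₂)
  have hB := S.normB_pos
  rw [reduction, lt_add_iff_pos_right]
  positivity

include h₁ h₂ hR hε

theorem reduction_le_two_pow : S.reduction ε ≤ 2 ^ S.logReduction ε :=
  (le_mul_of_one_le_left (one_pos.trans (one_lt_reduction h₁ h₂ hε)).le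
    (Nat.one_le_cast.2 hR)).trans ((mul_reduction_le_two_pow_iff _).2 le_rfl)

omit hR in
theorem R_le_two_pow : (S.R : ℝ) ≤ 2 ^ S.logReduction ε :=
  (le_mul_of_one_le_right (Nat.cast_nonneg _) (one_lt_reduction h₁ h₂ hε).le).trans
    ((mul_reduction_le_two_pow_iff _).2 le_rfl)

theorem logReduction_pos : 0 < S.logReduction ε := by
  refine Nat.pos_of_ne_zero fun h => ?_
  have h2 := reduction_le_two_pow h₁ h₂ hR hε
  rw [h, pow_zero] at h2
  exact h2.not_gt (one_lt_reduction h₁ h₂ hε)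

theorem steps_pos : 0 < S.steps ε := by
  have hκ₁ := one_pos.trans_le (one_le_condNumber h₁)
  have hκ₂ := one_pos.trans_le (one_le_condNumber h₂)
  have hL : (0 : ℝ) < S.logReduction ε := Nat.cast_pos.2 (logReduction_pos h₁ h₂ hR hε)
  exact Nat.ceil_pos.2 (by positivity)

theorem samples_pos : 0 < S.samples ε k := by
  have hX := one_pos.trans (one_lt_reduction h₁ h₂ hε)
  have hT : (0 : ℝ) < S.steps ε := Nat.cast_pos.2 (steps_pos h₁ h₂ hR hε)
  exact Nat.ceil_pos.2 (by positivity)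

theorem precision_mul_eq_one : 12 * S.steps ε * √S.R * S.precision ε * S.reduction ε = 1 := by
  have hX := one_pos.trans (one_lt_reduction h₁ h₂ hε)
  have hT : (0 : ℝ) < S.steps ε := Nat.cast_pos.2 (steps_pos h₁ h₂ hR hε)
  rw [precision]
  field_simp

omit hR in
theorem precision_nonneg : 0 ≤ S.precision ε := by
  have hX := one_pos.trans (one_lt_reduction h₁ h₂ hε)
  rw [precision]
  positivity

theorem le_samples_mul_sq_precision :
    (k + S.steps ε + S.logReduction ε + 3 : ℝ) ≤ S.samples ε k * S.precision ε ^ 2 / 16 := by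
  have hX := one_pos.trans (one_lt_reduction h₁ h₂ hε)
  have hT : (0 : ℝ) < S.steps ε := Nat.cast_pos.2 (steps_pos h₁ h₂ hR hε)
  have hη : S.precision ε ^ 2 / 16 =
      1 / (2304 * S.R * ((S.steps ε * S.steps ε) * (S.reduction ε * S.reduction ε))) := by
    rw [precision, div_pow, mul_pow, mul_pow, mul_pow, Real.sq_sqrt (Nat.cast_nonneg _)]
    field_simp
    norm_num
  rw [mul_div_assoc, hη, mul_one_div, le_div_iff₀ (by positivity), mul_comm]
  refine le_of_eq_of_le ?_ (Nat.le_ceil _)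
  push_cast
  rfl

end Parameters

theorem sq_condNumber_A₁_mul_le_steps :
    2 * condNumber S.A₁ ^ 2 * S.logReduction ε ≤ S.steps ε := by
  refine le_trans ?_ (Nat.le_ceil _)
  gcongr
  nlinarith [sq_nonneg (condNumber S.A₂)]

theorem sq_condNumber_A₂_mul_le_steps :
    2 * condNumber S.A₂ ^ 2 * S.logReduction ε ≤ S.steps ε := by
  refine le_trans ?_ (Nat.le_ceil _)
  gcongr
  nlinarith [sq_nonneg (condNumber S.A₁)]

theorem two_pow_mul_exp_le {R k T L : ℕ} (hR : (R : ℝ) ≤ 2 ^ L) :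
    4 * R * (1 + 2 * T) * Real.exp (-(k + T + L + 3)) ≤ (1 / 2 : ℝ) ^ k := by
  have hpow (n : ℕ) : (2 : ℝ) ^ n ≤ Real.exp n := by
    rw [← mul_one (n : ℝ), Real.exp_nat_mul]
    gcongr
    linarith [Real.add_one_le_exp (1 : ℝ)]
  have hexp : Real.exp (-(k + T + L + 3)) =
      (Real.exp k)⁻¹ * (Real.exp T)⁻¹ * (Real.exp L)⁻¹ * (Real.exp (3 : ℕ))⁻¹ := by
    simp only [← Real.exp_neg, ← Real.exp_add]
    congr 1
    push_cast
    ring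
  calc 4 * R * (1 + 2 * T) * Real.exp (-(k + T + L + 3))
      ≤ 4 * 2 ^ L * (2 * Real.exp T) * Real.exp (-(k + T + L + 3)) := by
        gcongr
        linarith [Real.add_one_le_exp (T : ℝ)]
    _ = (2 ^ L * (Real.exp L)⁻¹) * (2 ^ 3 * (Real.exp (3 : ℕ))⁻¹) * (Real.exp k)⁻¹ := by
        rw [hexp]
        field_simp
        norm_num
    _ ≤ 1 * 1 * (2 ^ k)⁻¹ := by
        have hone (n : ℕ) : (2 : ℝ) ^ n * (Real.exp n)⁻¹ ≤ 1 :=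
          mul_inv_le_one_of_le₀ (hpow n) (Real.exp_nonneg _)
        gcongr
        · exact hone L
        · exact hone 3
        · exact hpow k
    _ = (1 / 2) ^ k := by rw [one_mul, one_mul, one_div, inv_pow]

theorem total_failure_le (h₁ : 0 < specNorm S.A₁) (h₂ : 0 < specNorm S.A₂) (hR : 0 < S.R)
    (hε : 0 < ε) :
    S.R * S.estimateFailure ε k + (S.steps ε * (S.R * S.estimateFailure ε k) +
      S.steps ε * (S.R * S.estimateFailure ε k)) ≤ ENNReal.ofReal ((1 / 2 : ℝ) ^ k) := by
  set p := Real.exp (-(S.samples ε k * S.precision ε ^ 2 / 16)) with hp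
  have hsum : S.R * S.estimateFailure ε k + (S.steps ε * (S.R * S.estimateFailure ε k) +
      S.steps ε * (S.R * S.estimateFailure ε k)) =
      ENNReal.ofReal (4 * S.R * (1 + 2 * S.steps ε) * p) := by
    rw [estimateFailure, ← hp, ENNReal.ofReal_mul (by positivity),
      ENNReal.ofReal_mul (by positivity), ENNReal.ofReal_mul (by positivity),
      ENNReal.ofReal_add zero_le_one (by positivity), ENNReal.ofReal_mul zero_le_two]
    simp only [ENNReal.ofReal_ofNat, ENNReal.ofReal_natCast, ENNReal.ofReal_one]
    ring
  rw [hsum]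
  refine ENNReal.ofReal_le_ofReal (le_trans ?_ (two_pow_mul_exp_le (T := S.steps ε)
    (R_le_two_pow h₁ h₂ hε)))
  gcongr
  exact Real.exp_le_exp.2 (neg_le_neg (le_samples_mul_sq_precision h₁ h₂ hR hε))

end FactorizedSystem

/-! ### Computation of the parameters -/

variable {s' : Store}

/-- The entry of array 2 with a given index. -/
abbrev inputExp (i : ℕ) : NumExp := .entry 2 (.lit i) zeroExp

/-- The expression for the condition number of `A₁`. -/
def cond₁Exp : NumExp := .div (inputExp 2) (inputExp 3)

/-- The expression for the condition number of `A₂`. -/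
def cond₂Exp : NumExp := .div (inputExp 4) (inputExp 5)

/-- The expression for the reduction factor. -/
def reductionExp : NumExp :=
  .add (.lit 1)
    (.div (.mul (.mul (.mul (.lit 8) cond₁Exp) (.mul cond₂Exp cond₂Exp)) (inputExp 0)) (inputExp 1))

/-- The expression for `R` times the reduction factor. -/
def sizeExp : NumExp := .mul (.ofNat (.reg 0)) reductionExp

/-- The expression that is rounded up to the number of steps, with the logarithm of the reduction
factor in register 4. -/
def stepsExp : NumExp :=
  .mul (.mul (.lit 2) (.add (.mul cond₁Exp cond₁Exp) (.mul cond₂Exp cond₂Exp))) (.ofNat (.reg 4))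

/-- The expression that is rounded up to the number of samples, with the number of steps in
register 5. -/
def samplesExp : NumExp :=
  .mul
    (.mul (.mul (.lit 2304) (.ofNat (.reg 0)))
      (.mul (.mul (.ofNat (.reg 5)) (.ofNat (.reg 5))) (.mul reductionExp reductionExp)))
    (.ofNat (.add (.add (.add (.reg 3) (.reg 5)) (.reg 4)) (.lit 3)))

/-- The program that computes the binary logarithm of register 7, rounded up, in register 4, with
the corresponding power of two in register 8. -/
def clogProg : Prog :=
  .seq (.setNat 8 (.lit 1))
    (.loop 10 (.reg 7)
      (.ite (.natLE (.reg 7) (.reg 8)) .skip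
        (.seq (.setNat 8 (.add (.reg 8) (.reg 8))) (.setNat 4 (.add (.reg 4) (.lit 1))))))

/-- The program that computes the logarithm of the reduction factor in register 4. -/
def logProg : Prog := .seq (.ceil 7 sizeExp) clogProg

/-- The program that computes the number of steps in register 5 and the number of samples in
register 6. -/
def paramProg : Prog := .seq logProg (.seq (.ceil 5 stepsExp) (.ceil 6 samplesExp))

section Eval

variable (h : s.num 2 = (S.input ε k).num 2)
include h

theorem eval_inputExp (i : ℕ) : (inputExp i).eval s =
    (([S.normB, ε, specNorm S.A₁, minSingularValue S.A₁, specNorm S.A₂,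
      minSingularValue S.A₂].getD i 0 : ℝ) : ℂ) := by
  simp only [NumExp.eval, NatExp.eval, h, FactorizedSystem.input, if_true]

theorem eval_cond₁Exp : cond₁Exp.eval s = condNumber S.A₁ := by
  rw [cond₁Exp, NumExp.eval, eval_inputExp h, eval_inputExp h, ← Complex.ofReal_div]
  rfl

theorem eval_cond₂Exp : cond₂Exp.eval s = condNumber S.A₂ := by
  rw [cond₂Exp, NumExp.eval, eval_inputExp h, eval_inputExp h, ← Complex.ofReal_div]
  rfl

theorem eval_reductionExp : reductionExp.eval s = S.reduction ε := by
  simp only [reductionExp, NumExp.eval, eval_cond₁Exp h, eval_cond₂Exp h,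
    show s.num 2 _ _ = _ from eval_inputExp h 0, show s.num 2 _ _ = _ from eval_inputExp h 1,
    FactorizedSystem.reduction]
  simp

theorem ceil_eval_sizeExp (h0 : s.nat 0 = S.R) :
    ⌈(sizeExp.eval s).re⌉₊ = ⌈S.R * S.reduction ε⌉₊ := by
  rw [sizeExp, NumExp.eval, NumExp.eval, NatExp.eval, h0, eval_reductionExp h,
    ← Complex.ofReal_natCast, ← Complex.ofReal_mul, Complex.ofReal_re]

theorem ceil_eval_stepsExp (h4 : s.nat 4 = S.logReduction ε) :
    ⌈(stepsExp.eval s).re⌉₊ = S.steps ε := by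
  have heval : stepsExp.eval s = ((2 * (condNumber S.A₁ * condNumber S.A₁ +
      condNumber S.A₂ * condNumber S.A₂) * S.logReduction ε : ℝ) : ℂ) := by
    simp only [stepsExp, NumExp.eval, NatExp.eval, eval_cond₁Exp h, eval_cond₂Exp h, h4]
    push_cast
    rfl
  rw [heval, Complex.ofReal_re, FactorizedSystem.steps]

theorem ceil_eval_samplesExp (h0 : s.nat 0 = S.R) (h3 : s.nat 3 = k)
    (h4 : s.nat 4 = S.logReduction ε) (h5 : s.nat 5 = S.steps ε) :
    ⌈(samplesExp.eval s).re⌉₊ = S.samples ε k := by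
  have heval : samplesExp.eval s = ((2304 * S.R * ((S.steps ε * S.steps ε) *
      (S.reduction ε * S.reduction ε)) * ((k + S.steps ε + S.logReduction ε + 3 : ℕ) : ℝ) : ℝ) :
        ℂ) := by
    simp only [samplesExp, NumExp.eval, NatExp.eval, eval_reductionExp h, h0, h3, h4, h5]
    push_cast
    rfl
  rw [heval, Complex.ofReal_re, FactorizedSystem.samples]

end Eval

theorem natWrites_clogProg : clogProg.natWrites = {4, 8, 10} := by decide

theorem likely_clogProg (h4 : s.nat 4 = 0) :
    Likely S clogProg s 0 fun s' => s'.nat 4 = Nat.clog 2 (s.nat 7) := by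
  rw [clogProg, ← add_zero (0 : ℝ≥0∞)]
  refine Likely.seq (A := fun s' => s' = s.setNat 8 1) ?_ fun s₁ _ hs₁ => ?_
  · simp only [likely_zero_iff, FactorizedSystem.final_setNat, PMF.mem_support_pure_iff, forall_eq,
      NatExp.eval]
  set n := s.nat 7
  have hn : (NatExp.reg 7).eval s₁ = n := by rw [hs₁]; rfl
  refine (Likely.loop (p := 0) (A := fun i s' => s'.nat 4 = min i (Nat.clog 2 n) ∧
    s'.nat 8 = 2 ^ s'.nat 4) ?_ fun i _ s₂ hs₂ hA => ?_).mono (mul_zero _).le fun s' _ hs' => ?_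
  · simp [hs₁, h4]
  · have h7 : s₂.nat 7 = n := (hs₂.nat_eq 7 (by decide)).trans hn
    have hcond : Cond.Holds (s₂.setNat 10 i) (.natLE (.reg 7) (.reg 8)) ↔ Nat.clog 2 n ≤ i := by
      simp only [Cond.Holds, NatExp.eval, Store.nat_setNat, Nat.reduceEqDiff, if_false, h7, hA.2,
        ← Nat.clog_le_iff_le_pow one_lt_two, hA.1]
      omega
    rw [likely_zero_iff]
    rcases le_or_gt (Nat.clog 2 n) i with hi | hi
    · rw [FactorizedSystem.final_ite_of_holds (hcond.2 hi)]
      simp only [FactorizedSystem.final_skip, PMF.mem_support_pure_iff, forall_eq, Store.nat_setNat,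
        Nat.reduceEqDiff, if_false]
      exact ⟨by omega, hA.2⟩
    · rw [FactorizedSystem.final_ite_of_not_holds (mt hcond.1 hi.not_ge)]
      simp only [FactorizedSystem.final_seq, FactorizedSystem.final_setNat, PMF.pure_bind,
        PMF.mem_support_pure_iff, forall_eq, Store.nat_setNat, NatExp.eval, Nat.reduceEqDiff,
        if_true, if_false, hA.2, pow_succ, mul_two, and_true]
      omega
  · have hclog : Nat.clog 2 n ≤ n :=
      (Nat.clog_le_iff_le_pow one_lt_two).2 Nat.lt_two_pow_self.le
    rw [hs'.1, hn, min_eq_right hclog]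

theorem likely_logProg : Likely S logProg (S.input ε k) 0 fun s' =>
    Unchanged {4, 7, 8, 10} ∅ (S.input ε k) s' ∧ s'.nat 4 = S.logReduction ε := by
  rw [logProg, ← add_zero (0 : ℝ≥0∞)]
  refine Likely.seq (A := fun s' => s' = (S.input ε k).setNat 7 ⌈S.R * S.reduction ε⌉₊) ?_
    fun s₁ _ hs₁ => (likely_clogProg (by rw [hs₁]; rfl)).mono le_rfl fun s₂ hs₂ h4 => ⟨?_, ?_⟩
  · rw [← ceil_eval_sizeExp (s := S.input ε k) rfl rfl]
    simp only [likely_zero_iff, FactorizedSystem.final_ceil, PMF.mem_support_pure_iff, forall_eq]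
  · have hu := FactorizedSystem.unchanged_of_mem_support natWrites_clogProg.le le_rfl hs₂
    rw [hs₁] at hu
    exact ((Unchanged.refl _ _ _).setNat (by decide) _).trans (hu.mono (by decide) (by decide))
  · rw [h4, hs₁, Store.nat_setNat, if_pos rfl, FactorizedSystem.logReduction]

/-- The memory holds the input and the numbers of steps and of samples. -/
structure Ready (S : FactorizedSystem) (ε : ℝ) (k : ℕ) (s : Store) : Prop where
  unchanged : Unchanged {4, 5, 6, 7, 8, 10, 11, 12, 13} {5, 6, 7, 8, 9} (S.input ε k) s
  steps : s.nat 5 = S.steps ε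
  samples : s.nat 6 = S.samples ε k

namespace Ready

theorem of_unchanged (h : Ready S ε k s)
    (h' : Unchanged {10, 11, 12, 13} {5, 6, 7, 8, 9} s s') : Ready S ε k s' where
  unchanged := h.unchanged.trans (h'.mono (by decide) subset_rfl)
  steps := (h'.nat_eq 5 (by decide)).trans h.steps
  samples := (h'.nat_eq 6 (by decide)).trans h.samples

theorem rank (h : Ready S ε k s) : s.nat 0 = S.R := h.unchanged.nat_eq 0 (by decide)

theorem normB (h : Ready S ε k s) : s.num 2 0 0 = S.normB :=
  eval_inputExp (h.unchanged.num_eq 2 (by decide)) 0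

theorem normU (h : Ready S ε k s) (i : Fin S.R) : s.num 0 i 0 = S.normU i := by
  simp only [h.unchanged.num_eq 0 (by decide), FactorizedSystem.input, if_true, i.2, dif_pos]

theorem normV (h : Ready S ε k s) (i : Fin S.R) : s.num 1 i 0 = S.normV i := by
  simp only [h.unchanged.num_eq 1 (by decide), FactorizedSystem.input, if_true, i.2, dif_pos]

end Ready

theorem likely_paramProg : Likely S paramProg (S.input ε k) 0 fun s' =>
    Ready S ε k s' ∧ s'.vec 6 S.R = 0 := by
  rw [paramProg, ← add_zero (0 : ℝ≥0∞)]
  refine Likely.seq likely_logProg fun s₁ _ hs₁ => ?_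
  obtain ⟨hu, h4⟩ := hs₁
  have hnum : s₁.num 2 = (S.input ε k).num 2 := hu.num_eq 2 (by decide)
  have hsamples : ⌈(samplesExp.eval (s₁.setNat 5 (S.steps ε))).re⌉₊ = S.samples ε k :=
    ceil_eval_samplesExp hnum (hu.nat_eq 0 (by decide)) (hu.nat_eq 3 (by decide)) h4 rfl
  simp only [likely_zero_iff, FactorizedSystem.final_seq, FactorizedSystem.final_ceil,
    PMF.pure_bind, PMF.mem_support_pure_iff, forall_eq, ceil_eval_stepsExp hnum h4, hsamples]
  refine ⟨⟨?_, rfl, rfl⟩, ?_⟩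
  · exact ((hu.mono (by decide) (by decide)).setNat (by decide) _).setNat (by decide) _
  · ext i
    simp only [Store.vec_apply, Store.num_setNat, hu.num_eq 6 (by decide), FactorizedSystem.input,
      if_true]
    rfl

/-! ### The two systems of normal equations -/

theorem lookup_of_lt {R n : ℕ} (c : Fin R → Circuit n) (i : Fin R) :
    FactorizedSystem.lookup c i = c i := dif_pos i.2

/-- The inner product `⟨u_i|u_j⟩`, with `i` and `j` in registers 11 and 12. -/
def gramQueryU : Query := .uu (.reg 11) (.reg 12)

/-- The inner product `⟨v_i|v_j⟩`, with `i` and `j` in registers 11 and 12. -/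
def gramQueryV : Query := .vv (.reg 11) (.reg 12)

theorem mean_gramQueryU {i j : Fin S.R} (hi : s.nat 11 = i) (hj : s.nat 12 = j) :
    gramQueryU.mean S s = star (S.circU i).state ⬝ᵥ (S.circU j).state := by
  simp only [gramQueryU, Query.mean, NatExp.eval, hi, hj, lookup_of_lt]

theorem mean_gramQueryV {i j : Fin S.R} (hi : s.nat 11 = i) (hj : s.nat 12 = j) :
    gramQueryV.mean S s = star (S.circV i).state ⬝ᵥ (S.circV j).state := by
  simp only [gramQueryV, Query.mean, NatExp.eval, hi, hj, lookup_of_lt]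

namespace Ready

theorem gramAccessU (h : Ready S ε k s) :
    GramAccess S S.normU S.circU (specNorm S.A₁) 0 2 gramQueryU (S.samples ε k) s where
  array_le := by norm_num
  nat_zero := h.rank
  nat_six := h.samples
  weight := h.normU
  norm := eval_inputExp (h.unchanged.num_eq 2 (by decide)) 2
  mean _ _ _ hi hj := mean_gramQueryU hi hj

theorem gramAccessV (h : Ready S ε k s) :
    GramAccess S S.normV S.circV (specNorm S.A₂) 1 4 gramQueryV (S.samples ε k) s where
  array_le := by norm_num
  nat_zero := h.rank
  nat_six := h.samples
  weight := h.normV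
  norm := eval_inputExp (h.unchanged.num_eq 2 (by decide)) 4
  mean _ _ _ hi hj := mean_gramQueryV hi hj

end Ready

theorem toEuclideanLin_columnMatrix_normV :
    (columnMatrix S.normV S.circV).toEuclideanLin = S.A₂.toEuclideanLin.adjoint := by
  have hconj : S.A₂ᴴ = columnMatrix S.normV S.circV := by
    ext i j
    simp [FactorizedSystem.A₂, columnMatrix, Matrix.conjTranspose_apply]
  rw [← hconj, Matrix.toEuclideanLin_conjTranspose_eq_adjoint]

theorem adjoint_columnMatrix_normV :
    (columnMatrix S.normV S.circV).toEuclideanLin.adjoint = S.A₂.toEuclideanLin := by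
  rw [toEuclideanLin_columnMatrix_normV, LinearMap.adjoint_adjoint]

theorem boundedColumns_normU (h₁ : 0 < specNorm S.A₁) :
    BoundedColumns S.normU S.circU (specNorm S.A₁) :=
  ⟨S.normU_nonneg, S.preparesU, h₁, norm_toEuclideanLin_le S.A₁⟩

theorem boundedColumns_normV (h₂ : 0 < specNorm S.A₂) :
    BoundedColumns S.normV S.circV (specNorm S.A₂) := by
  refine ⟨S.normV_nonneg, S.preparesV, h₂, ?_⟩
  rw [toEuclideanLin_columnMatrix_normV]
  exact norm_adjoint_apply_le (specNorm_nonneg _) (norm_toEuclideanLin_le _)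

theorem surjective_toEuclideanLin_A₂ (hrank : S.A₂.rank = S.R) :
    Function.Surjective S.A₂.toEuclideanLin := by
  rw [← LinearMap.range_eq_top]
  refine Submodule.eq_top_of_finrank_eq ?_
  rw [← rank_eq_finrank_range_toEuclideanLin, hrank, finrank_euclideanSpace_fin]

theorem mul_norm_le_norm_columnMatrix_normV (hrank : S.A₂.rank = S.R)
    (y : EuclideanSpace ℂ (Fin S.R)) :
    minSingularValue S.A₂ * ‖y‖ ≤ ‖(columnMatrix S.normV S.circV).toEuclideanLin y‖ := by
  rw [toEuclideanLin_columnMatrix_normV]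
  exact mul_norm_le_norm_adjoint_of_surjective (minSingularValue_nonneg _)
    (surjective_toEuclideanLin_A₂ hrank) (fun _ => minSingularValue_mul_norm_le _) y

theorem ker_columnMatrix_normV_eq_bot (hrank : S.A₂.rank = S.R) :
    (columnMatrix S.normV S.circV).toEuclideanLin.ker = ⊥ := by
  rw [toEuclideanLin_columnMatrix_normV, ← LinearMap.orthogonal_range,
    LinearMap.range_eq_top.2 (surjective_toEuclideanLin_A₂ hrank), Submodule.top_orthogonal_eq_bot]

theorem specNorm_A₂_pos (hR : 0 < S.R) (hrank : S.A₂.rank = S.R) : 0 < specNorm S.A₂ := by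
  refine (specNorm_nonneg _).lt_of_ne fun h => hR.ne ?_
  rw [← hrank, eq_zero_of_specNorm_eq_zero h.symm, Matrix.rank_zero]

theorem norm_toLp_b : ‖WithLp.toLp 2 S.b‖ = S.normB := by
  have hb : WithLp.toLp 2 S.b = (S.normB : ℂ) • WithLp.toLp 2 (ketOf S.N S.circB) := rfl
  rw [hb, norm_smul, norm_toLp_ketOf S.preparesB, mul_one, Complex.norm_real,
    Real.norm_of_nonneg S.normB_pos.le]

theorem adjoint_A₁_b_apply (i : Fin S.R) :
    S.A₁.toEuclideanLin.adjoint (WithLp.toLp 2 S.b) i =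
      S.normU i * (S.normB * (star (S.circU i).state ⬝ᵥ S.circB.state)) := by
  have hb : S.b = (S.normB : ℂ) • ketOf S.N S.circB := rfl
  refine (adjoint_columnMatrix_apply (w := S.normU) (C := S.circU) _ i).trans ?_
  rw [hb, dotProduct_smul, smul_eq_mul, dotProduct_ketOf _ S.preparesB]

/-! ### The residual -/

theorem residual_eq (x : Fin S.M → ℂ) : S.residual x =
    ‖S.A₁.toEuclideanLin (S.A₂.toEuclideanLin (WithLp.toLp 2 x)) - WithLp.toLp 2 S.b‖ := by
  rw [FactorizedSystem.residual, FactorizedSystem.A, ← Matrix.mulVec_mulVec]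
  rfl

theorem toLp_combine {c : Fin S.R → ℂ} {t : EuclideanSpace ℂ (Fin S.R)}
    (hc : ∀ i, c i = S.normV i * t i) :
    WithLp.toLp 2 (S.combine c) = (columnMatrix S.normV S.circV).toEuclideanLin t := by
  ext i
  simp only [FactorizedSystem.combine, Matrix.toLpLin_apply, columnMatrix, Matrix.mulVec,
    dotProduct, Matrix.of_apply, Finset.sum_apply, Pi.smul_apply, smul_eq_mul, hc]
  exact Finset.sum_congr rfl fun j _ => by ring

theorem residual_sub_iInf_le {y : EuclideanSpace ℂ (Fin S.R)}
    (hy : ∀ y', ‖S.A₁.toEuclideanLin y - WithLp.toLp 2 S.b‖ ≤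
      ‖S.A₁.toEuclideanLin y' - WithLp.toLp 2 S.b‖) (x : Fin S.M → ℂ) :
    S.residual x - ⨅ x, S.residual x ≤
      specNorm S.A₁ * ‖S.A₂.toEuclideanLin (WithLp.toLp 2 x) - y‖ := by
  set z := S.A₂.toEuclideanLin (WithLp.toLp 2 x)
  have hmin : ‖S.A₁.toEuclideanLin y - WithLp.toLp 2 S.b‖ ≤ ⨅ x, S.residual x :=
    le_ciInf fun x => (hy _).trans_eq (residual_eq x).symm
  have hsplit : S.A₁.toEuclideanLin z - WithLp.toLp 2 S.b =
      S.A₁.toEuclideanLin (z - y) + (S.A₁.toEuclideanLin y - WithLp.toLp 2 S.b) := by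
    rw [map_sub, sub_add_sub_cancel]
  rw [sub_le_iff_le_add, residual_eq, hsplit]
  exact (norm_add_le _ _).trans (add_le_add (norm_toEuclideanLin_le _ _) hmin)

theorem residual_sub_iInf_eq_zero (h : specNorm S.A₁ = 0) (x : Fin S.M → ℂ) :
    S.residual x - ⨅ x, S.residual x = 0 := by
  have hconst (x : Fin S.M → ℂ) : S.residual x = ‖WithLp.toLp 2 (-S.b)‖ := by
    rw [FactorizedSystem.residual, FactorizedSystem.A, eq_zero_of_specNorm_eq_zero h,
      Matrix.zero_mul, Matrix.zero_mulVec, zero_sub]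
  simp only [hconst, ciInf_const, sub_self]

/-! ### The algorithm -/

/-- The program that estimates `A₁† b` in array 5. -/
def rhsProg : Prog :=
  assignEach 5 (estimate (.lit 1) (.ub (.reg 11)) (.entry 2 zeroExp zeroExp))
    (.mul (.entry 0 (.reg 11) zeroExp) (.div (.entry 8 zeroExp zeroExp) (.ofNat (.reg 6))))

/-- The program that approximates a minimizer `y` of `‖A₁ y - b‖` in array 5. -/
def leastSquaresProg : Prog :=
  .seq rhsProg (.seq (solveProg 0 gramQueryU 2) (fill 5 (.entry 6 (.reg 11) zeroExp)))

/-- The program that solves `A₂ A₂† z = y` approximately, for `y` in array 5, and writes the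
coefficients of `A₂† z` to array 3. -/
def outputProg : Prog :=
  .seq (fill 6 (.lit 0)) (.seq (solveProg 1 gramQueryV 4)
    (fill 3 (.mul (.entry 1 (.reg 11) zeroExp) (.entry 6 (.reg 11) zeroExp))))

/-- The hybrid algorithm. -/
def mainProg : Prog :=
  .ite (.reLE (inputExp 2) (.lit 0)) .skip (.seq paramProg (.seq leastSquaresProg outputProg))

theorem natWrites_rhsProg : rhsProg.natWrites = {11, 12, 13} := by
  rw [rhsProg, natWrites_assignEach, natWrites_estimate]

theorem numWrites_rhsProg : rhsProg.numWrites = {5, 8, 9} := by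
  rw [rhsProg, numWrites_assignEach, numWrites_estimate]

section Correctness

theorem likely_rhsProg (h : Ready S ε k s) (h₁ : 0 < specNorm S.A₁) (hm0 : 0 < S.samples ε k)
    (hη : 0 ≤ S.precision ε) :
    Likely S rhsProg s (S.R * S.estimateFailure ε k) fun s' =>
      ‖s'.vec 5 S.R - S.A₁.toEuclideanLin.adjoint (WithLp.toLp 2 S.b)‖ ≤
        √S.R * (2 * (specNorm S.A₁ * (S.normB * S.precision ε))) := by
  have hB := S.normB_pos
  set g := S.A₁.toEuclideanLin.adjoint (WithLp.toLp 2 S.b)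
  set δ := 2 * (specNorm S.A₁ * (S.normB * S.precision ε))
  refine (likely_assignEach (Good := fun i z => ‖z - g i‖ ≤ δ) h.rank
    (by rw [numWrites_estimate]; decide) (by rw [natWrites_estimate]; decide)
    fun i s₁ hs₁ hi => ?_).mono le_rfl fun s' _ hs' => ?_
  · rw [natWrites_estimate, numWrites_estimate] at hs₁
    have hr₁ := h.of_unchanged (hs₁.mono (by decide) (by decide))
    refine (likely_estimate_div (n := 1) (d := fun _ => S.normB)
      (μ := fun _ => star (S.circU i).state ⬝ᵥ S.circB.state) hr₁.samples hm0 rfl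
      (fun j s₂ hs₂ _ => ⟨?_, ?_⟩) hB hη ?_).mono le_rfl fun s₂ hs₂ hx => ?_
    · exact (hr₁.of_unchanged (hs₂.mono (by decide) (by decide))).normB
    · simp only [Query.mean, NatExp.eval, hs₂.nat_eq 11 (by decide), hi, lookup_of_lt]
    · simp
    · have hu := FactorizedSystem.unchanged_of_mem_support (natWrites_estimate ..).le
        (numWrites_estimate ..).le hs₂
      have hr₂ := hr₁.of_unchanged (hu.mono (by decide) (by decide))
      rw [Fin.sum_const, one_smul] at hx
      simp only [NumExp.eval, NatExp.eval, (hu.nat_eq 11 (by decide)).trans hi, hr₂.normU,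
        hr₂.samples]
      rw [adjoint_A₁_b_apply, ← mul_sub, norm_mul, Complex.norm_real,
        Real.norm_of_nonneg (S.normU_nonneg i)]
      calc S.normU i * _ ≤ specNorm S.A₁ * (2 * (S.normB * S.precision ε)) := by
            gcongr
            have hC := boundedColumns_normU h₁
            exact weight_le hC.nonneg hC.prepares hC.norm_le i
        _ = δ := by ring
  · simpa only [Fintype.card_fin] using
      norm_le_sqrt_card_mul (x := s'.vec 5 S.R - g) (by positivity) hs'

theorem natWrites_leastSquaresProg : leastSquaresProg.natWrites = {10, 11, 12, 13} := by
  simp only [leastSquaresProg, Prog.natWrites, natWrites_rhsProg, natWrites_solveProg, fill,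
    natWrites_assignEach]
  decide

theorem numWrites_leastSquaresProg : leastSquaresProg.numWrites = {5, 6, 7, 8, 9} := by
  simp only [leastSquaresProg, Prog.numWrites, numWrites_rhsProg, numWrites_solveProg, fill,
    numWrites_assignEach]
  decide

theorem Ready.of_mem_support {P : Prog} (h : Ready S ε k s)
    (hV : P.natWrites ⊆ {10, 11, 12, 13}) (hW : P.numWrites ⊆ {5, 6, 7, 8, 9})
    (hs' : s' ∈ (S.final P s).support) : Ready S ε k s' :=
  h.of_unchanged (FactorizedSystem.unchanged_of_mem_support hV hW hs')

theorem vec_six_of_mem_support_rhsProg (hs' : s' ∈ (S.final rhsProg s).support) :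
    s'.vec 6 S.R = s.vec 6 S.R :=
  (FactorizedSystem.unchanged_of_mem_support natWrites_rhsProg.le numWrites_rhsProg.le hs').vec_eq
    (by decide) S.R

theorem output_error_le (h₁ : 0 < specNorm S.A₁) (h₂ : 0 < specNorm S.A₂) (hε : 0 < ε) :
    specNorm S.A₁ * (specNorm S.A₂ * (specNorm S.A₂ *
      (2 * (3 * (S.normB / minSingularValue S.A₁) / minSingularValue S.A₂ ^ 2) / S.reduction ε)) +
        2 * (S.normB / minSingularValue S.A₁) / S.reduction ε) ≤ ε := by
  have hρ₁ := minSingularValue_pos h₁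
  have hρ₂ := minSingularValue_pos h₂
  have hB := S.normB_pos
  have hX := one_pos.trans (FactorizedSystem.one_lt_reduction h₁ h₂ hε)
  have hκ₁ := one_pos.trans_le (FactorizedSystem.one_le_condNumber h₁)
  have hκ₂ : 1 ≤ condNumber S.A₂ * condNumber S.A₂ := one_le_mul_of_one_le_of_one_le
    (FactorizedSystem.one_le_condNumber h₂) (FactorizedSystem.one_le_condNumber h₂)
  calc _ = condNumber S.A₁ * S.normB * (6 * (condNumber S.A₂ * condNumber S.A₂) + 2 * 1) /
        S.reduction ε := by
        rw [condNumber, condNumber]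
        field_simp
        ring
    _ ≤ condNumber S.A₁ * S.normB * (6 * (condNumber S.A₂ * condNumber S.A₂) +
        2 * (condNumber S.A₂ * condNumber S.A₂)) / S.reduction ε := by gcongr
    _ ≤ ε := by
        rw [div_le_iff₀ hX, FactorizedSystem.reduction, mul_one_add, mul_div_cancel₀ _ hε.ne']
        linarith

theorem residual_combine_sub_iInf_le {y g z t : EuclideanSpace ℂ (Fin S.R)} {c : Fin S.R → ℂ}
    {δ δ' : ℝ} (h₂ : 0 < specNorm S.A₂)
    (hy : S.A₁.toEuclideanLin.adjoint (S.A₁.toEuclideanLin y) =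
      S.A₁.toEuclideanLin.adjoint (WithLp.toLp 2 S.b))
    (hg : ‖g - y‖ ≤ δ')
    (hz : (columnMatrix S.normV S.circV).toEuclideanLin.adjoint
      ((columnMatrix S.normV S.circV).toEuclideanLin z) = g)
    (ht : ‖t - z‖ ≤ δ) (hc : ∀ i, c i = S.normV i * t i) :
    S.residual (S.combine c) - ⨅ x, S.residual x ≤
      specNorm S.A₁ * (specNorm S.A₂ * (specNorm S.A₂ * δ) + δ') := by
  refine (residual_sub_iInf_le (norm_apply_sub_le_of_adjoint_apply_eq hy) _).trans ?_
  have hV := boundedColumns_normV h₂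
  rw [toLp_combine hc, ← adjoint_columnMatrix_normV]
  set W := (columnMatrix S.normV S.circV).toEuclideanLin
  have hsplit : W.adjoint (W t) - y = W.adjoint (W (t - z)) + (g - y) := by
    rw [← hz, map_sub, map_sub, sub_add_sub_cancel]
  refine mul_le_mul_of_nonneg_left ?_ (specNorm_nonneg _)
  rw [hsplit]
  refine (norm_add_le _ _).trans (add_le_add ?_ hg)
  calc ‖W.adjoint (W (t - z))‖ ≤ specNorm S.A₂ * ‖W (t - z)‖ :=
        norm_adjoint_apply_le hV.pos.le hV.norm_le _
    _ ≤ specNorm S.A₂ * (specNorm S.A₂ * ‖t - z‖) := by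
        gcongr
        exact hV.norm_le _
    _ ≤ specNorm S.A₂ * (specNorm S.A₂ * δ) := by gcongr

variable (h₁ : 0 < specNorm S.A₁) (h₂ : 0 < specNorm S.A₂) (hR : 0 < S.R) (hε : 0 < ε)

include h₁ h₂ hR hε

theorem likely_solve_leastSquares (h : Ready S ε k s) (h0 : s.vec 6 S.R = 0)
    {y : EuclideanSpace ℂ (Fin S.R)} (hy : y ∈ S.A₁.toEuclideanLin.kerᗮ)
    (hyb : S.A₁.toEuclideanLin.adjoint (S.A₁.toEuclideanLin y) =
      S.A₁.toEuclideanLin.adjoint (WithLp.toLp 2 S.b))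
    (hs : ‖s.vec 5 S.R - S.A₁.toEuclideanLin.adjoint (WithLp.toLp 2 S.b)‖ ≤
      √S.R * (2 * (specNorm S.A₁ * (S.normB * S.precision ε)))) :
    Likely S (solveProg 0 gramQueryU 2) s (S.steps ε * (S.R * S.estimateFailure ε k)) fun s' =>
      ‖s'.vec 6 S.R - y‖ ≤ 2 * (S.normB / minSingularValue S.A₁) / S.reduction ε := by
  have hB := S.normB_pos
  have hρ := minSingularValue_pos h₁
  have hρσ := minSingularValue_le_specNorm S.A₁
  have hη := FactorizedSystem.precision_nonneg h₁ h₂ hε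
  have hyY : ‖y‖ ≤ S.normB / minSingularValue S.A₁ := by
    rw [le_div_iff₀ hρ, mul_comm, ← norm_toLp_b]
    exact (minSingularValue_mul_norm_le _ hy).trans (norm_apply_le_of_adjoint_apply_eq hyb)
  refine likely_solve_accurate (boundedColumns_normU h₁) h.gramAccessU
    (FactorizedSystem.samples_pos h₁ h₂ hR hε) (by positivity) hη h.steps h0 hρ hρσ
    (fun _ => minSingularValue_mul_norm_le S.A₁) hyY hy ?_
    (FactorizedSystem.one_lt_reduction h₁ h₂ hε).le
    (FactorizedSystem.reduction_le_two_pow h₁ h₂ hR hε)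
    FactorizedSystem.sq_condNumber_A₁_mul_le_steps
    (FactorizedSystem.precision_mul_eq_one h₁ h₂ hR hε).le
  change ‖_ • (s.vec 5 S.R - S.A₁.toEuclideanLin.adjoint (S.A₁.toEuclideanLin y))‖ ≤ _
  rw [hyb, norm_smul, Complex.norm_real, Real.norm_of_nonneg (by positivity)]
  calc _ ≤ (specNorm S.A₁ ^ 2)⁻¹ *
        (√S.R * (2 * (specNorm S.A₁ * (S.normB * S.precision ε)))) := by gcongr
    _ = √S.R * (2 * (S.normB / specNorm S.A₁) * S.precision ε) := by field_simp
    _ ≤ √S.R * (6 * (S.normB / minSingularValue S.A₁) * S.precision ε) := by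
        gcongr
        norm_num

theorem likely_leastSquaresProg (h : Ready S ε k s) (h0 : s.vec 6 S.R = 0)
    {y : EuclideanSpace ℂ (Fin S.R)} (hy : y ∈ S.A₁.toEuclideanLin.kerᗮ)
    (hyb : S.A₁.toEuclideanLin.adjoint (S.A₁.toEuclideanLin y) =
      S.A₁.toEuclideanLin.adjoint (WithLp.toLp 2 S.b)) :
    Likely S leastSquaresProg s
      (S.R * S.estimateFailure ε k + S.steps ε * (S.R * S.estimateFailure ε k)) fun s' =>
      ‖s'.vec 5 S.R - y‖ ≤ 2 * (S.normB / minSingularValue S.A₁) / S.reduction ε := by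
  rw [leastSquaresProg, ← add_zero ((S.steps ε : ℝ≥0∞) * _)]
  refine (likely_rhsProg h h₁ (FactorizedSystem.samples_pos h₁ h₂ hR hε)
    (FactorizedSystem.precision_nonneg h₁ h₂ hε)).seq fun s₁ hs₁ hb => ?_
  have hr₁ : Ready S ε k s₁ :=
    h.of_mem_support (by rw [natWrites_rhsProg]; decide) (by rw [numWrites_rhsProg]; decide) hs₁
  have h0₁ := (vec_six_of_mem_support_rhsProg hs₁).trans h0
  refine (likely_solve_leastSquares h₁ h₂ hR hε hr₁ h0₁ hy hyb hb).seq fun s₂ hs₂ hacc => ?_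
  have hr₂ := hr₁.of_mem_support (natWrites_solveProg ..).le
    (by rw [numWrites_solveProg]; decide) hs₂
  refine (likely_fill (x := s₂.vec 6 S.R) hr₂.rank fun i s' hs' hi => ?_).mono le_rfl
    fun s' _ hs' => hs' ▸ hacc
  simp only [NumExp.eval, NatExp.eval, hi, hs'.num_eq 6 (by decide), Store.vec_apply]

theorem likely_solve_output (hrank : S.A₂.rank = S.R) (h : Ready S ε k s) (h0 : s.vec 6 S.R = 0)
    {z : EuclideanSpace ℂ (Fin S.R)} {G : ℝ} (hG : 0 < G) (hs : ‖s.vec 5 S.R‖ ≤ G)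
    (hz : (columnMatrix S.normV S.circV).toEuclideanLin.adjoint
      ((columnMatrix S.normV S.circV).toEuclideanLin z) = s.vec 5 S.R) :
    Likely S (solveProg 1 gramQueryV 4) s (S.steps ε * (S.R * S.estimateFailure ε k)) fun s' =>
      ‖s'.vec 6 S.R - z‖ ≤ 2 * (G / minSingularValue S.A₂ ^ 2) / S.reduction ε := by
  have hρ := minSingularValue_pos h₂
  have hη := FactorizedSystem.precision_nonneg h₁ h₂ hε
  have hlow := mul_norm_le_norm_columnMatrix_normV hrank
  have hzY : ‖z‖ ≤ G / minSingularValue S.A₂ ^ 2 := by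
    rw [le_div_iff₀ (by positivity), mul_comm]
    exact ((sq_mul_norm_le_norm_adjoint_apply hρ.le hlow z).trans_eq (by rw [hz])).trans hs
  refine likely_solve_accurate (boundedColumns_normV h₂) h.gramAccessV
    (FactorizedSystem.samples_pos h₁ h₂ hR hε) (by positivity) hη h.steps h0 hρ
    (minSingularValue_le_specNorm _) (fun y _ => hlow y) hzY ?_ ?_
    (FactorizedSystem.one_lt_reduction h₁ h₂ hε).le
    (FactorizedSystem.reduction_le_two_pow h₁ h₂ hR hε)
    FactorizedSystem.sq_condNumber_A₂_mul_le_steps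
    (FactorizedSystem.precision_mul_eq_one h₁ h₂ hR hε).le
  · rw [ker_columnMatrix_normV_eq_bot hrank, Submodule.bot_orthogonal_eq_top]
    exact Submodule.mem_top
  · rw [hz, sub_self, smul_zero, norm_zero]
    positivity

theorem likely_outputProg (hrank : S.A₂.rank = S.R) (h : Ready S ε k s)
    {y : EuclideanSpace ℂ (Fin S.R)} (hy : y ∈ S.A₁.toEuclideanLin.kerᗮ)
    (hyb : S.A₁.toEuclideanLin.adjoint (S.A₁.toEuclideanLin y) =
      S.A₁.toEuclideanLin.adjoint (WithLp.toLp 2 S.b))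
    (hs : ‖s.vec 5 S.R - y‖ ≤ 2 * (S.normB / minSingularValue S.A₁) / S.reduction ε) :
    Likely S outputProg s (S.steps ε * (S.R * S.estimateFailure ε k)) fun s' =>
      S.residual (S.combine (S.output s')) - ⨅ x, S.residual x ≤ ε := by
  have hB := S.normB_pos
  have hρ := minSingularValue_pos h₁
  obtain ⟨z, hz⟩ := exists_adjoint_apply_apply_eq (minSingularValue_pos h₂)
    (mul_norm_le_norm_columnMatrix_normV hrank) (s.vec 5 S.R)
  rw [outputProg, ← zero_add ((S.steps ε : ℝ≥0∞) * _), ← add_zero ((S.steps ε : ℝ≥0∞) * _)]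
  refine (likely_fill (x := 0) h.rank fun i s' _ _ =>
    by simp [NumExp.eval]).seq fun s₁ hs₁ h0 => ?_
  have hu₁ := FactorizedSystem.unchanged_of_mem_support (natWrites_assignEach ..).le
    (numWrites_assignEach ..).le hs₁
  have hr₁ : Ready S ε k s₁ := h.of_unchanged (hu₁.mono (by decide) (by decide))
  have h5 : s₁.vec 5 S.R = s.vec 5 S.R := hu₁.vec_eq (by decide) S.R
  have hG : ‖s₁.vec 5 S.R‖ ≤ 3 * (S.normB / minSingularValue S.A₁) := by
    have hyY : ‖y‖ ≤ S.normB / minSingularValue S.A₁ := by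
      rw [le_div_iff₀ hρ, mul_comm, ← norm_toLp_b]
      exact (minSingularValue_mul_norm_le _ hy).trans (norm_apply_le_of_adjoint_apply_eq hyb)
    have hX : 2 * (S.normB / minSingularValue S.A₁) / S.reduction ε ≤ _ :=
      div_le_self (by positivity) (FactorizedSystem.one_lt_reduction h₁ h₂ hε).le
    rw [h5]
    linarith [norm_le_norm_sub_add (s.vec 5 S.R) y]
  refine (likely_solve_output h₁ h₂ hR hε hrank hr₁ h0 (by positivity) hG
    (hz.trans h5.symm)).seq fun s₂ hs₂ ht => ?_
  have hr₂ : Ready S ε k s₂ := hr₁.of_mem_support (natWrites_solveProg ..).le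
    (by rw [numWrites_solveProg]; decide) hs₂
  refine (likely_fill (x := WithLp.toLp 2 fun i => S.normV i * s₂.vec 6 S.R i) hr₂.rank
    fun i s' hs' hi => ?_).mono le_rfl fun s₃ _ hs₃ => ?_
  · simp only [NumExp.eval, NatExp.eval, hi, hs'.num_eq 6 (by decide),
      hs'.num_eq 1 (by decide), hr₂.normV, Store.vec_apply]
  · exact (residual_combine_sub_iInf_le h₂ hyb hs hz ht fun i => congrArg (· i) hs₃).trans
      (output_error_le h₁ h₂ hε)

end Correctness

theorem holds_reLE_specNorm_A₁_iff :
    (Cond.reLE (inputExp 2) (.lit 0)).Holds (S.input ε k) ↔ specNorm S.A₁ ≤ 0 := by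
  rw [Cond.Holds, eval_inputExp rfl 2]
  simp [NumExp.eval]

theorem likely_mainProg (hR : 0 < S.R) (hε : 0 < ε) (hrank : S.A₂.rank = S.R) :
    Likely S mainProg (S.input ε k) (ENNReal.ofReal ((1 / 2 : ℝ) ^ k)) fun s' =>
      S.residual (S.combine (S.output s')) - ⨅ x, S.residual x ≤ ε := by
  by_cases h₁ : specNorm S.A₁ ≤ 0
  · exact (likely_zero_iff.2 fun s' _ => (residual_sub_iInf_eq_zero
      (h₁.antisymm (specNorm_nonneg _)) _).trans_le hε.le).mono zero_le fun _ _ h => h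
  rw [Likely, mainProg,
    FactorizedSystem.final_ite_of_not_holds (mt holds_reLE_specNorm_A₁_iff.1 h₁)]
  have h₂ := specNorm_A₂_pos hR hrank
  rw [not_le] at h₁
  obtain ⟨y, hy, hyb⟩ := exists_mem_ker_orthogonal_adjoint_apply_eq S.A₁.toEuclideanLin
    (WithLp.toLp 2 S.b)
  refine (likely_paramProg.seq fun s₁ _ hs₁ =>
    (likely_leastSquaresProg h₁ h₂ hR hε hs₁.1 hs₁.2 hy hyb).seq fun s₂ hs₂ hs =>
      likely_outputProg h₁ h₂ hR hε hrank (hs₁.1.of_mem_support natWrites_leastSquaresProg.le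
        numWrites_leastSquaresProg.le hs₂) hy hyb hs).mono ?_ fun _ _ h => h
  rw [zero_add, add_assoc]
  exact FactorizedSystem.total_failure_le h₁ h₂ hR hε

/-! ### The running time of the algorithm -/

variable {G : ℕ}

theorem timeLE_clogProg (hS : S.GatesLE G) : TimeLE S clogProg s (4 + 12 * s.nat 7) := by
  have hstatic : clogProg.StaticLoops {4, 8, 10} := by
    simp [clogProg, Prog.StaticLoops, NatExp.regs]
  refine (TimeLE.of_staticLoops hS natWrites_clogProg.le hstatic).mono (le_of_eq ?_)
  simp only [clogProg, Prog.timeBound, NatExp.eval, NatExp.cost, Cond.cost]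
  lia

theorem cost_sizeExp : sizeExp.cost = 38 := by decide

theorem cost_stepsExp : stepsExp.cost = 36 := by decide

theorem cost_samplesExp : samplesExp.cost = 91 := by decide

theorem timeLE_logProg (hS : S.GatesLE G) :
    TimeLE S logProg (S.input ε k) (43 + 13 * ⌈S.R * S.reduction ε⌉₊) := by
  have hsize := ceil_eval_sizeExp (s := S.input ε k) rfl rfl
  refine (TimeLE.ceil.seq (t' := 4 + 12 * ⌈S.R * S.reduction ε⌉₊) fun s' hs' =>
    (timeLE_clogProg hS).mono ?_).mono ?_
  · rw [FactorizedSystem.final_ceil, PMF.mem_support_pure_iff, hsize] at hs'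
    rw [hs', Store.nat_setNat, if_pos rfl]
  · rw [hsize, cost_sizeExp]
    lia

theorem timeLE_paramProg (hS : S.GatesLE G) : TimeLE S paramProg (S.input ε k)
    (172 + 13 * ⌈S.R * S.reduction ε⌉₊ + S.steps ε + S.samples ε k) := by
  refine ((timeLE_logProg hS).seq (t' := 129 + S.steps ε + S.samples ε k)
    fun s₁ hs₁ => ?_).mono (by lia)
  obtain ⟨hu, h4⟩ := likely_zero_iff.1 likely_logProg s₁ hs₁
  have hnum : s₁.num 2 = (S.input ε k).num 2 := hu.num_eq 2 (by decide)
  have hsteps := ceil_eval_stepsExp hnum h4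
  have hsamples : ⌈(samplesExp.eval (s₁.setNat 5 (S.steps ε))).re⌉₊ = S.samples ε k :=
    ceil_eval_samplesExp hnum (hu.nat_eq 0 (by decide)) (hu.nat_eq 3 (by decide)) h4 rfl
  refine (TimeLE.ceil.seq fun s₂ hs₂ => TimeLE.ceil.mono (t' := 92 + S.samples ε k) ?_).mono ?_
  · rw [FactorizedSystem.final_ceil, PMF.mem_support_pure_iff, hsteps] at hs₂
    rw [hs₂, hsamples, cost_samplesExp]
    lia
  · rw [hsteps, cost_stepsExp]
    lia

theorem timeLE_leastSquaresProg (hS : S.GatesLE G) (h : Ready S ε k s) :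
    TimeLE S leastSquaresProg s (6 + 31 * S.R + (55 + 4 * G) * S.R * S.samples ε k +
      S.steps ε * (5 + 44 * S.R + S.R ^ 2 * (3 + (65 + 4 * G) * S.samples ε k))) := by
  have hstatic : leastSquaresProg.StaticLoops {10, 11, 12, 13} := by
    simp [leastSquaresProg, rhsProg, solveProg, stepProg, fill, assignEach, estimate, sample,
      halfSample, Prog.StaticLoops, NatExp.regs]
  refine (TimeLE.of_staticLoops hS natWrites_leastSquaresProg.le hstatic).mono (le_of_eq ?_)
  simp only [leastSquaresProg, rhsProg, solveProg, stepProg, fill, assignEach, estimate, sample,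
    halfSample, gramQueryU, Query.cost, Prog.timeBound, NatExp.eval, NatExp.cost, NumExp.cost,
    h.rank, h.steps, h.samples]
  ring

theorem timeLE_outputProg (hS : S.GatesLE G) (h : Ready S ε k s) :
    TimeLE S outputProg s (6 + 18 * S.R +
      S.steps ε * (5 + 44 * S.R + S.R ^ 2 * (3 + (65 + 4 * G) * S.samples ε k))) := by
  have hstatic : outputProg.StaticLoops {10, 11, 12, 13} := by
    simp [outputProg, solveProg, stepProg, fill, assignEach, estimate, sample, halfSample,
      Prog.StaticLoops, NatExp.regs]
  have hwrites : outputProg.natWrites = {10, 11, 12, 13} := by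
    rw [outputProg, Prog.natWrites, Prog.natWrites, natWrites_solveProg, fill, fill,
      natWrites_assignEach, natWrites_assignEach]
    decide
  refine (TimeLE.of_staticLoops hS hwrites.le hstatic).mono (le_of_eq ?_)
  simp only [outputProg, solveProg, stepProg, fill, assignEach, estimate, sample, halfSample,
    gramQueryV, Query.cost, Prog.timeBound, NatExp.eval, NatExp.cost, NumExp.cost, h.rank,
    h.steps, h.samples]
  ring

theorem timeLE_mainProg (hR : 0 < S.R) (hS : S.GatesLE G) :
    TimeLE S mainProg (S.input ε k) (13 * ⌈S.R * S.reduction ε⌉₊ +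
      300 * ((S.steps ε + 1) * S.R ^ 2 * (S.samples ε k + 1) * (G + 1))) := by
  have hskip : TimeLE S .skip (S.input ε k) 1 := .of_staticLoops (V := ∅) hS subset_rfl trivial
  refine (TimeLE.ite (fun _ => hskip) fun _ => (timeLE_paramProg hS).seq fun s₁ hs₁ =>
    (timeLE_leastSquaresProg hS (likely_zero_iff.1 likely_paramProg s₁ hs₁).1).seq fun s₂ hs₂ =>
      timeLE_outputProg hS ((likely_zero_iff.1 likely_paramProg s₁ hs₁).1.of_mem_support
        natWrites_leastSquaresProg.le numWrites_leastSquaresProg.le hs₂)).mono ?_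
  obtain ⟨r, hr⟩ := Nat.exists_eq_succ_of_ne_zero hR.ne'
  generalize S.steps ε = T, S.samples ε k = m, ⌈S.R * S.reduction ε⌉₊ = N
  simp only [hr, Nat.succ_eq_add_one, Cond.cost, NumExp.cost, NatExp.cost]
  ring_nf
  lia

/-! ### A polynomial bound for the running time -/

theorem condNumber_nonneg {N M : ℕ} (A : Matrix (Fin N) (Fin M) ℂ) : 0 ≤ condNumber A :=
  div_nonneg (specNorm_nonneg _) (minSingularValue_nonneg _)

theorem clog_ceil_le_log {x : ℝ} (hx : 1 ≤ x) :
    (Nat.clog 2 ⌈x⌉₊ : ℝ) ≤ 1 + 2 * Real.log x := by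
  have hx0 := Real.log_nonneg hx
  rcases Nat.eq_zero_or_pos (Nat.clog 2 ⌈x⌉₊) with h | h
  · rw [h, Nat.cast_zero]
    positivity
  have hpow : (2 : ℝ) ^ (Nat.clog 2 ⌈x⌉₊ - 1) ≤ x := by
    by_contra! hlt
    have : ⌈x⌉₊ ≤ 2 ^ (Nat.clog 2 ⌈x⌉₊ - 1) := Nat.ceil_le.2 (by exact_mod_cast hlt.le)
    rw [← Nat.clog_le_iff_le_pow one_lt_two] at this
    lia
  have hlog := Real.log_le_log (by positivity) hpow
  rw [Real.log_pow, Nat.cast_pred h] at hlog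
  have hhalf : ((Nat.clog 2 ⌈x⌉₊ : ℝ) - 1) * (1 / 2) ≤ (Nat.clog 2 ⌈x⌉₊ - 1) * Real.log 2 := by
    have : (1 : ℝ) ≤ Nat.clog 2 ⌈x⌉₊ := Nat.one_le_cast.2 h
    gcongr
    linarith [Real.log_two_gt_d9]
  linarith

theorem clog_le_log (N : ℕ) : (Nat.clog 2 N : ℝ) ≤ 1 + 2 * Real.log N := by
  rcases Nat.eq_zero_or_pos N with rfl | hN
  · simp
  · simpa only [Nat.ceil_natCast] using clog_ceil_le_log (x := N) (Nat.one_le_cast.2 hN)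

namespace FactorizedSystem

theorem one_le_reduction (hε : 0 < ε) : 1 ≤ S.reduction ε := by
  have hκ₁ := condNumber_nonneg S.A₁
  have hκ₂ := condNumber_nonneg S.A₂
  have hB := S.normB_pos
  rw [reduction, le_add_iff_nonneg_right]
  positivity

theorem logReduction_le (hR : 0 < S.R) (hε : 0 < ε) :
    (S.logReduction ε : ℝ) ≤ 1 + 2 * Real.log S.R + 4 * √(S.reduction ε) := by
  have hR1 : (1 : ℝ) ≤ S.R := Nat.one_le_cast.2 hR
  have hX1 := one_le_reduction (S := S) hε
  have hX := one_pos.trans_le hX1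
  have hlog := clog_ceil_le_log (one_le_mul_of_one_le_of_one_le hR1 hX1)
  rw [Real.log_mul (by positivity) hX.ne'] at hlog
  have hlogX : Real.log (S.reduction ε) ≤ 2 * √(S.reduction ε) := by
    have := Real.log_le_sub_one_of_pos (Real.sqrt_pos.2 hX)
    rw [Real.log_sqrt hX.le] at this
    linarith
  rw [logReduction]
  linarith

end FactorizedSystem

/-- The parameters of a system are at most `z`, and the reciprocal of the accuracy is at most `F²`,
which makes all parameters of the algorithm bounded by monomials in `z` and `F`. -/
structure ParametersLE (S : FactorizedSystem) (ε z F : ℝ) : Prop where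
  one_le_z : 1 ≤ z
  one_le_F : 1 ≤ F
  ε_pos : 0 < ε
  inv_ε_le : 1 / ε ≤ F ^ 2
  condNumber_A₁_le : condNumber S.A₁ ≤ z
  condNumber_A₂_le : condNumber S.A₂ ≤ z
  normB_le : S.normB ≤ z
  log_R_le : Real.log S.R ≤ z

namespace ParametersLE

variable {z F : ℝ} (h : ParametersLE S ε z F) (hR : 0 < S.R)
include h

theorem one_le_pow_mul (n : ℕ) : 1 ≤ z ^ n * F :=
  one_le_mul_of_one_le_of_one_le (one_le_pow₀ h.one_le_z) h.one_le_F

theorem reduction_le : S.reduction ε ≤ 9 * (z ^ 2 * F) ^ 2 := by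
  have hone := h.one_le_pow_mul 2
  obtain ⟨hz, -, hε, hεF, hκ₁, hκ₂, hB, -⟩ := h
  have hκ₂0 := condNumber_nonneg S.A₂
  have hB0 := S.normB_pos
  calc S.reduction ε
      = 1 + 8 * condNumber S.A₁ * (condNumber S.A₂ * condNumber S.A₂) * S.normB * (1 / ε) := by
        rw [FactorizedSystem.reduction, mul_one_div]
    _ ≤ (z ^ 2 * F) ^ 2 + 8 * z * (z * z) * z * F ^ 2 := by
        gcongr
        exact one_le_pow₀ hone
    _ = 9 * (z ^ 2 * F) ^ 2 := by ring

include hR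

theorem logReduction_le : S.logReduction ε ≤ 15 * (z ^ 2 * F) := by
  have hz := h.one_le_z
  have hF := h.one_le_F
  have hz2 : z ≤ z ^ 2 * F := by
    calc z = z * 1 * 1 := by ring
      _ ≤ z * z * F := by gcongr
      _ = z ^ 2 * F := by ring
  have hsqrt : √(S.reduction ε) ≤ 3 * (z ^ 2 * F) := by
    rw [Real.sqrt_le_left (by positivity), mul_pow]
    exact h.reduction_le.trans_eq (by norm_num)
  linarith [FactorizedSystem.logReduction_le hR h.ε_pos, h.log_R_le]

theorem steps_add_one_le : S.steps ε + 1 ≤ 62 * (z ^ 4 * F) := by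
  have hκ₁ := condNumber_nonneg S.A₁
  have hκ₂ := condNumber_nonneg S.A₂
  have hz := h.one_le_z
  calc (S.steps ε + 1 : ℝ)
      ≤ 2 * (condNumber S.A₁ * condNumber S.A₁ + condNumber S.A₂ * condNumber S.A₂) *
          S.logReduction ε + 1 + 1 := by
        gcongr
        exact (Nat.ceil_lt_add_one (by positivity)).le
    _ ≤ 2 * (z * z + z * z) * (15 * (z ^ 2 * F)) + z ^ 4 * F + z ^ 4 * F := by
        gcongr
        exacts [h.condNumber_A₁_le, h.condNumber_A₁_le, h.condNumber_A₂_le, h.condNumber_A₂_le,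
          h.logReduction_le hR, h.one_le_pow_mul 4, h.one_le_pow_mul 4]
    _ = 62 * (z ^ 4 * F) := by ring

theorem samples_add_one_le (hk : 0 < k) :
    S.samples ε k + 1 ≤ 6 * 10 ^ 10 * (k * S.R * (z ^ 4 * F) ^ 7) := by
  have hk1 : (1 : ℝ) ≤ k := Nat.one_le_cast.2 hk
  have hR1 : (1 : ℝ) ≤ S.R := Nat.one_le_cast.2 hR
  have hF := h.one_le_F
  have hz := h.one_le_z
  have hX0 := zero_le_one.trans (FactorizedSystem.one_le_reduction (S := S) h.ε_pos)
  have hle : z ^ 2 * F ≤ z ^ 4 * F := by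
    gcongr
    norm_num
  have hT := h.steps_add_one_le hR
  have hy := h.one_le_pow_mul 4
  set y := z ^ 4 * F
  have hL : S.logReduction ε ≤ 15 * y := (h.logReduction_le hR).trans (by gcongr)
  have hX : S.reduction ε ≤ 9 * y ^ 2 := h.reduction_le.trans (by gcongr)
  have hsum : ((k + S.steps ε + S.logReduction ε + 3 : ℕ) : ℝ) ≤ k * (81 * y) := by
    push_cast
    nlinarith
  have hone : 1 ≤ k * S.R * y ^ 7 := one_le_mul_of_one_le_of_one_le
    (one_le_mul_of_one_le_of_one_le hk1 hR1) (one_le_pow₀ hy)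
  calc (S.samples ε k + 1 : ℝ)
      ≤ 2304 * S.R * ((S.steps ε * S.steps ε) * (S.reduction ε * S.reduction ε)) *
          ((k + S.steps ε + S.logReduction ε + 3 : ℕ) : ℝ) + 1 + 1 := by
        gcongr
        exact (Nat.ceil_lt_add_one (by positivity)).le
    _ ≤ 2304 * S.R * (((62 * y) * (62 * y)) * ((9 * y ^ 2) * (9 * y ^ 2))) * (k * (81 * y)) +
          k * S.R * y ^ 7 + k * S.R * y ^ 7 := by
        gcongr <;> linarith
    _ = 58107995138 * (k * S.R * y ^ 7) := by ring
    _ ≤ 6 * 10 ^ 10 * (k * S.R * y ^ 7) := by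
        gcongr
        norm_num

theorem ceil_mul_reduction_le :
    (⌈S.R * S.reduction ε⌉₊ : ℝ) ≤ 10 * (S.R * (z ^ 4 * F) ^ 8) := by
  have hR1 : (1 : ℝ) ≤ S.R := Nat.one_le_cast.2 hR
  have hz := h.one_le_z
  have hX0 := zero_le_one.trans (FactorizedSystem.one_le_reduction (S := S) h.ε_pos)
  have hle : z ^ 2 * F ≤ z ^ 4 * F := by
    have hF := h.one_le_F
    gcongr
    norm_num
  have hy := h.one_le_pow_mul 4
  have hX := h.reduction_le
  have hy2 := zero_le_one.trans (h.one_le_pow_mul 2)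
  set y := z ^ 4 * F
  calc (⌈S.R * S.reduction ε⌉₊ : ℝ) ≤ S.R * S.reduction ε + 1 :=
        (Nat.ceil_lt_add_one (by positivity)).le
    _ ≤ S.R * (9 * y ^ 8) + S.R * y ^ 8 := by
        gcongr
        · calc S.reduction ε ≤ 9 * y ^ 2 := hX.trans (by gcongr)
            _ ≤ 9 * y ^ 8 := by
                gcongr
                norm_num
        · exact one_le_mul_of_one_le_of_one_le hR1 (one_le_pow₀ hy)
    _ = 10 * (S.R * y ^ 8) := by ring

theorem runningTime_le (hk : 0 < k) : ((13 * ⌈S.R * S.reduction ε⌉₊ +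
      300 * ((S.steps ε + 1) * S.R ^ 2 * (S.samples ε k + 1) * (G + 1)) : ℕ) : ℝ) ≤
    2 * 10 ^ 15 * (k * S.R ^ 3 * (z ^ 4 * F) ^ 8 * (G + 1)) := by
  have hk1 : (1 : ℝ) ≤ k := Nat.one_le_cast.2 hk
  have hR1 : (1 : ℝ) ≤ S.R := Nat.one_le_cast.2 hR
  have hT := h.steps_add_one_le hR
  have hm := h.samples_add_one_le hR hk
  have hy := h.one_le_pow_mul 4
  set y := z ^ 4 * F
  have hceil := h.ceil_mul_reduction_le hR
  have hone : 1 ≤ (k * S.R ^ 2 * (G + 1) : ℝ) :=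
    one_le_mul_of_one_le_of_one_le (one_le_mul_of_one_le_of_one_le hk1 (one_le_pow₀ hR1))
      (le_add_of_nonneg_left (Nat.cast_nonneg G))
  push_cast
  calc 13 * (⌈S.R * S.reduction ε⌉₊ : ℝ) +
        300 * ((S.steps ε + 1) * S.R ^ 2 * (S.samples ε k + 1) * (G + 1))
      ≤ 13 * (10 * (S.R * y ^ 8) * (k * S.R ^ 2 * (G + 1))) +
          300 * (62 * y * S.R ^ 2 * (6 * 10 ^ 10 * (k * S.R * y ^ 7)) * (G + 1)) := by
        gcongr
        exact hceil.trans (le_mul_of_one_le_right (by positivity) hone)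
    _ = 1116000000000130 * (k * S.R ^ 3 * y ^ 8 * (G + 1)) := by ring
    _ ≤ 2 * 10 ^ 15 * (k * S.R ^ 3 * y ^ 8 * (G + 1)) := by
        gcongr
        norm_num

end ParametersLE

/-! ### The running time in terms of the size of the input -/

namespace FactorizedSystem

variable (S) in
/-- The sum of the five quantities in which the bound for the running time is polynomial, plus one.
-/
def scale : ℝ :=
  1 + (condNumber S.A₁ + condNumber S.A₂ + Real.log S.M + Real.log S.N + S.normB)

variable (S) in
/-- A bound, at least one, for `1 + d²` for each of the depths `d` that `D` allows. -/
def depthScale (D : Polynomial ℝ) : ℝ :=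
  2 + D.eval (Real.log S.N) ^ 2 + D.eval (Real.log S.M) ^ 2

variable {D : Polynomial ℝ} {c : ℝ}

theorem one_le_scale : 1 ≤ S.scale := by
  have hκ₁ := condNumber_nonneg S.A₁
  have hκ₂ := condNumber_nonneg S.A₂
  have hB := S.normB_pos
  rw [scale, le_add_iff_nonneg_right]
  positivity

theorem le_scale : condNumber S.A₁ ≤ S.scale ∧ condNumber S.A₂ ≤ S.scale ∧
    Real.log S.M ≤ S.scale ∧ Real.log S.N ≤ S.scale ∧ S.normB ≤ S.scale := by
  have hκ₁ := condNumber_nonneg S.A₁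
  have hκ₂ := condNumber_nonneg S.A₂
  have hM := Real.log_natCast_nonneg S.M
  have hN := Real.log_natCast_nonneg S.N
  have hB := S.normB_pos
  rw [scale]
  refine ⟨?_, ?_, ?_, ?_, ?_⟩ <;> linarith

theorem one_le_depthScale : 1 ≤ S.depthScale D := by
  rw [depthScale]
  linarith [sq_nonneg (D.eval (Real.log S.N)), sq_nonneg (D.eval (Real.log S.M))]

theorem length_gates_le {N : ℕ} (C : Circuit (Nat.clog 2 N)) {d z : ℝ} (hd : C.depth ≤ d)
    (hz : 1 ≤ z) (hN : Real.log N ≤ z) : C.gates.length ≤ 3 * z * (1 + d ^ 2) :=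
  calc (C.gates.length : ℝ) ≤ C.depth * Nat.clog 2 N := by exact_mod_cast C.length_gates_le
    _ ≤ (1 + d ^ 2) * (3 * z) := by
        gcongr
        · nlinarith [sq_nonneg (d - 1)]
        · linarith [clog_le_log N]
    _ = 3 * z * (1 + d ^ 2) := mul_comm _ _

theorem gatesLE (hD : S.DepthBound D) : S.GatesLE ⌊3 * S.scale * S.depthScale D⌋₊ := by
  have hz := S.one_le_scale
  obtain ⟨-, -, hzM, hzN, -⟩ := S.le_scale
  have hN : 3 * S.scale * (1 + D.eval (Real.log S.N) ^ 2) ≤ 3 * S.scale * S.depthScale D := by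
    rw [depthScale]
    refine mul_le_mul_of_nonneg_left ?_ (by positivity)
    linarith [sq_nonneg (D.eval (Real.log S.M))]
  have hM : 3 * S.scale * (1 + D.eval (Real.log S.M) ^ 2) ≤ 3 * S.scale * S.depthScale D := by
    rw [depthScale]
    refine mul_le_mul_of_nonneg_left ?_ (by positivity)
    linarith [sq_nonneg (D.eval (Real.log S.N))]
  exact ⟨fun j => Nat.le_floor ((length_gates_le _ (hD.1 j) hz hzN).trans hN),
    fun j => Nat.le_floor ((length_gates_le _ (hD.2.1 j) hz hzM).trans hM),
    Nat.le_floor ((length_gates_le _ hD.2.2 hz hzN).trans hN)⟩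

theorem R_le_M (hrank : S.A₂.rank = S.R) : S.R ≤ S.M :=
  hrank.symm.trans_le S.A₂.rank_le_width

theorem sq_minSingularValue_A₂_le_Γ (hR : 0 < S.R) (hrank : S.A₂.rank = S.R) :
    minSingularValue S.A₂ ^ 2 ≤ S.Γ := by
  have hV : minSingularValue S.A₂ ≤ S.normV ⟨0, hR⟩ :=
    le_weight S.normV_nonneg S.preparesV (mul_norm_le_norm_columnMatrix_normV hrank) _
  have h0 := minSingularValue_nonneg (A := S.A₂)
  calc minSingularValue S.A₂ ^ 2 ≤ S.normV ⟨0, hR⟩ ^ 2 := by gcongr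
    _ ≤ S.Γ := (le_max_right _ _).trans (le_ciSup (f := fun j : Fin S.R =>
        max (max (S.normU j ^ 2) (S.normU j * S.normB)) (S.normV j ^ 2))
        (Set.finite_range _).bddAbove ⟨0, hR⟩)

theorem one_le_mul_sq_Γ (hc : 0 < c) (hR : 0 < S.R) (hrank : S.A₂.rank = S.R)
    (h : c ≤ max S.Γ (specNorm S.A₂)) :
    1 ≤ ((c ^ 2)⁻¹ + (c ^ 4)⁻¹) * (S.Γ ^ 2 * condNumber S.A₂ ^ 4) := by
  have hA := specNorm_A₂_pos hR hrank
  have hρ := minSingularValue_pos hA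
  have hκ := one_le_pow₀ (n := 4) (one_le_condNumber hA)
  rw [add_mul]
  rcases le_max_iff.1 h with hΓ | hA₂
  · have hle : c ^ 2 ≤ S.Γ ^ 2 * condNumber S.A₂ ^ 4 :=
      (pow_le_pow_left₀ hc.le hΓ 2).trans (le_mul_of_one_le_right (sq_nonneg _) hκ)
    exact ((one_le_inv_mul₀ (by positivity)).2 hle).trans
      (le_add_of_nonneg_right (by positivity))
  · have hle : c ^ 4 ≤ S.Γ ^ 2 * condNumber S.A₂ ^ 4 :=
      calc c ^ 4 ≤ (minSingularValue S.A₂ * condNumber S.A₂) ^ 4 := by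
            rw [condNumber, mul_div_cancel₀ _ hρ.ne']
            gcongr
        _ = (minSingularValue S.A₂ ^ 2) ^ 2 * condNumber S.A₂ ^ 4 := by ring
        _ ≤ S.Γ ^ 2 * condNumber S.A₂ ^ 4 := by
            gcongr
            exact sq_minSingularValue_A₂_le_Γ hR hrank
    exact ((one_le_inv_mul₀ (by positivity)).2 hle).trans
      (le_add_of_nonneg_left (by positivity))

theorem parametersLE (hc : 0 < c) (hR : 0 < S.R) (hrank : S.A₂.rank = S.R) (hε : 0 < ε)
    (hεc : ε ≤ 1 / c) : ParametersLE S ε S.scale √((1 + 1 / c) / ε) := by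
  obtain ⟨hκ₁, hκ₂, hM, -, hB⟩ := S.le_scale
  have hRM : Real.log S.R ≤ Real.log S.M :=
    Real.log_le_log (Nat.cast_pos.2 hR) (Nat.cast_le.2 (R_le_M hrank))
  refine ⟨one_le_scale, ?_, hε, ?_, hκ₁, hκ₂, hB, hRM.trans hM⟩
  · rw [Real.one_le_sqrt, one_le_div hε]
    linarith
  · rw [Real.sq_sqrt (by positivity)]
    gcongr
    exact le_add_of_nonneg_right (by positivity)

end FactorizedSystem

/-- The polynomial in `κ(A₁), κ(A₂), log M, log N, ‖b‖` that bounds the running time when the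
circuits have depths bounded by `D`. -/
def timePolynomial (K : ℝ) (D : Polynomial ℝ) : MvPolynomial (Fin 5) ℝ :=
  MvPolynomial.C K * (1 + ∑ i, MvPolynomial.X i) ^ 37 *
    (2 + D.eval₂ MvPolynomial.C (MvPolynomial.X 3) ^ 2 +
      D.eval₂ MvPolynomial.C (MvPolynomial.X 2) ^ 2)

theorem eval_timePolynomial (K : ℝ) (D : Polynomial ℝ) :
    MvPolynomial.eval ![condNumber S.A₁, condNumber S.A₂, Real.log S.M, Real.log S.N, S.normB]
      (timePolynomial K D) = K * S.scale ^ 37 * S.depthScale D := by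
  have heval (v : Fin 5 → ℝ) (i : Fin 5) :
      MvPolynomial.eval v (D.eval₂ MvPolynomial.C (MvPolynomial.X i)) = D.eval (v i) := by
    have hC : (MvPolynomial.eval v).comp MvPolynomial.C = RingHom.id ℝ := by
      ext
      simp
    rw [Polynomial.hom_eval₂, hC, MvPolynomial.eval_X, Polynomial.eval₂_id]
  simp [timePolynomial, heval, FactorizedSystem.scale, FactorizedSystem.depthScale,
    Fin.sum_univ_five]

/-- The constant of the bound for the running time, in terms of the lower bound `c` for
`max {Γ, ‖A₂‖}`. -/
def timeConstant (c : ℝ) : ℝ := 8 * 10 ^ 15 * (1 + 1 / c) ^ 4 * ((c ^ 2)⁻¹ + (c ^ 4)⁻¹)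

theorem timeLE_mainProg_timePolynomial {c : ℝ} (hc : 0 < c) {D : Polynomial ℝ} (hR : 0 < S.R)
    (hrank : S.A₂.rank = S.R) (hD : S.DepthBound D) (hsize : c ≤ max S.Γ (specNorm S.A₂))
    (hε : 0 < ε) (hεc : ε ≤ 1 / c) (hk : 0 < k) {o : Store × ℕ}
    (ho : o ∈ (S.run mainProg (S.input ε k)).support) :
    o.2 ≤ k * (S.R ^ 3 * S.Γ ^ 2 * MvPolynomial.eval ![condNumber S.A₁, condNumber S.A₂,
      Real.log S.M, Real.log S.N, S.normB] (timePolynomial (timeConstant c) D) / ε ^ 4) := by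
  have hz := S.one_le_scale
  have hd := S.one_le_depthScale (D := D)
  have hκ₂ := condNumber_nonneg S.A₂
  have hF : √((1 + 1 / c) / ε) ^ 8 = (1 + 1 / c) ^ 4 / ε ^ 4 := by
    rw [← div_pow, show 8 = 2 * 4 by rfl, pow_mul, Real.sq_sqrt (by positivity)]
  have hG : (⌊3 * S.scale * S.depthScale D⌋₊ : ℝ) + 1 ≤ 4 * S.scale * S.depthScale D := by
    linarith [Nat.floor_le (a := 3 * S.scale * S.depthScale D) (by positivity),
      one_le_mul_of_one_le_of_one_le hz hd]
  have hΓ : 1 ≤ ((c ^ 2)⁻¹ + (c ^ 4)⁻¹) * (S.Γ ^ 2 * S.scale ^ 4) :=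
    (FactorizedSystem.one_le_mul_sq_Γ hc hR hrank hsize).trans (by gcongr; exact S.le_scale.2.1)
  rw [eval_timePolynomial, timeConstant]
  calc (o.2 : ℝ)
      ≤ 2 * 10 ^ 15 * (k * S.R ^ 3 * (S.scale ^ 4 * √((1 + 1 / c) / ε)) ^ 8 *
          (⌊3 * S.scale * S.depthScale D⌋₊ + 1)) :=
        (Nat.cast_le.2 (timeLE_mainProg hR (FactorizedSystem.gatesLE hD) o ho)).trans
          ((FactorizedSystem.parametersLE hc hR hrank hε hεc).runningTime_le hR hk)
    _ = 2 * 10 ^ 15 * (k * S.R ^ 3 * S.scale ^ 32 * ((1 + 1 / c) ^ 4 / ε ^ 4) *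
          (⌊3 * S.scale * S.depthScale D⌋₊ + 1)) * 1 := by
        rw [mul_pow, hF]
        ring
    _ ≤ 2 * 10 ^ 15 * (k * S.R ^ 3 * S.scale ^ 32 * ((1 + 1 / c) ^ 4 / ε ^ 4) *
          (4 * S.scale * S.depthScale D)) *
          (((c ^ 2)⁻¹ + (c ^ 4)⁻¹) * (S.Γ ^ 2 * S.scale ^ 4)) := by
        gcongr
    _ = _ := by ring

end Hybrid

end

theorem mainTheorem4 :
    ∃ P : Hybrid.Prog, ∀ c : ℝ, 0 < c → ∀ D : Polynomial ℝ, ∃ p : MvPolynomial (Fin 5) ℝ,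
      ∀ S : Hybrid.FactorizedSystem, 0 < S.R → S.A₂.rank = S.R → S.DepthBound D →
        c ≤ max S.Γ (Hybrid.specNorm S.A₂) →
        ∀ ε : ℝ, 0 < ε → ε ≤ 1 / c → ∀ k : ℕ, 0 < k →
          (∀ o ∈ (S.run P (S.input ε k)).support, (o.2 : ℝ) ≤
            k * ((S.R : ℝ) ^ 3 * S.Γ ^ 2 *
              MvPolynomial.eval ![Hybrid.condNumber S.A₁, Hybrid.condNumber S.A₂,
                Real.log S.M, Real.log S.N, S.normB] p / ε ^ 4)) ∧
          1 - (1 / 2 : ℝ) ^ k ≤ ((S.run P (S.input ε k)).toOuterMeasure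
            {o | S.residual (S.combine (S.output o.1)) - ⨅ x, S.residual x ≤ ε}).toReal := by
  refine ⟨Hybrid.mainProg, fun c hc D => ⟨Hybrid.timePolynomial (Hybrid.timeConstant c) D,
    fun S hR hrank hdepth hsize ε hε hεc k hk =>
      ⟨fun o => Hybrid.timeLE_mainProg_timePolynomial hc hR hrank hdepth hsize hε hεc hk, ?_⟩⟩⟩
  refine Hybrid.one_sub_le_toReal_toOuterMeasure (by positivity) ?_
  have hlikely := Hybrid.likely_mainProg (k := k) hR hε hrank
  rwa [Hybrid.Likely, Hybrid.FactorizedSystem.final, PMF.toOuterMeasure_map_apply] at hlikely
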